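/- **Setting.** Let $(M,g)$ be a smooth pseudo-Riemannian four-manifold (any signature) of constant curvature with cosmological constant $\Lambda\neq0$: $[\nabla_a,\nabla_b]\omega_c=-R_{ab}{}^d{}_c\omega_d$ with $R_{ab}{}^d{}_c=\frac{\Lambda}{3}(\delta^d_a g_{bc}-\delta^d_b g_{ac})$. Let $U$ be an open subset of a coordinate domain of $M$; all tensor fields below are smooth fields on $U$. Round brackets denote symmetrisation with unit weight, $(\cdots)_\circ$ its trace-free part, $\nabla.T=\nabla^aT_{a\cdots}$, $\Delta=\nabla^a\nabla_a$, and $\bar T$ is the trace $g^{ab}T_{ab\cdots}$. **Partially massless (PM) theory.** For a symmetric $\varphi_{abc}$ and a scalar $\chi$, the maximal-depth PM spin-three system is $$\Delta\varphi_{abc}-\tfrac{5\Lambda}{3}\varphi_{abc}-3\nabla_{(a}\nabla.\varphi_{bc)}+3\nabla_{(a}\nabla_b\bar\varphi_{c)}-3g_{(ab}\Delta\bar\varphi_{c)}+3g_{(ab}\nabla^d\nabla^e\varphi_{c)de}-\tfrac32 g_{(ab}\nabla_{c)}\nabla.\bar\varphi+3g_{(ab}\nabla_{c)}\chi=0,$$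 $$\Delta\chi+\tfrac{\Lambda}{3}\nabla.\bar\varphi=0 ,$$ its constraints are $$\nabla_{(a}\nabla_{b)_\circ}\chi-\Lambda\nabla.\varphi_{(ab)_\circ}+2\Lambda\nabla_{(a}\bar\varphi_{b)_\circ}=0,\qquad \nabla_a\chi+\tfrac{\Lambda}{3}\bar\varphi_a=0,$$ and its gauge transformation with scalar parameter $\varsigma$ is $$\delta\varphi_{abc}=\bigl(\nabla_{(a}\nabla_{(b}\nabla_{c)_\circ)}+\tfrac{\Lambda}{2}g_{(ab}\nabla_{c)}\bigr)\varsigma,\qquad \delta\chi=-\tfrac{\Lambda}{6}\bigl(\Delta+\tfrac{10\Lambda}{3}\bigr)\varsigma .$$ The trace-adjusted field is $\psi_{abc}=\varphi_{abc}+\frac12g_{(ab}\bar\varphi_{c)}$. **BGG side.** In the scale $g$, sections of the tractor bundle $\mathcal T_{(AB)}$ are triples $(\tau,v_a,w_{ab})$, $w_{ab}=w_{(ab)}$, with tractor connection $$\nabla_c(\tau,v_a,w_{ab})=(\nabla_c\tau-2v_c,\ \nabla_cv_a+Q_{ca}\tau-w_{ca},\ \nabla_cw_{ab}+2Q_{c(a}v_{b)}),$$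 where $Q=\frac13\mathrm{Ric}$ is the projective Schouten tensor. Let $d^\nabla$ be the twisted exterior derivative, $\delta^\nabla$ its formal adjoint ($(\delta^\nabla F)_c=-\nabla^dF_{dc}$), $\Omega$ the tractor curvature, $\boldsymbol M^\nabla=\delta^\nabla d^\nabla-\mathrm{End}(\Omega^\sharp)$ on $\mathcal T_{(AB)}$-valued one-forms, $\partial^*$ the Kostant codifferential and $\pi$ the projection of one-forms onto the totally symmetric part of the bottom slot, $\pi(\tau_c,v_{ca},w_{cab})=w_{(cab)}$ ($c$ the form index). Put $$\mathcal L_0\sigma=(\sigma,\tfrac12\nabla_a\sigma,(\tfrac12\nabla_a\nabla_b+Q_{ab})\sigma),\quad \mathcal L_1\psi=(0,0,\psi_{cab}),\quad \mathcal L^1=\pi,\quad \mathcal D=\pi\, d^\nabla\mathcal L_0,\quad M=\mathcal L^1\boldsymbol M^\nabla\mathcal L_1,$$ and let $\mathcal D^*$ be the formal adjoint of $\mathcal D$. **Claim.** The following hold on $U$. 1. $Q_{ab}=\frac{\Lambda}{3}g_{ab}$. The section $\mathcal L_0\sigma$ is the unique section $s$ of $\mathcal T_{(AB)}$ with top slot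 $\sigma$ and $\partial^*d^\nabla s=0$. For symmetric $\psi_{abc}$, $\mathcal L_1\psi$ is the unique $\mathcal T_{(AB)}$-valued one-form $\Xi$ with $\partial^*\Xi=0$, $\pi\Xi=\psi$, $\partial^*d^\nabla\Xi=0$. 2. $\mathcal D\sigma=\frac12\bigl[\nabla_{(a}\nabla_b\nabla_{c)}+4Q_{(ab}\nabla_{c)}+2(\nabla_{(a}Q_{bc)})\bigr]\sigma=\frac12\bigl(\nabla_{(a}\nabla_b\nabla_{c)}+\frac{4\Lambda}{3}g_{(ab}\nabla_{c)}\bigr)\sigma$, and $d^\nabla\mathcal L_0=\mathcal L_1\mathcal D$. 3. For symmetric $\psi_{abc}$, $d^\nabla\mathcal L_1\psi=(0,0,\nabla_d\psi_{cab}-\nabla_c\psi_{dab})$ and $$\boldsymbol M^\nabla\mathcal L_1\psi=\Bigl(0,\ \nabla.\psi_{ca}-\nabla_c\bar\psi_a,\ -\bigl[\Delta\psi_{cab}-\nabla_c\nabla.\psi_{ab}+\tfrac{2\Lambda}{3}g_{c(a}\bar\psi_{b)}-\tfrac{5\Lambda}{3}\psi_{cab}\bigr]\Bigr),$$ $$M\psi=-\bigl[\Delta\psi_{abc}-\nabla_{(a}\nabla.\psi_{bc)}+\tfrac{2\Lambda}{3}g_{(ab}\bar\psi_{c)}-\tfrac{5\Lambda}{3}\psi_{abc}\bigr].$$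 4. $d^\nabla\mathcal L_1\mathcal D=0$, $\boldsymbol M^\nabla\mathcal L_1\mathcal D=0$, $M\mathcal D=0$ and $\mathcal D^*M=0$. 5. The middle slot of $\boldsymbol M^\nabla\mathcal L_1\psi$ vanishes if and only if $\nabla.\psi_{ab}=\nabla_{(a}\bar\psi_{b)}$ and $\nabla_{[a}\bar\psi_{b]}=0$; in that case $\boldsymbol M^\nabla\mathcal L_1\psi=(0,0,(M\psi)_{cab})$, so the mixed-symmetry part of the bottom slot vanishes. On every coordinate ball in $U$ on which the middle slot vanishes there is a smooth $\chi$ with $\bar\psi_a=-\frac{6}{\Lambda}\nabla_a\chi$; if moreover $\boldsymbol M^\nabla\mathcal L_1\psi=0$ there, then $(\psi_{abc}-\frac14g_{(ab}\bar\psi_{c)},\chi)$ solves the PM system there. 6. The map $\varphi\mapsto\psi$ is invertible on symmetric tensors, with inverse $\varphi_{abc}=\psi_{abc}-\frac14g_{(ab}\bar\psi_{c)}$. It takes $\delta\varphi$ to $\delta\psi=(\nabla_{(a}\nabla_b\nabla_{c)}+\frac{4\Lambda}{3}g_{(ab}\nabla_{c)})\varsigma=2\mathcal D\varsigma$. The left-hand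 sides of both PM equations and of both constraints are unchanged under $(\varphi,\chi)\mapsto(\varphi+\delta\varphi,\chi+\delta\chi)$. 7. For all $\varphi,\chi$ with trace-adjusted field $\psi$: the PM system implies both constraints; the second constraint is equivalent to $\bar\psi_a=-\frac6\Lambda\nabla_a\chi$, and when it holds the first constraint is equivalent to $\nabla.\psi_{ab}=\nabla_{(a}\bar\psi_{b)}$; when both constraints hold, the left-hand side of the $\varphi$-equation equals $-M\psi$ and the $\chi$-equation holds. Finally, $(\varphi,\chi)$ solves the PM system if and only if $\boldsymbol M^\nabla\mathcal L_1\psi=0$ and $\bar\psi_a=-\frac6\Lambda\nabla_a\chi$. -/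

import Mathlib

open scoped Manifold ContDiff

noncomputable section

namespace PMSpinThree

/-! ### Tensor fields on a four-manifold and their coordinate components -/

/-- The model space of a four-dimensional manifold. -/
abbrev Coord : Type := EuclideanSpace ℝ (Fin 4)

/-- Covariant tensor fields of rank `k` on a four-manifold `M` (not yet smooth). -/
abbrev TensorField (M : Type*) [TopologicalSpace M] [ChartedSpace Coord M] (k : ℕ) : Type _ :=
  ∀ x : M, MultilinearMap ℝ (fun _ : Fin k => TangentSpace (𝓡 4) x) ℝ

/-- Component functions of a covariant tensor field of rank `k` on a coordinate domain:
`T y ![a, b, c]` is `T_{abc}` at the point with coordinates `y`. -/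
abbrev Comp (k : ℕ) : Type := Coord → (Fin k → Fin 4) → ℝ

section Manifold

variable {M : Type*} [TopologicalSpace M] [ChartedSpace Coord M]

/-- The coordinate vector `∂_a` of the chart `e`, at the point with coordinates `y`. -/
def coordVec (e : OpenPartialHomeomorph M Coord) (y : Coord) (a : Fin 4) :
    TangentSpace (𝓡 4) (e.symm y) :=
  mfderiv 𝓘(ℝ, Coord) (𝓡 4) e.symm y (EuclideanSpace.single a (1 : ℝ) : Coord)

/-- The components of a tensor field in the chart `e`. -/
def TensorField.comp {k : ℕ} (T : TensorField M k) (e : OpenPartialHomeomorph M Coord) : Comp k :=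
  fun y I => T (e.symm y) (fun i => coordVec e y (I i))

/-- Smoothness of component functions on a set of the coordinate space. -/
def Comp.SmoothOn {k : ℕ} (T : Comp k) (U : Set Coord) : Prop :=
  ∀ I, ContDiffOn ℝ ∞ (fun y => T y I) U

/-- A tensor field is smooth if its components in every chart are. -/
def TensorField.IsSmooth {k : ℕ} (T : TensorField M k) : Prop :=
  ∀ e ∈ IsManifold.maximalAtlas (𝓡 4) ∞ M, (T.comp e).SmoothOn e.target

/-- Total symmetry of a covariant tensor field. -/
def TensorField.IsSymm {k : ℕ} (T : TensorField M k) : Prop :=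
  ∀ (x : M) (v : Fin k → TangentSpace (𝓡 4) x) (π : Equiv.Perm (Fin k)),
    T x (fun i => v (π i)) = T x v

/-- A pseudo-Riemannian metric, of arbitrary signature. -/
structure IsPseudoRiemannianMetric (g : TensorField M 2) : Prop where
  smooth : g.IsSmooth
  symm : g.IsSymm
  nondeg : ∀ (x : M) (v : TangentSpace (𝓡 4) x),
    (∀ w : TangentSpace (𝓡 4) x, g x ![v, w] = 0) → v = 0

end Manifold

/-! ### Levi-Civita calculus in coordinates; `g` is the component array of the metric -/

/-- Equality of component arrays on a set. -/
def Comp.EqOn {k : ℕ} (U : Set Coord) (S T : Comp k) : Prop := ∀ y ∈ U, ∀ I, S y I = T y I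

/-- Total symmetry of a component array on a set. -/
def Comp.SymmOn {k : ℕ} (U : Set Coord) (T : Comp k) : Prop :=
  ∀ y ∈ U, ∀ (I : Fin k → Fin 4) (π : Equiv.Perm (Fin k)), T y (fun i => I (π i)) = T y I

/-- Vanishing of a component array on a set. -/
def Comp.ZeroOn {k : ℕ} (U : Set Coord) (T : Comp k) : Prop := ∀ y ∈ U, ∀ I, T y I = 0

/-- The partial derivative `∂_a f`. -/
def pd (a : Fin 4) (f : Coord → ℝ) (y : Coord) : ℝ :=
  fderiv ℝ f y (EuclideanSpace.single a (1 : ℝ))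

/-- The inverse metric `g^{ab}`. -/
def ginv (g : Comp 2) (y : Coord) : Matrix (Fin 4) (Fin 4) ℝ :=
  (Matrix.of fun a b => g y ![a, b])⁻¹

/-- The Christoffel symbols `Γ^d_{ab}` of the Levi-Civita connection. -/
def christoffel (g : Comp 2) (y : Coord) (d a b : Fin 4) : ℝ :=
  (1 / 2) * ∑ e, ginv g y d e *
    (pd a (fun z => g z ![e, b]) y + pd b (fun z => g z ![e, a]) y - pd e (fun z => g z ![a, b]) y)

/-- The covariant derivative; the new index comes first: `cov g T y ![c, a, b] = ∇_c T_{ab}`. -/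
def cov {k : ℕ} (g : Comp 2) (T : Comp k) : Comp (k + 1) := fun y I =>
  pd (I 0) (fun z => T z (Fin.tail I)) y
    - ∑ i : Fin k, ∑ d, christoffel g y d (I 0) (Fin.tail I i) *
        T y (Function.update (Fin.tail I) i d)

/-- The metric trace over the first two indices, `g^{ab} T_{ab…}`. -/
def tr {k : ℕ} (g : Comp 2) (T : Comp (k + 2)) : Comp k := fun y I =>
  ∑ a, ∑ b, ginv g y a b * T y (Matrix.vecCons a (Matrix.vecCons b I))

/-- The divergence on the first index, `∇^a T_{a…}`. -/
def div {k : ℕ} (g : Comp 2) (T : Comp (k + 1)) : Comp k := tr g (cov g T)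

/-- The Bochner Laplacian `Δ = ∇^a ∇_a`. -/
def lap {k : ℕ} (g : Comp 2) (T : Comp k) : Comp k := tr g (cov g (cov g T))

/-- The curvature `R_{ab}{}^d{}_c`, normalised by `[∇_a, ∇_b] v^d = R_{ab}{}^d{}_c v^c`, that is
`[∇_a, ∇_b] ω_c = - R_{ab}{}^d{}_c ω_d`. -/
def riem (g : Comp 2) (y : Coord) (a b d c : Fin 4) : ℝ :=
  pd a (fun z => christoffel g z d b c) y - pd b (fun z => christoffel g z d a c) y
    + ∑ e, (christoffel g y d a e * christoffel g y e b c
        - christoffel g y d b e * christoffel g y e a c)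

/-- The Kronecker delta. -/
def kron (a b : Fin 4) : ℝ := if a = b then 1 else 0

/-- The projective Schouten tensor `Q = Ric / (n - 1)`, `n = 4`, of the Levi-Civita connection. -/
def schouten (g : Comp 2) : Comp 2 := fun y I => (1 / 3) * ∑ a, riem g y a (I 0) a (I 1)

/-- The projective Weyl tensor `W_{ab}{}^d{}_c` (for a Levi-Civita connection, whose projective
Schouten tensor is symmetric). -/
def weyl (g : Comp 2) (y : Coord) (a b d c : Fin 4) : ℝ :=
  riem g y a b d c - kron d a * schouten g y ![b, c] + kron d b * schouten g y ![a, c]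

/-- The projective Cotton tensor `C_{abc} = ∇_a Q_{bc} - ∇_b Q_{ac}`. -/
def cotton (g : Comp 2) (y : Coord) (a b c : Fin 4) : ℝ :=
  cov g (schouten g) y ![a, b, c] - cov g (schouten g) y ![b, a, c]

/-- Constant curvature in dimension four: `R_{ab}{}^d{}_c = (Λ/3) (δ^d_a g_{bc} - δ^d_b g_{ac})`
with the constant `Λ`; so `Ric = Λ g`. -/
def HasConstantCurvature {M : Type*} [TopologicalSpace M] [ChartedSpace Coord M]
    (g : TensorField M 2) (Λ : ℝ) : Prop :=
  ∀ e ∈ IsManifold.maximalAtlas (𝓡 4) ∞ M, ∀ y ∈ e.target, ∀ a b d c : Fin 4,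
    riem (g.comp e) y a b d c =
      Λ / 3 * (kron d a * g.comp e y ![b, c] - kron d b * g.comp e y ![a, c])

/-- Symmetrisation with unit weight, `F_{(ab)}`. -/
def sym2 (F : Fin 4 → Fin 4 → ℝ) (a b : Fin 4) : ℝ := (F a b + F b a) / 2

/-- Symmetrisation with unit weight, `F_{(abc)}`. -/
def sym3 (F : Fin 4 → Fin 4 → Fin 4 → ℝ) (a b c : Fin 4) : ℝ :=
  (F a b c + F a c b + F b a c + F b c a + F c a b + F c b a) / 6

/-- `T_{(abc)}` as a tensor. -/
def symm3 (T : Comp 3) : Comp 3 := fun y I =>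
  sym3 (fun a b c => T y ![a, b, c]) (I 0) (I 1) (I 2)

/-- `g_{(ab} X_{c)}` as a tensor. -/
def gSym (g : Comp 2) (X : Comp 1) : Comp 3 := fun y I =>
  sym3 (fun a b c => g y ![a, b] * X y ![c]) (I 0) (I 1) (I 2)

/-- The trace-free symmetric part `T_{(ab)_∘}`. -/
def tfSym (g : Comp 2) (T : Comp 2) : Comp 2 := fun y I =>
  sym2 (fun a b => T y ![a, b]) (I 0) (I 1) - (1 / 4) * g y I * tr g T y ![]

/-! ### The bundle `T_(AB)` and its tractor connection, in the Levi-Civita scale -/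

/-- A `k`-form with values in `T_(AB)` (or, before skewing, a covariant `k`-tensor with such
values), given by its slots `(τ, v_a, w_ab)`. In `mid` and `bot` the tractor indices come first
and are followed by the form indices; in `bot` the two tractor indices are to be symmetric. -/
structure TractorForm (k : ℕ) where
  top : Comp k
  mid : Comp (k + 1)
  bot : Comp (k + 2)

namespace TractorForm

/-- Equality of tractor-valued forms on a set. -/
def EqOn {k : ℕ} (U : Set Coord) (Ξ Θ : TractorForm k) : Prop :=
  Comp.EqOn U Ξ.top Θ.top ∧ Comp.EqOn U Ξ.mid Θ.mid ∧ Comp.EqOn U Ξ.bot Θ.bot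

/-- Vanishing of a tractor-valued form on a set. -/
def ZeroOn {k : ℕ} (U : Set Coord) (Ξ : TractorForm k) : Prop :=
  Comp.ZeroOn U Ξ.top ∧ Comp.ZeroOn U Ξ.mid ∧ Comp.ZeroOn U Ξ.bot

/-- Smooth sections on `U`, with symmetric tractor indices. -/
structure IsSection {k : ℕ} (U : Set Coord) (Ξ : TractorForm k) : Prop where
  top : Ξ.top.SmoothOn U
  mid : Ξ.mid.SmoothOn U
  bot : Ξ.bot.SmoothOn U
  symm : ∀ y ∈ U, ∀ (a b : Fin 4) (J : Fin k → Fin 4),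
    Ξ.bot y (Matrix.vecCons a (Matrix.vecCons b J)) =
      Ξ.bot y (Matrix.vecCons b (Matrix.vecCons a J))

end TractorForm

/-- The tractor connection (coupled to the Levi-Civita connection on form indices)
`∇_c (τ, v_a, w_ab) = (∇_c τ - 2 v_c, ∇_c v_a + Q_ca τ - w_ca, ∇_c w_ab + 2 Q_c(a v_b))`.
The new form index `c` precedes the old ones. -/
def tractorCov {k : ℕ} (g : Comp 2) (Ξ : TractorForm k) : TractorForm (k + 1) where
  top := fun y I => cov g Ξ.top y I - 2 * Ξ.mid y I
  mid := fun y I =>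
    let a := I 0
    let c := I 1
    let J := Fin.tail (Fin.tail I)
    cov g Ξ.mid y (Matrix.vecCons c (Matrix.vecCons a J)) + schouten g y ![c, a] * Ξ.top y J
      - Ξ.bot y (Matrix.vecCons c (Matrix.vecCons a J))
  bot := fun y I =>
    let a := I 0
    let b := I 1
    let c := I 2
    let J := Fin.tail (Fin.tail (Fin.tail I))
    cov g Ξ.bot y (Matrix.vecCons c (Matrix.vecCons a (Matrix.vecCons b J)))
      + schouten g y ![c, a] * Ξ.mid y (Matrix.vecCons b J)
      + schouten g y ![c, b] * Ξ.mid y (Matrix.vecCons a J)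

/-- The twisted exterior derivative on tractor-valued one-forms,
`(d^∇ Ξ)_{dc} = ∇_d Ξ_c - ∇_c Ξ_d`. On tractor-valued functions `d^∇` is `tractorCov`. -/
def extD (g : Comp 2) (Ξ : TractorForm 1) : TractorForm 2 where
  top := fun y I => (tractorCov g Ξ).top y ![I 0, I 1] - (tractorCov g Ξ).top y ![I 1, I 0]
  mid := fun y I =>
    (tractorCov g Ξ).mid y ![I 0, I 1, I 2] - (tractorCov g Ξ).mid y ![I 0, I 2, I 1]
  bot := fun y I =>
    (tractorCov g Ξ).bot y ![I 0, I 1, I 2, I 3] - (tractorCov g Ξ).bot y ![I 0, I 1, I 3, I 2]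

/-- The twisted codifferential (formal adjoint of `d^∇`) on tractor-valued two-forms,
`(δ^∇ F)_c = - ∇^d F_{dc}`. -/
def codiff (g : Comp 2) (F : TractorForm 2) : TractorForm 1 where
  top := fun y I => - ∑ d, ∑ e, ginv g y d e * (tractorCov g F).top y ![d, e, I 0]
  mid := fun y I => - ∑ d, ∑ e, ginv g y d e * (tractorCov g F).mid y ![I 0, d, e, I 1]
  bot := fun y I => - ∑ d, ∑ e, ginv g y d e * (tractorCov g F).bot y ![I 0, I 1, d, e, I 2]

/-- The curvature endomorphism `(End(Ω^♯) Ξ)_c = Ω_c{}^d Ξ_d`, where the curvature of the tractor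
connection on `T_(AB)` is
`Ω_cd (τ, v_a, w_ab) = (0, -W_cd{}^e{}_a v_e + C_cda τ, -2 W_cd{}^e{}_(a w_b)e + 2 C_cd(a v_b))`. -/
def endCurv (g : Comp 2) (Ξ : TractorForm 1) : TractorForm 1 where
  top := fun _ _ => 0
  mid := fun y I =>
    let a := I 0
    let c := I 1
    ∑ d, ∑ f, ginv g y d f *
      (cotton g y c d a * Ξ.top y ![f] - ∑ e, weyl g y c d e a * Ξ.mid y ![e, f])
  bot := fun y I =>
    let a := I 0
    let b := I 1
    let c := I 2
    ∑ d, ∑ f, ginv g y d f *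
      (cotton g y c d a * Ξ.mid y ![b, f] + cotton g y c d b * Ξ.mid y ![a, f]
        - ∑ e, (weyl g y c d e a * Ξ.bot y ![e, b, f] + weyl g y c d e b * Ξ.bot y ![a, e, f]))

/-- The Yang–Mills detour operator `M^∇ = δ^∇ d^∇ - End(Ω^♯)` on tractor-valued one-forms. -/
def detourOp (g : Comp 2) (Ξ : TractorForm 1) : TractorForm 1 where
  top := fun y I => (codiff g (extD g Ξ)).top y I - (endCurv g Ξ).top y I
  mid := fun y I => (codiff g (extD g Ξ)).mid y I - (endCurv g Ξ).mid y I
  bot := fun y I => (codiff g (extD g Ξ)).bot y I - (endCurv g Ξ).bot y I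

/-! ### BGG operators -/

/-- The Kostant codifferential on one-forms: the cotangent vector `ζ` acts on `T_(AB)` by
`ζ · (τ, v_a, w_ab) = (0, ζ_a τ, 2 ζ_(a v_b))`, and `∂^* (ζ ⊗ s) = ζ · s`. -/
def kostant₁ (Ξ : TractorForm 1) : TractorForm 0 where
  top := fun _ _ => 0
  mid := fun y I => Ξ.top y ![I 0]
  bot := fun y I => Ξ.mid y ![I 1, I 0] + Ξ.mid y ![I 0, I 1]

/-- The Kostant codifferential on two-forms: the first form index acts. -/
def kostant₂ (F : TractorForm 2) : TractorForm 1 where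
  top := fun _ _ => 0
  mid := fun y I => F.top y ![I 0, I 1]
  bot := fun y I => F.mid y ![I 1, I 0, I 2] + F.mid y ![I 0, I 1, I 2]

/-- The projection `π` from (the kernel of the Kostant codifferential in) tractor-valued one-forms
to the homology bundle `⊙³ T^*M`; it is also the operator `𝓛¹`, the adjoint of `𝓛₁`. -/
def proj (Ξ : TractorForm 1) : Comp 3 := symm3 Ξ.bot

/-- The splitting operator `𝓛₀ σ = (σ, ½ ∇_a σ, (½ ∇_a ∇_b + Q_ab) σ)`. -/
def split₀ (g : Comp 2) (σ : Comp 0) : TractorForm 0 where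
  top := σ
  mid := fun y I => (1 / 2) * cov g σ y I
  bot := fun y I => (1 / 2) * cov g (cov g σ) y I + schouten g y I * σ y ![]

/-- The splitting operator `𝓛₁ ψ = (0, 0, ψ_cab)`, with form index `c`. -/
def split₁ (ψ : Comp 3) : TractorForm 1 where
  top := fun _ _ => 0
  mid := fun _ _ => 0
  bot := fun y I => ψ y ![I 2, I 0, I 1]

/-- The first BGG operator `𝓓 = π ∘ d^∇ ∘ 𝓛₀`. -/
def bggOp (g : Comp 2) (σ : Comp 0) : Comp 3 := proj (tractorCov g (split₀ g σ))

/-- The formal adjoint `𝓓^*` of `𝓓 σ = ½ ∇_(a ∇_b ∇_c) σ + 2 Q_(ab ∇_c) σ + (∇_(a Q_bc)) σ`: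
`𝓓^* γ = -½ ∇^a ∇^b ∇^c γ_abc - 2 ∇^c (Q^ab γ_abc) + (∇^a Q^bc) γ_abc`. -/
def bggOpAdj (g : Comp 2) (γ : Comp 3) : Comp 0 := fun y I =>
  -(1 / 2) * div g (div g (div g γ)) y I
    - 2 * div g (fun z (K : Fin 1 → Fin 4) => ∑ a, ∑ b, ∑ a', ∑ b',
        ginv g z a a' * ginv g z b b' * schouten g z ![a', b'] * γ z ![a, b, K 0]) y I
    + ∑ a, ∑ b, ∑ c, ∑ a', ∑ b', ∑ c', ginv g y a a' * ginv g y b b' * ginv g y c c' *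
        cov g (schouten g) y ![a', b', c'] * γ y ![a, b, c]

/-- The BGG detour operator `M = 𝓛¹ ∘ M^∇ ∘ 𝓛₁` on `⊙³ T^*M`. -/
def bggDetour (g : Comp 2) (ψ : Comp 3) : Comp 3 := proj (detourOp g (split₁ ψ))

/-- The gauge operator `∇_(a ∇_b ∇_c) ς + (4Λ/3) g_(ab ∇_c) ς`. -/
def gaugeOp (g : Comp 2) (Λ : ℝ) (ς : Comp 0) : Comp 3 := fun y I =>
  symm3 (cov g (cov g (cov g ς))) y I + 4 * Λ / 3 * gSym g (cov g ς) y I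

/-! ### The maximal-depth partially massless spin-three theory -/

/-- Left-hand side of the equation of motion of the field `φ_abc`. -/
def pmEq (g : Comp 2) (Λ : ℝ) (φ : Comp 3) (χ : Comp 0) : Comp 3 := fun y I =>
  lap g φ y I - 5 * Λ / 3 * φ y I
    - 3 * symm3 (cov g (div g φ)) y I
    + 3 * symm3 (cov g (cov g (tr g φ))) y I
    - 3 * gSym g (lap g (tr g φ)) y I
    + 3 * gSym g (div g (div g φ)) y I
    - 3 / 2 * gSym g (cov g (div g (tr g φ))) y I
    + 3 * gSym g (cov g χ) y I

/-- Left-hand side of the equation of motion of the auxiliary scalar, `Δχ + (Λ/3) ∇.φ̄`. -/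
def pmAux (g : Comp 2) (Λ : ℝ) (φ : Comp 3) (χ : Comp 0) : Comp 0 := fun y I =>
  lap g χ y I + Λ / 3 * div g (tr g φ) y I

/-- The partially massless system holds on `U`. -/
def PMSystemOn (U : Set Coord) (g : Comp 2) (Λ : ℝ) (φ : Comp 3) (χ : Comp 0) : Prop :=
  Comp.ZeroOn U (pmEq g Λ φ χ) ∧ Comp.ZeroOn U (pmAux g Λ φ χ)

/-- `∇_(a ∇_b)∘ χ - Λ ∇.φ_(ab)∘ + 2Λ ∇_(a φ̄_b)∘`. -/
def pmDivConstraint (g : Comp 2) (Λ : ℝ) (φ : Comp 3) (χ : Comp 0) : Comp 2 := fun y I =>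
  tfSym g (cov g (cov g χ)) y I - Λ * tfSym g (div g φ) y I
    + 2 * Λ * tfSym g (cov g (tr g φ)) y I

/-- `∇_a χ + (Λ/3) φ̄_a`. -/
def pmScalarConstraint (g : Comp 2) (Λ : ℝ) (φ : Comp 3) (χ : Comp 0) : Comp 1 := fun y I =>
  cov g χ y I + Λ / 3 * tr g φ y I

/-- `δφ_abc = ∇_(a ∇_(b ∇_c)∘) ς + (Λ/2) g_(ab ∇_c) ς`. -/
def pmGaugeField (g : Comp 2) (Λ : ℝ) (ς : Comp 0) : Comp 3 := fun y I =>
  symm3 (cov g (tfSym g (cov g (cov g ς)))) y I + Λ / 2 * gSym g (cov g ς) y I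

/-- `δχ = -(Λ/6) (Δ + 10Λ/3) ς`. -/
def pmGaugeScalar (g : Comp 2) (Λ : ℝ) (ς : Comp 0) : Comp 0 := fun y I =>
  -(Λ / 6) * (lap g ς y I + 10 * Λ / 3 * ς y I)

/-- The trace-adjusted field `ψ_abc = φ_abc + ½ g_(ab φ̄_c)`. -/
def traceAdjust (g : Comp 2) (φ : Comp 3) : Comp 3 := fun y I =>
  φ y I + (1 / 2) * gSym g (tr g φ) y I

/-- The inverse field redefinition `φ_abc = ψ_abc - ¼ g_(ab ψ̄_c)`. -/
def traceAdjustInv (g : Comp 2) (ψ : Comp 3) : Comp 3 := fun y I =>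
  ψ y I - (1 / 4) * gSym g (tr g ψ) y I

end PMSpinThree

end

open PMSpinThree

/-!
All assertions are identities between natural differential operators in a metric of constant
curvature, and they are proved first in an algebraic model: a commutative `ℝ`-algebra `A` with four
commuting derivations, in the role of the smooth functions on a coordinate domain, together with an
invertible symmetric matrix `g` over `A` whose Riemann tensor is that of constant curvature
(`MetricAlgebra`, `ConstCurvAlgebra`). Component arrays are functions from `Fin k → Fin 4` to `A`,
the covariant derivative acts on arrays of every rank, and the only input is the Ricci
identity (`ConstCurvAlgebra.ricci`) with the fact that `g` is parallel.

*The detour complex.* For constant curvature `Q = (Λ/3) g` is parallel and the projective Weyl and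
Cotton tensors vanish, so the tractor connection is flat and the detour operator is `δ^∇ d^∇`.
The derivative of the split scalar lies in the bottom slot, where it is `½ gaugeOp`
(`tcov_tsplit₀`). The twisted exterior derivative of a split symmetric tensor `ψ` is the field
strength `∇_d ψ_{cab} - ∇_c ψ_{dab}`, whose trace and divergence are the middle and the bottom slot
of the detour operator (`con_curl`, `dv_curl`). The field strength of `gaugeOp σ` is zero
(`cov_gaugeOp_comm`), whence the vanishing of all compositions; that the adjoint of the first
operator annihilates the detour operator is `adj_det`. The mixed-symmetry part of the bottom slot
is a derivative of the middle slot (`detBot_comm`). The normalisation conditions on the splitting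
operators are solved slot by slot (`eq_tsplit₀_iff`, `eq_tsplit₁_iff`).

*The partially massless theory.* In terms of the trace-adjusted field `ψ`, the equation of motion of
`φ` is the detour operator on `ψ` plus terms in three quantities (`pmEq_traceAdjInv`): the
symmetric part `B` of the middle slot, the exterior derivative of the trace, which is the skew part
of the middle slot, and the scalar constraint `W`, whose exterior derivative is again that of the
trace, up to a factor. The equation of the auxiliary scalar is `∇.W = 0`. The divergence and the
trace of the equation of motion (`dv_pmEq`, `tr_pmEq`) are then linear relations between `B`, `W`
and their derivatives that force `W = 0` and `B = 0` (`constraints_of_pmSystem`), and conversely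
the equation of motion reduces to the detour operator when these vanish (`pmSystem_iff`). Gauge
invariance follows, since trace adjustment takes the gauge transformation to `gaugeOp`
(`traceAdj_pmGF`).

*Transfer to coordinates.* The identities are applied to the algebra `SmoothFun U` of smooth
functions on `U`; `Rep` and `RepT` relate component arrays on `U` to arrays over this algebra. The
component matrix of the metric in a chart is invertible because the coordinate vectors form a basis
of the tangent space (`IsPseudoRiemannianMetric.comp_nondeg`). The auxiliary scalar on a ball is a
potential of the trace, by the Poincaré lemma (`exists_potential`, `exists_auxiliary_scalar`).
-/

noncomputable section

namespace PMSpinThree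

/-! ### Levi-Civita calculus over a commutative algebra with four commuting derivations -/

/-- Component arrays of rank `k` with entries in `A`. -/
abbrev Tens (A : Type*) (k : ℕ) : Type _ := (Fin k → Fin 4) → A

/-- An algebraic model of a metric on a coordinate domain: `A` plays the role of the algebra of
smooth functions, `D a` that of `∂_a`, and `h` is the inverse of the metric `g`. -/
structure MetricAlgebra (A : Type*) [CommRing A] [Algebra ℝ A] where
  D : Fin 4 → Derivation ℝ A A
  D_comm : ∀ a b f, D a (D b f) = D b (D a f)
  g : Matrix (Fin 4) (Fin 4) A
  h : Matrix (Fin 4) (Fin 4) A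
  g_symm : ∀ a b, g a b = g b a
  h_symm : ∀ a b, h a b = h b a
  h_mul_g : h * g = 1

namespace MetricAlgebra

variable {A : Type*} [CommRing A] {k : ℕ}

/-- The derivation action of a matrix on the indices of a covariant tensor. -/
def act (X : Matrix (Fin 4) (Fin 4) A) : Tens A k →ₗ[A] Tens A k where
  toFun T J := ∑ i, ∑ d, X d (J i) * T (Function.update J i d)
  map_add' S T := by
    funext J; simp only [Pi.add_apply, mul_add, Finset.sum_add_distrib]
  map_smul' c T := by
    funext J
    simp only [Pi.smul_apply, smul_eq_mul, RingHom.id_apply, Finset.mul_sum]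
    exact Finset.sum_congr rfl fun _ _ => Finset.sum_congr rfl fun _ _ => by ring

theorem act_apply (X : Matrix (Fin 4) (Fin 4) A) (T : Tens A k) (J : Fin k → Fin 4) :
    act X T J = ∑ i, ∑ d, X d (J i) * T (Function.update J i d) := rfl

theorem update_cons_zero (a d : Fin 4) (J : Fin k → Fin 4) :
    Function.update (Matrix.vecCons a J) 0 d = Matrix.vecCons d J := Fin.update_cons_zero _ _ _

theorem update_cons_succ (a d : Fin 4) (J : Fin k → Fin 4) (i : Fin k) :
    Function.update (Matrix.vecCons a J) i.succ d = Matrix.vecCons a (Function.update J i d) :=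
  (Fin.cons_update _ _ _ _).symm

theorem act_cons (X : Matrix (Fin 4) (Fin 4) A) (T : Tens A (k + 1)) (a : Fin 4)
    (J : Fin k → Fin 4) : act X T (Matrix.vecCons a J) =
      ∑ d, X d a * T (Matrix.vecCons d J) + act X (fun K => T (Matrix.vecCons a K)) J := by
  rw [act_apply, Fin.sum_univ_succ, act_apply]
  simp only [update_cons_zero, update_cons_succ, Matrix.cons_val_zero, Matrix.cons_val_succ]

/-- The off-diagonal part of the composite of two derivation actions is symmetric. -/
theorem act_act (X Y : Matrix (Fin 4) (Fin 4) A) (T : Tens A k) (J : Fin k → Fin 4) :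
    act X (act Y T) J = act (Y * X) T J + ∑ i, ∑ j, if i = j then 0 else
      ∑ d, ∑ e, X d (J i) * (Y e (J j) *
        T (Function.update (Function.update J i d) j e)) := by
  simp only [act_apply, ← Finset.sum_add_distrib]
  refine Finset.sum_congr rfl fun i _ => ?_
  have h1 : ∀ j, (∑ d, X d (J i) * ∑ e, Y e (Function.update J i d j) *
      T (Function.update (Function.update J i d) j e)) =
      (if i = j then ∑ e, (Y * X) e (J i) * T (Function.update J i e) else 0) +
      (if i = j then 0 else ∑ d, ∑ e, X d (J i) * (Y e (J j) *
        T (Function.update (Function.update J i d) j e))) := fun j => by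
    split_ifs with hij
    · subst hij
      simp only [Function.update_self, Function.update_idem, Matrix.mul_apply, Finset.mul_sum,
        Finset.sum_mul, add_zero]
      rw [Finset.sum_comm]
      exact Finset.sum_congr rfl fun _ _ => Finset.sum_congr rfl fun _ _ => by ring
    · simp only [Function.update_of_ne (Ne.symm hij), Finset.mul_sum, zero_add]
  calc _ = ∑ j, ∑ d, X d (J i) * ∑ e, Y e (Function.update J i d j) *
      T (Function.update (Function.update J i d) j e) := by
        simp only [Finset.mul_sum]; exact Finset.sum_comm
    _ = _ := by
        rw [Finset.sum_congr rfl fun j _ => h1 j, Finset.sum_add_distrib]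
        simp

theorem act_commutator (X Y : Matrix (Fin 4) (Fin 4) A) (T : Tens A k) (J : Fin k → Fin 4) :
    act X (act Y T) J - act Y (act X T) J = act (Y * X - X * Y) T J := by
  have h0 : act (Y * X - X * Y) T J = act (Y * X) T J - act (X * Y) T J := by
    simp only [act_apply, Matrix.sub_apply, sub_mul, Finset.sum_sub_distrib]
  rw [act_act, act_act, h0]
  have : (∑ i, ∑ j, if i = j then 0 else ∑ d, ∑ e, X d (J i) * (Y e (J j) *
        T (Function.update (Function.update J i d) j e))) =
      ∑ i, ∑ j, if i = j then 0 else ∑ d, ∑ e, Y d (J i) * (X e (J j) *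
        T (Function.update (Function.update J i d) j e)) := by
    rw [Finset.sum_comm]
    refine Finset.sum_congr rfl fun i _ => Finset.sum_congr rfl fun j _ => ?_
    by_cases hij : i = j
    · simp [hij]
    · rw [if_neg (Ne.symm hij), if_neg hij, Finset.sum_comm]
      refine Finset.sum_congr rfl fun d _ => Finset.sum_congr rfl fun e _ => ?_
      rw [Function.update_comm hij]; ring
  rw [this]; ring

variable [Algebra ℝ A] (M : MetricAlgebra A)

/-- The Christoffel symbols `Γ^d_{ab}`, as the matrix `(d, b)` of the direction `a`. -/
def Γ (a : Fin 4) : Matrix (Fin 4) (Fin 4) A := Matrix.of fun d b =>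
  (1 / 2 : ℝ) • ∑ e, M.h d e * (M.D a (M.g e b) + M.D b (M.g e a) - M.D e (M.g a b))

/-- The covariant derivative, with the new index in front. -/
def cov : Tens A k →ₗ[ℝ] Tens A (k + 1) where
  toFun T I := M.D (I 0) (T (Fin.tail I)) - act (M.Γ (I 0)) T (Fin.tail I)
  map_add' S T := by
    funext I; simp only [Pi.add_apply, map_add]; ring
  map_smul' c T := by
    funext I
    have : c • T = algebraMap ℝ A c • T := by
      funext J; simp [Algebra.smul_def]
    have h2 : act (M.Γ (I 0)) (c • T) (Fin.tail I) = c • act (M.Γ (I 0)) T (Fin.tail I) := by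
      rw [this, map_smul, Pi.smul_apply, algebraMap_smul]
    simp only [RingHom.id_apply, Pi.smul_apply, h2, Derivation.map_smul, smul_sub]

theorem cov_apply (T : Tens A k) (I : Fin (k + 1) → Fin 4) :
    M.cov T I = M.D (I 0) (T (Fin.tail I)) - act (M.Γ (I 0)) T (Fin.tail I) := rfl

theorem cov_cons (T : Tens A k) (c : Fin 4) (J : Fin k → Fin 4) :
    M.cov T (Matrix.vecCons c J) = M.D c (T J) - act (M.Γ c) T J := rfl

/-- Contraction of two indices with the inverse metric. -/
def con : (Fin 4 → Fin 4 → A) →ₗ[A] A where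
  toFun f := ∑ a, ∑ b, M.h a b * f a b
  map_add' f f' := by simp only [Pi.add_apply, mul_add, Finset.sum_add_distrib]
  map_smul' c f := by
    simp only [Pi.smul_apply, smul_eq_mul, RingHom.id_apply, Finset.mul_sum]
    exact Finset.sum_congr rfl fun _ _ => Finset.sum_congr rfl fun _ _ => by ring

theorem con_apply (f : Fin 4 → Fin 4 → A) : M.con f = ∑ a, ∑ b, M.h a b * f a b := rfl

/-! ### Contraction rules -/

theorem con_add (f f' : Fin 4 → Fin 4 → A) :
    M.con (fun a b => f a b + f' a b) = M.con f + M.con f' := map_add M.con f f'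

theorem con_sub (f f' : Fin 4 → Fin 4 → A) :
    M.con (fun a b => f a b - f' a b) = M.con f - M.con f' := map_sub M.con f f'

theorem con_neg (f : Fin 4 → Fin 4 → A) :
    M.con (fun a b => -f a b) = -M.con f := map_neg M.con f

theorem con_mul (x : A) (f : Fin 4 → Fin 4 → A) :
    M.con (fun a b => x * f a b) = x * M.con f := map_smul M.con x f

theorem con_smul (r : ℝ) (f : Fin 4 → Fin 4 → A) :
    M.con (fun a b => r • f a b) = r • M.con f := by
  simp only [Algebra.smul_def, con_mul]

theorem con_zero : M.con (fun _ _ => 0) = 0 := map_zero M.con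

theorem con_sum {ι : Type*} (s : Finset ι) (f : ι → Fin 4 → Fin 4 → A) :
    M.con (fun a b => ∑ i ∈ s, f i a b) = ∑ i ∈ s, M.con (f i) := by
  rw [← map_sum]; congr 1; funext a b; simp

theorem con_swap (f : Fin 4 → Fin 4 → A) : M.con (fun a b => f b a) = M.con f := by
  rw [con_apply, con_apply, Finset.sum_comm]
  exact Finset.sum_congr rfl fun a _ => Finset.sum_congr rfl fun b _ => by rw [M.h_symm]

/-- Two independent contractions commute. -/
theorem con_comm (f : Fin 4 → Fin 4 → Fin 4 → Fin 4 → A) :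
    M.con (fun a b => M.con (f a b)) = M.con (fun c d => M.con fun a b => f a b c d) := by
  simp only [con_apply, Finset.mul_sum]
  calc _ = ∑ a, ∑ c, ∑ b, ∑ d, M.h a b * (M.h c d * f a b c d) :=
        Finset.sum_congr rfl fun a _ => Finset.sum_comm
    _ = ∑ c, ∑ a, ∑ b, ∑ d, M.h a b * (M.h c d * f a b c d) := Finset.sum_comm
    _ = ∑ c, ∑ a, ∑ d, ∑ b, M.h a b * (M.h c d * f a b c d) :=
        Finset.sum_congr rfl fun c _ => Finset.sum_congr rfl fun a _ => Finset.sum_comm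
    _ = ∑ c, ∑ d, ∑ a, ∑ b, M.h a b * (M.h c d * f a b c d) :=
        Finset.sum_congr rfl fun c _ => Finset.sum_comm
    _ = _ := by
        refine Finset.sum_congr rfl fun c _ => Finset.sum_congr rfl fun d _ =>
          Finset.sum_congr rfl fun a _ => Finset.sum_congr rfl fun b _ => by ring

theorem sum_h_mul_g (a c : Fin 4) : ∑ b, M.h a b * M.g b c = if a = c then 1 else 0 := by
  have := congrFun (congrFun M.h_mul_g a) c
  rwa [Matrix.mul_apply, Matrix.one_apply] at this

theorem con_right (c : Fin 4) (f : Fin 4 → A) : M.con (fun a b => M.g b c * f a) = f c := by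
  have : ∀ a, ∑ b, M.h a b * (M.g b c * f a) = (if a = c then 1 else 0) * f a := fun a => by
    rw [← M.sum_h_mul_g, Finset.sum_mul]
    exact Finset.sum_congr rfl fun _ _ => by ring
  simp [con_apply, this]

theorem con_left (c : Fin 4) (f : Fin 4 → A) : M.con (fun a b => M.g a c * f b) = f c := by
  rw [← M.con_right c f, ← con_swap]

theorem con_right' (c : Fin 4) (f : Fin 4 → A) : M.con (fun a b => M.g c b * f a) = f c := by
  simp only [M.g_symm c]; exact M.con_right c f

theorem con_left' (c : Fin 4) (f : Fin 4 → A) : M.con (fun a b => M.g c a * f b) = f c := by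
  simp only [M.g_symm c]; exact M.con_left c f

theorem con_g (x : A) : M.con (fun a b => M.g a b * x) = 4 * x := by
  have : ∀ a, ∑ b, M.h a b * (M.g a b * x) = x := fun a => by
    have := M.sum_h_mul_g a a
    rw [if_pos rfl] at this
    calc _ = (∑ b, M.h a b * M.g b a) * x := by
          rw [Finset.sum_mul]
          exact Finset.sum_congr rfl fun b _ => by rw [M.g_symm b a]; ring
      _ = x := by rw [this, one_mul]
  simp [con_apply, this]

/-- Contraction of an array that is skew in the contracted indices. -/
theorem con_skew (f : Fin 4 → Fin 4 → A) (hf : ∀ a b, f a b = -f b a) : M.con f = 0 := by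
  have h1 : M.con f = -M.con f := by
    conv_lhs => rw [← con_swap]
    rw [← con_neg]; exact congrArg _ (by funext a b; exact hf b a)
  have h2 : (2 : ℝ) • M.con f = 0 := by linear_combination (norm := algebra) h1
  simpa using congrArg ((1 / 2 : ℝ) • ·) h2

/-! ### The Levi-Civita connection -/

theorem Γ_symm (d a b : Fin 4) : M.Γ a d b = M.Γ b d a := by
  simp only [Γ, Matrix.of_apply]
  congr 1
  exact Finset.sum_congr rfl fun e _ => by rw [M.g_symm a b]; ring

/-- Lowering the upper index of the Christoffel symbols. -/
theorem sum_g_mul_Γ (a b c : Fin 4) : ∑ d, M.g c d * M.Γ a d b =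
    (1 / 2 : ℝ) • (M.D a (M.g c b) + M.D b (M.g c a) - M.D c (M.g a b)) := by
  have hgh : M.g * M.h = 1 := mul_eq_one_comm.mp M.h_mul_g
  have h1 : ∀ e, ∑ d, M.g c d * M.h d e = if c = e then 1 else 0 := fun e => by
    rw [← Matrix.one_apply, ← hgh, Matrix.mul_apply]
  simp only [Γ, Matrix.of_apply, mul_smul_comm, ← Finset.smul_sum, Finset.mul_sum]
  rw [Finset.sum_comm]
  simp only [← mul_assoc, ← Finset.sum_mul, h1]
  simp

/-- Metric compatibility of the Christoffel symbols. -/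
theorem D_g (a b c : Fin 4) : M.D a (M.g b c) =
    ∑ d, M.Γ a d b * M.g d c + ∑ d, M.Γ a d c * M.g b d := by
  have h1 : ∑ d, M.Γ a d b * M.g d c = ∑ d, M.g c d * M.Γ a d b :=
    Finset.sum_congr rfl fun d _ => by rw [M.g_symm c d]; ring
  have h2 : ∑ d, M.Γ a d c * M.g b d = ∑ d, M.g b d * M.Γ a d c :=
    Finset.sum_congr rfl fun d _ => by ring
  rw [h1, h2, sum_g_mul_Γ, sum_g_mul_Γ, M.g_symm c b, M.g_symm c a, M.g_symm b a]
  algebra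

/-- The inverse metric is parallel. -/
theorem D_h (a b c : Fin 4) : M.D a (M.h b c) =
    -∑ d, M.Γ a b d * M.h d c - ∑ d, M.Γ a c d * M.h b d := by
  have hgh : M.g * M.h = 1 := mul_eq_one_comm.mp M.h_mul_g
  have hDg : M.g.map (M.D a) = (M.Γ a).transpose * M.g + M.g * M.Γ a := by
    ext b c
    simp only [Matrix.map_apply, Matrix.add_apply, Matrix.mul_apply, Matrix.transpose_apply, D_g]
    congr 1
    exact Finset.sum_congr rfl fun d _ => by ring
  have hD : M.h.map (M.D a) * M.g + M.h * M.g.map (M.D a) = 0 := by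
    ext b c
    have h1 := congrArg (M.D a) (congrFun (congrFun M.h_mul_g b) c)
    have h2 : M.D a ((1 : Matrix (Fin 4) (Fin 4) A) b c) = 0 := by
      rw [Matrix.one_apply]; split <;> simp
    rw [h2, Matrix.mul_apply, map_sum] at h1
    simp only [Matrix.add_apply, Matrix.mul_apply, Matrix.map_apply, Matrix.zero_apply]
    rw [← h1, ← Finset.sum_add_distrib]
    exact Finset.sum_congr rfl fun d _ => by
      rw [Derivation.leibniz, smul_eq_mul, smul_eq_mul]; ring
  have hDh : M.h.map (M.D a) = -(M.h * (M.Γ a).transpose) - M.Γ a * M.h := by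
    have h3 := congrArg (· * M.h) hD
    simp only [add_mul, zero_mul, mul_assoc, hgh, mul_one, hDg] at h3
    rw [mul_add, ← mul_assoc M.h M.g, M.h_mul_g, one_mul] at h3
    rw [← sub_eq_zero, ← h3]; abel
  have := congrFun (congrFun hDh b) c
  simp only [Matrix.map_apply, Matrix.sub_apply, Matrix.neg_apply, Matrix.mul_apply,
    Matrix.transpose_apply] at this
  rw [this, neg_sub_left, neg_sub_left, add_comm]
  congr 2
  exact Finset.sum_congr rfl fun d _ => by ring

/-- Derivatives pass through contractions, at the cost of connection terms. -/
theorem D_con (c : Fin 4) (f : Fin 4 → Fin 4 → A) : M.D c (M.con f) =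
    M.con (fun a b => M.D c (f a b) - ∑ d, M.Γ c d a * f d b - ∑ d, M.Γ c d b * f a d) := by
  have h1 : ∀ F : Fin 4 → Fin 4 → Fin 4 → A,
      ∑ a, ∑ b, ∑ d, F a b d = ∑ a, ∑ b, ∑ d, F d b a := fun F => by
    calc _ = ∑ b, ∑ a, ∑ d, F a b d := Finset.sum_comm
      _ = ∑ b, ∑ a, ∑ d, F d b a := Finset.sum_congr rfl fun b _ => Finset.sum_comm
      _ = _ := Finset.sum_comm
  have h2 : ∀ F : Fin 4 → Fin 4 → Fin 4 → A,
      ∑ a, ∑ b, ∑ d, F a b d = ∑ a, ∑ b, ∑ d, F a d b := fun F =>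
    Finset.sum_congr rfl fun b _ => Finset.sum_comm
  have e1 : ∑ a, ∑ b, (∑ d, M.Γ c a d * M.h d b) * f a b =
      ∑ a, ∑ b, M.h a b * ∑ d, M.Γ c d a * f d b := by
    simp only [Finset.sum_mul, Finset.mul_sum]
    rw [h1]
    exact Finset.sum_congr rfl fun _ _ => Finset.sum_congr rfl fun _ _ =>
      Finset.sum_congr rfl fun _ _ => by ring
  have e2 : ∑ a, ∑ b, (∑ d, M.Γ c b d * M.h a d) * f a b =
      ∑ a, ∑ b, M.h a b * ∑ d, M.Γ c d b * f a d := by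
    simp only [Finset.sum_mul, Finset.mul_sum]
    rw [h2]
    exact Finset.sum_congr rfl fun _ _ => Finset.sum_congr rfl fun _ _ =>
      Finset.sum_congr rfl fun _ _ => by ring
  rw [con_apply, con_apply]
  simp only [map_sum, Derivation.leibniz, smul_eq_mul, D_h, mul_sub, Finset.sum_sub_distrib,
    Finset.sum_add_distrib, mul_comm (f _ _) _, sub_mul, neg_mul, Finset.sum_neg_distrib,
    e1, e2]
  ring

/-- The trace over the first two indices. -/
def tr (T : Tens A (k + 2)) : Tens A k := fun J =>
  M.con fun a b => T (Matrix.vecCons a (Matrix.vecCons b J))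

/-- The divergence on the first index. -/
def dv (T : Tens A (k + 1)) : Tens A k := M.tr (M.cov T)

/-- The Laplacian. -/
def lp (T : Tens A k) : Tens A k := M.tr (M.cov (M.cov T))

theorem tr_apply (T : Tens A (k + 2)) (J : Fin k → Fin 4) :
    M.tr T J = M.con fun a b => T (Matrix.vecCons a (Matrix.vecCons b J)) := rfl

theorem dv_apply (T : Tens A (k + 1)) (J : Fin k → Fin 4) :
    M.dv T J = M.con fun a b => M.cov T (Matrix.vecCons a (Matrix.vecCons b J)) := rfl

/-- The covariant derivative commutes with the trace. -/
theorem cov_tr (T : Tens A (k + 2)) (c : Fin 4) (J : Fin k → Fin 4) :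
    M.cov (M.tr T) (Matrix.vecCons c J) =
      M.con fun a b => M.cov T (Matrix.vecCons c (Matrix.vecCons a (Matrix.vecCons b J))) := by
  simp only [cov_cons, act_cons, tr_apply, D_con, con_sub, con_add]
  have : act (M.Γ c) (M.tr T) J = M.con fun a b =>
      act (M.Γ c) (fun K => T (Matrix.vecCons a (Matrix.vecCons b K))) J := by
    simp only [act_apply, tr_apply, con_sum, con_mul]
  rw [this]; ring

/-- Multiplication by the metric, `g_{ab} T_{...}`. -/
def gOut (T : Tens A k) : Tens A (k + 2) := fun I =>
  M.g (I 0) (I 1) * T (Fin.tail (Fin.tail I))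

theorem gOut_cons (T : Tens A k) (a b : Fin 4) (J : Fin k → Fin 4) :
    M.gOut T (Matrix.vecCons a (Matrix.vecCons b J)) = M.g a b * T J := rfl

/-- The metric is parallel. -/
theorem cov_gOut (T : Tens A k) (c a b : Fin 4) (J : Fin k → Fin 4) :
    M.cov (M.gOut T) (Matrix.vecCons c (Matrix.vecCons a (Matrix.vecCons b J))) =
      M.g a b * M.cov T (Matrix.vecCons c J) := by
  simp only [cov_cons, act_cons, gOut_cons, Derivation.leibniz, D_g, smul_eq_mul, mul_sub]
  have : act (M.Γ c) (fun K => M.g a b * T K) J = M.g a b * act (M.Γ c) T J := by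
    exact congrFun ((act (M.Γ c)).map_smul (M.g a b) T) J
  rw [this]
  simp only [mul_add, Finset.mul_sum]
  have e1 : ∑ d, M.Γ c d a * (M.g d b * T J) = ∑ d, T J * (M.Γ c d a * M.g d b) :=
    Finset.sum_congr rfl fun _ _ => by ring
  have e2 : ∑ d, M.Γ c d b * (M.g a d * T J) = ∑ d, T J * (M.Γ c d b * M.g a d) :=
    Finset.sum_congr rfl fun _ _ => by ring
  rw [e1, e2]; ring

/-- The covariant derivative commutes with permutations of the indices. -/
theorem cov_reindex (T : Tens A k) (r : Fin k → Fin k) (hr : Function.Bijective r) (c : Fin 4)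
    (J : Fin k → Fin 4) : M.cov (fun I => T (I ∘ r)) (Matrix.vecCons c J) =
      M.cov T (Matrix.vecCons c (J ∘ r)) := by
  simp only [cov_cons, act_apply]
  congr 1
  rw [← (Equiv.ofBijective r hr).sum_comp]
  refine Finset.sum_congr rfl fun i _ => Finset.sum_congr rfl fun d _ => ?_
  rw [Equiv.ofBijective_apply]
  congr 2
  funext j
  by_cases hij : j = i
  · subst hij; simp
  · simp [Function.update_of_ne hij, Function.update_of_ne (hr.injective.ne hij)]

/-! ### The Ricci identity -/

theorem D_act (c : Fin 4) (X : Matrix (Fin 4) (Fin 4) A) (T : Tens A k) (J : Fin k → Fin 4) :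
    M.D c (act X T J) = act (X.map (M.D c)) T J + act X (fun K => M.D c (T K)) J := by
  simp only [act_apply, map_sum, Derivation.leibniz, smul_eq_mul, Matrix.map_apply,
    Finset.sum_add_distrib]
  rw [add_comm]
  congr 1
  exact Finset.sum_congr rfl fun _ _ => Finset.sum_congr rfl fun _ _ => by ring

/-- The curvature, as the matrix `(d, c)` of the pair `(a, b)`. -/
def R (a b : Fin 4) : Matrix (Fin 4) (Fin 4) A :=
  (M.Γ b).map (M.D a) - (M.Γ a).map (M.D b) + (M.Γ a * M.Γ b - M.Γ b * M.Γ a)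

/-- The Ricci identity on covariant tensors of any rank. -/
theorem ricci_identity (T : Tens A k) (a b : Fin 4) (J : Fin k → Fin 4) :
    M.cov (M.cov T) (Matrix.vecCons a (Matrix.vecCons b J)) -
      M.cov (M.cov T) (Matrix.vecCons b (Matrix.vecCons a J)) = -act (M.R a b) T J := by
  have hR : act (M.R a b) T J = act ((M.Γ b).map (M.D a)) T J - act ((M.Γ a).map (M.D b)) T J
      + act (M.Γ a * M.Γ b - M.Γ b * M.Γ a) T J := by
    simp only [act_apply, R, Matrix.sub_apply, Matrix.add_apply, sub_mul, add_mul,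
      Finset.sum_sub_distrib, Finset.sum_add_distrib]
  have hc : ∀ b : Fin 4, (fun K => M.cov T (Matrix.vecCons b K)) =
      (fun K => M.D b (T K)) - act (M.Γ b) T := fun b => by
    funext K; rw [cov_cons, Pi.sub_apply]
  rw [M.cov_cons (M.cov T), M.cov_cons (M.cov T), act_cons, act_cons, hc, hc, map_sub, map_sub,
    Pi.sub_apply, Pi.sub_apply, M.cov_cons T, M.cov_cons T, map_sub, map_sub, D_act, D_act, hR,
    ← act_commutator, M.D_comm a b]
  simp only [M.Γ_symm _ a b]
  ring

end MetricAlgebra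

/-! ### Constant curvature -/

/-- A metric algebra of constant curvature with cosmological constant `L`. -/
structure ConstCurvAlgebra (A : Type*) [CommRing A] [Algebra ℝ A] extends MetricAlgebra A where
  L : ℝ
  curv : ∀ a b d c, toMetricAlgebra.R a b d c =
    (L / 3) • ((if d = a then g b c else 0) - (if d = b then g a c else 0))

namespace ConstCurvAlgebra

open MetricAlgebra Matrix

variable {A : Type*} [CommRing A] [Algebra ℝ A] (M : ConstCurvAlgebra A) {k : ℕ}

theorem ricci (T : Tens A k) (a b : Fin 4) (J : Fin k → Fin 4) :
    M.cov (M.cov T) (vecCons a (vecCons b J)) = M.cov (M.cov T) (vecCons b (vecCons a J)) -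
      (M.L / 3) • ∑ i, (M.g b (J i) * T (Function.update J i a) -
        M.g a (J i) * T (Function.update J i b)) := by
  have h := M.ricci_identity T a b J
  have h2 : act (M.R a b) T J = (M.L / 3) • ∑ i, (M.g b (J i) * T (Function.update J i a) -
        M.g a (J i) * T (Function.update J i b)) := by
    rw [act_apply, Finset.smul_sum]
    refine Finset.sum_congr rfl fun i _ => ?_
    simp only [M.curv, smul_mul_assoc, ← Finset.smul_sum, sub_mul, ite_mul, zero_mul,
      Finset.sum_sub_distrib, Finset.sum_ite_eq', Finset.mem_univ, if_true]
  rw [← h2]; linear_combination h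

/-- Commuting a divergence past a covariant derivative. -/
theorem con_cov_cov (T : Tens A (k + 1)) (c : Fin 4) (J : Fin k → Fin 4) :
    M.con (fun d e => M.cov (M.cov T) (vecCons d (vecCons c (vecCons e J)))) =
      M.cov (M.dv T) (vecCons c J) + M.L • T (vecCons c J) -
        (M.L / 3) • ∑ i, (M.g c (J i) * M.con (fun d e => T (vecCons d (Function.update J i e))) -
          T (vecCons (J i) (Function.update J i c))) := by
  rw [dv, cov_tr]
  simp only [M.ricci T _ c, Fin.sum_univ_succ, cons_val_zero, cons_val_succ, update_cons_zero,
    update_cons_succ]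
  simp only [con_sub, con_smul, con_add, con_sum, con_mul]
  have h : ∀ i, M.con (fun d e => T (vecCons e (Function.update J i d))) =
      M.con (fun d e => T (vecCons d (Function.update J i e))) := fun i =>
    M.con_swap fun d e => T (vecCons d (Function.update J i e))
  have h1 : M.con (fun d e => M.g c e * T (vecCons d J)) = T (vecCons c J) :=
    M.con_right' c fun d => T (vecCons d J)
  have h2 : ∀ i, M.con (fun d e => M.g d (J i) * T (vecCons e (Function.update J i c))) =
      T (vecCons (J i) (Function.update J i c)) := fun i =>
    M.con_left (J i) fun e => T (vecCons e (Function.update J i c))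
  simp only [h, h1, h2, con_g]
  algebra

theorem cov_skew (T : Tens A (k + 2))
    (hT : ∀ a b J, T (vecCons a (vecCons b J)) = -T (vecCons b (vecCons a J)))
    (f a b : Fin 4) (J : Fin k → Fin 4) : M.cov T (vecCons f (vecCons a (vecCons b J))) =
      -M.cov T (vecCons f (vecCons b (vecCons a J))) := by
  have h : (fun K => T (vecCons a (vecCons b K))) = -fun K => T (vecCons b (vecCons a K)) :=
    funext fun K => hT a b K
  simp only [cov_cons, act_cons]
  rw [h, map_neg, Pi.neg_apply, hT a b, map_neg]
  simp only [hT _ b, hT a _, mul_neg, Finset.sum_neg_distrib]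
  ring

theorem cov_skew_succ (T : Tens A (k + 3))
    (hT : ∀ d a b J, T (vecCons d (vecCons a (vecCons b J))) =
      -T (vecCons d (vecCons b (vecCons a J))))
    (f d a b : Fin 4) (J : Fin k → Fin 4) :
    M.cov T (vecCons f (vecCons d (vecCons a (vecCons b J)))) =
      -M.cov T (vecCons f (vecCons d (vecCons b (vecCons a J)))) := by
  have h : (fun K => T (vecCons d (vecCons a (vecCons b K)))) =
      -fun K => T (vecCons d (vecCons b (vecCons a K))) := funext fun K => hT d a b K
  simp only [cov_cons, act_cons]
  rw [h, map_neg, Pi.neg_apply, hT d a b, map_neg]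
  simp only [hT _ a b, hT _ _ b, hT _ a _, mul_neg, Finset.sum_neg_distrib]
  ring

/-- The double divergence of a tensor that is skew in its first two indices. -/
theorem dv_dv_skew (T : Tens A (k + 2))
    (hT : ∀ a b J, T (vecCons a (vecCons b J)) = -T (vecCons b (vecCons a J)))
    (J : Fin k → Fin 4) :
    M.dv (M.dv T) J =
      (M.L / 3) • ∑ i, M.con fun d e => T (vecCons d (vecCons (J i) (Function.update J i e))) := by
  have hT2 : ∀ f d e c, M.cov (M.cov T) (vecCons f (vecCons d (vecCons e (vecCons c J)))) =
      -M.cov (M.cov T) (vecCons f (vecCons d (vecCons c (vecCons e J)))) :=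
    fun f d e c => M.cov_skew_succ _ (M.cov_skew T hT) f d e c J
  -- exchanging the two contractions and using skewness gives `Z` with the derivatives in the
  -- other order and the opposite sign, so `2 Z` is a curvature term
  set Z := M.dv (M.dv T) J with hZ
  have z1 : Z = M.con fun f c => M.con fun d e =>
      M.cov (M.cov T) (vecCons f (vecCons d (vecCons e (vecCons c J)))) := by
    rw [hZ, dv_apply]; simp only [dv, cov_tr]
  have z2 : Z = -M.con fun f c => M.con fun d e =>
      M.cov (M.cov T) (vecCons d (vecCons f (vecCons e (vecCons c J)))) := by
    rw [z1, con_comm, ← con_neg]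
    simp only [← con_neg, ← hT2]
  have z3 : M.con (fun f c => M.con fun d e =>
      M.cov (M.cov T) (vecCons f (vecCons d (vecCons e (vecCons c J))))) =
      M.con (fun f c => M.con fun d e =>
      M.cov (M.cov T) (vecCons d (vecCons f (vecCons e (vecCons c J))))) +
      (2 * M.L / 3) • ∑ i, M.con fun d e =>
        T (vecCons d (vecCons (J i) (Function.update J i e))) := by
    have hr : (fun f c => M.con fun d e =>
        M.cov (M.cov T) (vecCons f (vecCons d (vecCons e (vecCons c J))))) = _ :=
      funext fun f => funext fun c => congrArg M.con (funext fun d => funext fun e =>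
        M.ricci T f d (vecCons e (vecCons c J)))
    rw [hr]
    simp only [Fin.sum_univ_succ (n := k + 1), Fin.sum_univ_succ (n := k), cons_val_zero,
      cons_val_succ, update_cons_zero, update_cons_succ]
    simp only [con_sub, con_smul, con_add, con_sum]
    have s1 : M.con (fun a b => T (vecCons a (vecCons b J))) = 0 :=
      M.con_skew _ fun a b => hT a b J
    have s1' : M.con (fun a b => T (vecCons b (vecCons a J))) = 0 :=
      M.con_skew _ fun a b => hT b a J
    have a1 : ∀ x y K, M.con (fun d e => M.g d x * T (vecCons e (vecCons y K))) =
      T (vecCons x (vecCons y K)) := fun x y K =>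
        M.con_left x fun e => T (vecCons e (vecCons y K))
    have a2 : ∀ x y, M.con (fun d e => M.g x e * T (vecCons d (vecCons y J))) =
      T (vecCons x (vecCons y J)) := fun x y =>
        M.con_right' x fun d => T (vecCons d (vecCons y J))
    have a5 : ∀ i, M.con (fun a b => T (vecCons (J i) (vecCons b (Function.update J i a)))) =
        -M.con fun d e => T (vecCons d (vecCons (J i) (Function.update J i e))) := fun i => by
      rw [← con_neg, ← con_swap]
      simp only [hT (J i)]
    have a6 : ∀ i, M.con (fun a b => M.g a (J i) * M.con fun d e =>
        T (vecCons e (vecCons b (Function.update J i d)))) =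
        M.con fun d e => T (vecCons d (vecCons (J i) (Function.update J i e))) := fun i => by
      rw [M.con_left (J i) fun b => M.con fun d e => T (vecCons e (vecCons b
        (Function.update J i d)))]
      exact M.con_swap fun d e => T (vecCons d (vecCons (J i) (Function.update J i e)))
    simp only [a1, a2, con_g, con_mul, s1, s1', a5, a6, Finset.sum_sub_distrib,
      Finset.sum_neg_distrib]
    algebra
  have z4 : (2 : ℝ) • Z = (2 * M.L / 3) • ∑ i, M.con fun d e =>
        T (vecCons d (vecCons (J i) (Function.update J i e))) := by
    linear_combination (norm := algebra) z1 + z2 + z3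
  have z5 := congrArg ((1 / 2 : ℝ) • ·) z4
  simp only [smul_smul] at z5
  rw [show (1 / 2 : ℝ) * 2 = 1 by norm_num, one_smul] at z5
  rw [z5]; congr 1; ring

end ConstCurvAlgebra

namespace ConstCurvAlgebra

open MetricAlgebra Matrix

/-! ### Tensors of low rank -/

section Ext

variable {A : Type*}

theorem tens0_ext {S T : Tens A 0} (h : S ![] = T ![]) : S = T := by
  funext I; rw [Subsingleton.elim I ![], h]

theorem tens1_ext {S T : Tens A 1} (h : ∀ a, S ![a] = T ![a]) : S = T := by
  funext I
  have : I = ![I 0] := by funext i; fin_cases i; rfl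
  rw [this]; exact h _

theorem tens2_ext {S T : Tens A 2} (h : ∀ a b, S ![a, b] = T ![a, b]) : S = T := by
  funext I
  have : I = ![I 0, I 1] := by funext i; fin_cases i <;> rfl
  rw [this]; exact h _ _

theorem tens3_ext {S T : Tens A 3} (h : ∀ a b c, S ![a, b, c] = T ![a, b, c]) : S = T := by
  funext I
  have : I = ![I 0, I 1, I 2] := by funext i; fin_cases i <;> rfl
  rw [this]; exact h _ _ _

theorem tens4_ext {S T : Tens A 4} (h : ∀ a b c d, S ![a, b, c, d] = T ![a, b, c, d]) :
    S = T := by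
  funext I
  have : I = ![I 0, I 1, I 2, I 3] := by funext i; fin_cases i <;> rfl
  rw [this]; exact h _ _ _ _

end Ext

variable {A : Type*} [CommRing A] [Algebra ℝ A] (M : ConstCurvAlgebra A)

/-! ### Traces, divergences and Laplacians in components -/

theorem tr_two (T : Tens A 2) : M.tr T ![] = M.con fun a b => T ![a, b] := rfl

theorem tr_three (T : Tens A 3) (c : Fin 4) : M.tr T ![c] = M.con fun a b => T ![a, b, c] := rfl

theorem dv_one (T : Tens A 1) : M.dv T ![] = M.con fun d e => M.cov T ![d, e] := rfl

theorem dv_two (T : Tens A 2) (a : Fin 4) :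
    M.dv T ![a] = M.con fun d e => M.cov T ![d, e, a] := rfl

theorem dv_three (T : Tens A 3) (a b : Fin 4) :
    M.dv T ![a, b] = M.con fun d e => M.cov T ![d, e, a, b] := rfl

theorem dv_four (T : Tens A 4) (a b c : Fin 4) :
    M.dv T ![a, b, c] = M.con fun d e => M.cov T ![d, e, a, b, c] := rfl

theorem lp_one (T : Tens A 1) (a : Fin 4) :
    M.lp T ![a] = M.con fun d e => M.cov (M.cov T) ![d, e, a] := rfl

theorem lp_two (T : Tens A 2) (a b : Fin 4) :
    M.lp T ![a, b] = M.con fun d e => M.cov (M.cov T) ![d, e, a, b] := rfl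

theorem lp_three (T : Tens A 3) (a b c : Fin 4) :
    M.lp T ![a, b, c] = M.con fun d e => M.cov (M.cov T) ![d, e, a, b, c] := rfl

theorem cov_tr_two (T : Tens A 2) (c : Fin 4) :
    M.cov (M.tr T) ![c] = M.con fun a b => M.cov T ![c, a, b] := M.cov_tr T c ![]

theorem cov_tr_three (T : Tens A 3) (c d : Fin 4) :
    M.cov (M.tr T) ![c, d] = M.con fun a b => M.cov T ![c, a, b, d] := M.cov_tr T c ![d]

/-! ### The Ricci identity on tensors of rank one and two -/

theorem hess_symm (σ : Tens A 0) (a b : Fin 4) :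
    M.cov (M.cov σ) ![a, b] = M.cov (M.cov σ) ![b, a] := by
  simpa using M.ricci σ a b ![]

theorem ricci_one (T : Tens A 1) (a b c : Fin 4) :
    M.cov (M.cov T) ![a, b, c] = M.cov (M.cov T) ![b, a, c] -
      (M.L / 3) • (M.g b c * T ![a] - M.g a c * T ![b]) := by
  have h := M.ricci T a b ![c]
  simpa only [Fin.sum_univ_succ, Finset.univ_eq_empty, Finset.sum_empty, add_zero, cons_val_zero,
    cons_val_succ, update_cons_zero, update_cons_succ] using h

theorem ricci_two (T : Tens A 2) (a b c d : Fin 4) :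
    M.cov (M.cov T) ![a, b, c, d] = M.cov (M.cov T) ![b, a, c, d] -
      (M.L / 3) • (M.g b c * T ![a, d] - M.g a c * T ![b, d] +
        (M.g b d * T ![c, a] - M.g a d * T ![c, b])) := by
  have h := M.ricci T a b ![c, d]
  simpa only [Fin.sum_univ_succ, Finset.univ_eq_empty, Finset.sum_empty, add_zero, cons_val_zero,
    cons_val_succ, update_cons_zero, update_cons_succ] using h

/-! ### Divergence of a covariant derivative on tensors of rank one, two and three -/

theorem con_cov_cov_one (T : Tens A 1) (c : Fin 4) :
    M.con (fun d e => M.cov (M.cov T) ![d, c, e]) = M.cov (M.dv T) ![c] + M.L • T ![c] := by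
  simpa using M.con_cov_cov T c ![]

theorem con_cov_cov_two (T : Tens A 2) (c a : Fin 4) :
    M.con (fun d e => M.cov (M.cov T) ![d, c, e, a]) = M.cov (M.dv T) ![c, a] + M.L • T ![c, a] -
      (M.L / 3) • (M.g c a * M.tr T ![] - T ![a, c]) := by
  have h := M.con_cov_cov T c ![a]
  simpa only [tr_apply, Fin.sum_univ_succ, Finset.univ_eq_empty, Finset.sum_empty, add_zero,
    cons_val_zero, cons_val_succ, update_cons_zero, update_cons_succ] using h

theorem con_cov_cov_three (T : Tens A 3) (c a b : Fin 4) :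
    M.con (fun d e => M.cov (M.cov T) ![d, c, e, a, b]) =
      M.cov (M.dv T) ![c, a, b] + M.L • T ![c, a, b] -
      (M.L / 3) • (M.g c a * M.tr T ![b] - T ![a, c, b] +
        (M.g c b * M.con (fun d e => T ![d, a, e]) - T ![b, a, c])) := by
  have h := M.con_cov_cov T c ![a, b]
  simpa only [tr_apply, Fin.sum_univ_succ, Finset.univ_eq_empty, Finset.sum_empty, add_zero,
    cons_val_zero, cons_val_succ, update_cons_zero, update_cons_succ] using h

/-! ### Double divergences of skew tensors -/

theorem dv_dv_skew_two (T : Tens A 2) (hT : ∀ a b, T ![a, b] = -T ![b, a]) :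
    M.dv (M.dv T) ![] = 0 := by
  have h := M.dv_dv_skew T (fun a b J => by rw [Subsingleton.elim J ![]]; exact hT a b) ![]
  simpa using h

theorem dv_dv_skew_three (T : Tens A 3) (hT : ∀ a b c, T ![a, b, c] = -T ![b, a, c])
    (a : Fin 4) : M.dv (M.dv T) ![a] = (M.L / 3) • M.con fun d e => T ![d, a, e] := by
  have hJ : ∀ J : Fin 1 → Fin 4, J = ![J 0] := fun J => by funext i; fin_cases i; rfl
  have h := M.dv_dv_skew T (fun a b J => by rw [hJ J]; exact hT a b _) ![a]
  simpa only [Fin.sum_univ_succ, Finset.univ_eq_empty, Finset.sum_empty, add_zero, cons_val_zero,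
    cons_val_succ, update_cons_zero, update_cons_succ] using h

theorem dv_dv_skew_four (T : Tens A 4) (hT : ∀ a b c d, T ![a, b, c, d] = -T ![b, a, c, d])
    (a b : Fin 4) : M.dv (M.dv T) ![a, b] = (M.L / 3) •
      (M.con (fun d e => T ![d, a, e, b]) + M.con fun d e => T ![d, b, a, e]) := by
  have hJ : ∀ J : Fin 2 → Fin 4, J = ![J 0, J 1] := fun J => by funext i; fin_cases i <;> rfl
  have h := M.dv_dv_skew T (fun a b J => by rw [hJ J]; exact hT a b _ _) ![a, b]
  simpa only [Fin.sum_univ_succ, Finset.univ_eq_empty, Finset.sum_empty, add_zero, cons_val_zero,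
    cons_val_succ, update_cons_zero, update_cons_succ] using h

/-! ### Permutations of the indices under the covariant derivative -/

theorem comp_cons {m k : ℕ} (I : Fin m → Fin 4) (x : Fin m) (u : Fin k → Fin m) :
    I ∘ vecCons x u = vecCons (I x) (I ∘ u) := by
  funext i; refine Fin.cases rfl (fun _ => rfl) i

theorem comp_nil {m : ℕ} (I : Fin m → Fin 4) : I ∘ ![] = ![] := Subsingleton.elim _ _

theorem cov_perm_two (T : Tens A 2) (c a b : Fin 4) :
    M.cov (fun I => T ![I 1, I 0]) ![c, a, b] = M.cov T ![c, b, a] := by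
  have h := M.cov_reindex T ![1, 0] (by decide) c ![a, b]
  simpa [comp_cons, comp_nil] using h

/-- The permutation `r` of the indices of a tensor of rank three. -/
theorem cov_perm_three (T : Tens A 3) (r₀ r₁ r₂ : Fin 3)
    (hr : Function.Bijective ![r₀, r₁, r₂]) (c : Fin 4) (J : Fin 3 → Fin 4) :
    M.cov (fun I => T ![I r₀, I r₁, I r₂]) (vecCons c J) = M.cov T ![c, J r₀, J r₁, J r₂] := by
  have h := M.cov_reindex T ![r₀, r₁, r₂] hr c J
  simpa [comp_cons, comp_nil] using h

theorem cov_perm_four (T : Tens A 4) (r₀ r₁ r₂ r₃ : Fin 4)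
    (hr : Function.Bijective ![r₀, r₁, r₂, r₃]) (c : Fin 4) (J : Fin 4 → Fin 4) :
    M.cov (fun I => T ![I r₀, I r₁, I r₂, I r₃]) (vecCons c J) =
      M.cov T ![c, J r₀, J r₁, J r₂, J r₃] := by
  have h := M.cov_reindex T ![r₀, r₁, r₂, r₃] hr c J
  simpa [comp_cons, comp_nil] using h

theorem cov_symm_two {T : Tens A 2} (hT : ∀ a b, T ![a, b] = T ![b, a]) (c a b : Fin 4) :
    M.cov T ![c, a, b] = M.cov T ![c, b, a] := by
  rw [← cov_perm_two]
  exact congrFun (congrArg M.cov (tens2_ext fun a b => hT b a)) _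

/-- Second derivatives of a trace. -/
theorem cov_cov_tr_three (T : Tens A 3) (e c d : Fin 4) : M.cov (M.cov (M.tr T)) ![e, c, d] =
    M.con fun a b => M.cov (M.cov T) ![e, c, a, b, d] := by
  have h : M.cov (M.tr T) = M.tr fun I => M.cov T ![I 2, I 0, I 1, I 3] :=
    tens2_ext fun c d => M.cov_tr_three T c d
  rw [h]
  refine (M.cov_tr _ e ![c, d]).trans ?_
  refine congrArg M.con (funext fun a => funext fun b => ?_)
  exact M.cov_perm_four (M.cov T) 2 0 1 3 (by decide) e ![a, b, c, d]

/-- Total symmetry of a tensor of rank three, in terms of generating transpositions. -/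
def Sym (T : Tens A 3) : Prop :=
  (∀ a b c, T ![a, b, c] = T ![b, a, c]) ∧ ∀ a b c, T ![a, b, c] = T ![a, c, b]

theorem cov_symm_snd {T : Tens A 3} (hT : ∀ a b c, T ![a, b, c] = T ![a, c, b])
    (d a b c : Fin 4) : M.cov T ![d, a, b, c] = M.cov T ![d, a, c, b] := by
  have h : T = fun I => T ![I 0, I 2, I 1] := tens3_ext fun a b c => hT a b c
  conv_lhs => rw [h]
  exact M.cov_perm_three T 0 2 1 (by decide) d ![a, b, c]

theorem cov_symm_fst {T : Tens A 3} (hT : ∀ a b c, T ![a, b, c] = T ![b, a, c])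
    (d a b c : Fin 4) : M.cov T ![d, a, b, c] = M.cov T ![d, b, a, c] := by
  have h : T = fun I => T ![I 1, I 0, I 2] := tens3_ext fun a b c => hT a b c
  conv_lhs => rw [h]
  exact M.cov_perm_three T 1 0 2 (by decide) d ![a, b, c]

/-! ### Symmetrisations and multiples of the metric -/

/-- `T_{(abc)}`. -/
def symm3 (T : Tens A 3) : Tens A 3 := fun I => (1 / 6 : ℝ) •
  (T ![I 0, I 1, I 2] + T ![I 0, I 2, I 1] + T ![I 1, I 0, I 2] + T ![I 1, I 2, I 0] +
    T ![I 2, I 0, I 1] + T ![I 2, I 1, I 0])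

theorem symm3_apply (T : Tens A 3) (a b c : Fin 4) : symm3 T ![a, b, c] = (1 / 6 : ℝ) •
    (T ![a, b, c] + T ![a, c, b] + T ![b, a, c] + T ![b, c, a] + T ![c, a, b] + T ![c, b, a]) :=
  rfl

theorem cov_symm3 (T : Tens A 3) (d a b c : Fin 4) : M.cov (symm3 T) ![d, a, b, c] =
    (1 / 6 : ℝ) • (M.cov T ![d, a, b, c] + M.cov T ![d, a, c, b] + M.cov T ![d, b, a, c] +
      M.cov T ![d, b, c, a] + M.cov T ![d, c, a, b] + M.cov T ![d, c, b, a]) := by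
  have h : symm3 T = (1 / 6 : ℝ) • ((fun I => T ![I 0, I 1, I 2]) + (fun I => T ![I 0, I 2, I 1]) +
    (fun I => T ![I 1, I 0, I 2]) + (fun I => T ![I 1, I 2, I 0]) + (fun I => T ![I 2, I 0, I 1]) +
    fun I => T ![I 2, I 1, I 0]) := rfl
  rw [h]
  simp only [map_smul, map_add, Pi.smul_apply, Pi.add_apply]
  rw [M.cov_perm_three T 0 1 2 (by decide), M.cov_perm_three T 0 2 1 (by decide),
    M.cov_perm_three T 1 0 2 (by decide), M.cov_perm_three T 1 2 0 (by decide),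
    M.cov_perm_three T 2 0 1 (by decide), M.cov_perm_three T 2 1 0 (by decide)]
  rfl

theorem cov_cov_gOut (T : Tens A 1) (e d a b c : Fin 4) :
    M.cov (M.cov (M.gOut T)) ![e, d, a, b, c] = M.g a b * M.cov (M.cov T) ![e, d, c] := by
  have h : M.cov (M.gOut T) = fun I => M.gOut (M.cov T) ![I 1, I 2, I 0, I 3] :=
    tens4_ext fun d a b c => M.cov_gOut T d a b ![c]
  rw [h, M.cov_perm_four _ 1 2 0 3 (by decide)]
  exact M.cov_gOut (M.cov T) e a b ![d, c]

/-- `g_{(ab} X_{c)}`. -/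
def gSym (X : Tens A 1) : Tens A 3 := fun I => (1 / 3 : ℝ) •
  (M.g (I 0) (I 1) * X ![I 2] + M.g (I 1) (I 2) * X ![I 0] + M.g (I 0) (I 2) * X ![I 1])

theorem gSym_apply (X : Tens A 1) (a b c : Fin 4) : M.gSym X ![a, b, c] = (1 / 3 : ℝ) •
    (M.g a b * X ![c] + M.g b c * X ![a] + M.g a c * X ![b]) := rfl

theorem gSym_eq (X : Tens A 1) : M.gSym X = (1 / 3 : ℝ) • ((fun I => M.gOut X ![I 0, I 1, I 2]) +
    (fun I => M.gOut X ![I 1, I 2, I 0]) + fun I => M.gOut X ![I 0, I 2, I 1]) := by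
  refine tens3_ext fun a b c => ?_
  simp only [gSym_apply, Pi.smul_apply, Pi.add_apply]
  rfl

theorem cov_gSym (X : Tens A 1) (d a b c : Fin 4) : M.cov (M.gSym X) ![d, a, b, c] =
    (1 / 3 : ℝ) • (M.g a b * M.cov X ![d, c] + M.g b c * M.cov X ![d, a] +
      M.g a c * M.cov X ![d, b]) := by
  rw [gSym_eq]
  simp only [map_smul, map_add, Pi.smul_apply, Pi.add_apply]
  rw [M.cov_perm_three _ 0 1 2 (by decide), M.cov_perm_three _ 1 2 0 (by decide),
    M.cov_perm_three _ 0 2 1 (by decide)]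
  exact congrArg _ (congrArg₂ _ (congrArg₂ _ (M.cov_gOut X d a b ![c]) (M.cov_gOut X d b c ![a]))
    (M.cov_gOut X d a c ![b]))

theorem cov_cov_gSym (X : Tens A 1) (e d a b c : Fin 4) :
    M.cov (M.cov (M.gSym X)) ![e, d, a, b, c] = (1 / 3 : ℝ) • (M.g a b * M.cov (M.cov X) ![e, d, c]
      + M.g b c * M.cov (M.cov X) ![e, d, a] + M.g a c * M.cov (M.cov X) ![e, d, b]) := by
  have h : M.cov (M.gSym X) = (1 / 3 : ℝ) • ((fun I => M.cov (M.gOut X) ![I 0, I 1, I 2, I 3]) +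
    (fun I => M.cov (M.gOut X) ![I 0, I 2, I 3, I 1]) +
      fun I => M.cov (M.gOut X) ![I 0, I 1, I 3, I 2]) := by
    refine tens4_ext fun d a b c => ?_
    rw [cov_gSym]
    exact congrArg _ (congrArg₂ _ (congrArg₂ _ (M.cov_gOut X d a b ![c]).symm
      (M.cov_gOut X d b c ![a]).symm) (M.cov_gOut X d a c ![b]).symm)
  rw [h]
  simp only [map_smul, map_add, Pi.smul_apply, Pi.add_apply]
  rw [M.cov_perm_four _ 0 1 2 3 (by decide), M.cov_perm_four _ 0 2 3 1 (by decide),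
    M.cov_perm_four _ 0 1 3 2 (by decide)]
  exact congrArg _ (congrArg₂ _ (congrArg₂ _ (M.cov_cov_gOut X e d a b c)
    (M.cov_cov_gOut X e d b c a)) (M.cov_cov_gOut X e d a c b))

theorem tr_gSym (X : Tens A 1) (c : Fin 4) : M.tr (M.gSym X) ![c] = (2 : ℝ) • X ![c] := by
  rw [tr_three]
  simp only [gSym_apply, con_add, con_smul, con_g]
  rw [M.con_right c fun a => X ![a], M.con_left c fun a => X ![a]]
  algebra

theorem dv_gSym (X : Tens A 1) (b c : Fin 4) : M.dv (M.gSym X) ![b, c] =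
    (1 / 3 : ℝ) • (M.cov X ![b, c] + M.cov X ![c, b] + M.g b c * M.dv X ![]) := by
  rw [dv_three]
  simp only [cov_gSym, con_add, con_smul, con_mul]
  rw [M.con_right b fun a => M.cov X ![a, c], M.con_right c fun a => M.cov X ![a, b]]
  rw [dv_one]
  algebra

theorem lp_gSym (X : Tens A 1) : M.lp (M.gSym X) = M.gSym (M.lp X) := by
  refine tens3_ext fun a b c => ?_
  rw [lp_three]
  simp only [cov_cov_gSym, con_add, con_smul, con_mul]
  rfl

/-! ### The first operator of the sequence -/

theorem cov_hess_symm (σ : Tens A 0) (c a b : Fin 4) :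
    M.cov (M.cov (M.cov σ)) ![c, a, b] = M.cov (M.cov (M.cov σ)) ![c, b, a] :=
  M.cov_symm_two (M.hess_symm σ) c a b

/-- `∇_{(a} ∇_b ∇_{c)} σ + (4L/3) g_{(ab} ∇_{c)} σ`, which is twice the first operator. -/
def gaugeOp (σ : Tens A 0) : Tens A 3 :=
  symm3 (M.cov (M.cov (M.cov σ))) + (4 * M.L / 3) • M.gSym (M.cov σ)

/-- The symmetrisation in `gaugeOp` can be undone by the Ricci identity, since `∇_c ∇_a ∇_b σ` is
already symmetric in `a` and `b`. -/
theorem gaugeOp_apply (σ : Tens A 0) (c a b : Fin 4) :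
    M.gaugeOp σ ![c, a, b] = M.cov (M.cov (M.cov σ)) ![c, a, b] +
      (2 * M.L / 3) • (M.g a b * M.cov σ ![c]) +
      (M.L / 3) • (M.g c a * M.cov σ ![b] + M.g c b * M.cov σ ![a]) := by
  have h1 := M.cov_hess_symm σ c a b
  have h2 := M.ricci_one (M.cov σ) a c b
  have h3 := M.cov_hess_symm σ a c b
  have h4 := M.ricci_one (M.cov σ) b c a
  have h5 := M.cov_hess_symm σ b c a
  simp only [gaugeOp, Pi.add_apply, Pi.smul_apply, symm3_apply, gSym_apply]
  rw [M.g_symm b a] at h4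
  linear_combination (norm := algebra) (-1 / 2 : ℝ) • h1 + (1 / 3 : ℝ) • (h2 + h4)
    + (-1 / 6 : ℝ) • (h3 + h5)

theorem sym_gaugeOp (σ : Tens A 0) : Sym (M.gaugeOp σ) := by
  constructor <;> intro a b c <;>
  · simp only [gaugeOp, Pi.add_apply, Pi.smul_apply, symm3_apply, gSym_apply, M.g_symm b a,
      M.g_symm c b]
    algebra

/-- The twisted exterior derivative annihilates the image of the first operator: this is where the
flatness of the tractor connection enters. -/
theorem cov_gaugeOp_comm (σ : Tens A 0) (d c a b : Fin 4) :
    M.cov (M.gaugeOp σ) ![d, c, a, b] = M.cov (M.gaugeOp σ) ![c, d, a, b] := by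
  have h : M.gaugeOp σ = M.cov (M.cov (M.cov σ)) + M.L • M.gSym (M.cov σ) +
      (M.L / 3) • fun I => M.gOut (M.cov σ) ![I 1, I 2, I 0] := by
    refine tens3_ext fun c a b => ?_
    rw [gaugeOp_apply]
    have e : M.gOut (M.cov σ) ![a, b, c] = M.g a b * M.cov σ ![c] := rfl
    simp only [Pi.add_apply, Pi.smul_apply, gSym_apply, cons_val_zero, cons_val_one, cons_val, e]
    algebra
  have h2 : ∀ d c, M.cov (fun I => M.gOut (M.cov σ) ![I 1, I 2, I 0]) ![d, c, a, b] =
      M.g a b * M.cov (M.cov σ) ![d, c] := fun d c => by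
    rw [M.cov_perm_three _ 1 2 0 (by decide)]
    exact M.cov_gOut (M.cov σ) d a b ![c]
  simp only [h, map_add, map_smul, Pi.add_apply, Pi.smul_apply, cov_gSym, h2]
  have h3 := M.ricci_two (M.cov (M.cov σ)) d c a b
  rw [M.hess_symm σ a c, M.hess_symm σ a d] at h3
  rw [h3, M.hess_symm σ c d]
  algebra

theorem tr_hess (σ : Tens A 0) : M.tr (M.cov (M.cov σ)) = M.lp σ := rfl

/-- `Δ ∇_c σ = ∇_c Δ σ + L ∇_c σ`. -/
theorem lp_grad (σ : Tens A 0) (c : Fin 4) :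
    M.lp (M.cov σ) ![c] = M.cov (M.lp σ) ![c] + M.L • M.cov σ ![c] := by
  have h := M.con_cov_cov_one (M.cov σ) c
  have h2 : M.dv (M.cov σ) = M.lp σ := rfl
  rw [h2] at h
  rw [lp_one, ← h]
  exact congrArg M.con (funext fun d => funext fun e => M.cov_hess_symm σ d e c)

theorem tr_symm3_hess (σ : Tens A 0) (c : Fin 4) :
    M.tr (symm3 (M.cov (M.cov (M.cov σ)))) ![c] =
      M.cov (M.lp σ) ![c] + (2 * M.L / 3) • M.cov σ ![c] := by
  have h1 := M.lp_grad σ c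
  rw [lp_one] at h1
  have h2 : M.con (fun a b => M.cov (M.cov (M.cov σ)) ![a, c, b]) =
      M.con fun a b => M.cov (M.cov (M.cov σ)) ![a, b, c] :=
    congrArg M.con (funext fun d => funext fun e => M.cov_hess_symm σ d c e)
  have h3 : M.con (fun a b => M.cov (M.cov (M.cov σ)) ![c, a, b]) = M.cov (M.lp σ) ![c] :=
    (M.cov_tr_two (M.cov (M.cov σ)) c).symm
  have h4 := M.con_swap fun a b => M.cov (M.cov (M.cov σ)) ![c, a, b]
  have h5 := M.con_swap fun a b => M.cov (M.cov (M.cov σ)) ![a, c, b]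
  have h6 := M.con_swap fun a b => M.cov (M.cov (M.cov σ)) ![a, b, c]
  rw [tr_three]
  simp only [symm3_apply, con_smul, con_add, h4, h5, h6, h2, h3, h1]
  algebra

/-! ### The detour operator -/

/-- The middle slot `∇.ψ_{ca} - ∇_c ψ̄_a` of the detour operator. -/
def detMid (ψ : Tens A 3) : Tens A 2 := M.dv ψ - M.cov (M.tr ψ)

/-- The negative of the bottom slot of the detour operator, the form index being the first. -/
def detBot (ψ : Tens A 3) : Tens A 3 := fun I => M.lp ψ I - M.cov (M.dv ψ) I +
  (M.L / 3) • (M.g (I 0) (I 1) * M.tr ψ ![I 2] + M.g (I 0) (I 2) * M.tr ψ ![I 1]) -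
    (5 * M.L / 3) • ψ I

/-- The field strength `∇_d ψ_{cab} - ∇_c ψ_{dab}`, the bottom slot of the twisted exterior
derivative. -/
def curl (ψ : Tens A 3) : Tens A 4 := fun I => M.cov ψ I - M.cov ψ ![I 1, I 0, I 2, I 3]

/-- The negative of the detour operator on symmetric tensors. -/
def det (ψ : Tens A 3) : Tens A 3 := symm3 (M.detBot ψ)

/-- The skew derivative `∇_c m_{ab} - ∇_a m_{cb}` of a tensor of rank two. -/
def curl₂ (m : Tens A 2) : Tens A 3 := fun I => M.cov m I - M.cov m ![I 1, I 0, I 2]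

theorem detMid_apply (ψ : Tens A 3) (c a : Fin 4) :
    M.detMid ψ ![c, a] = M.dv ψ ![c, a] - M.cov (M.tr ψ) ![c, a] := rfl

theorem detBot_apply (ψ : Tens A 3) (c a b : Fin 4) : M.detBot ψ ![c, a, b] =
    M.lp ψ ![c, a, b] - M.cov (M.dv ψ) ![c, a, b] +
      (M.L / 3) • (M.g c a * M.tr ψ ![b] + M.g c b * M.tr ψ ![a]) -
        (5 * M.L / 3) • ψ ![c, a, b] := rfl

theorem curl_apply (ψ : Tens A 3) (d c a b : Fin 4) :
    M.curl ψ ![d, c, a, b] = M.cov ψ ![d, c, a, b] - M.cov ψ ![c, d, a, b] := rfl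

theorem curl₂_apply (m : Tens A 2) (c a b : Fin 4) :
    M.curl₂ m ![c, a, b] = M.cov m ![c, a, b] - M.cov m ![a, c, b] := rfl

theorem cov_curl (ψ : Tens A 3) (e d c a b : Fin 4) : M.cov (M.curl ψ) ![e, d, c, a, b] =
    M.cov (M.cov ψ) ![e, d, c, a, b] - M.cov (M.cov ψ) ![e, c, d, a, b] := by
  have h : M.curl ψ = M.cov ψ - fun I => M.cov ψ ![I 1, I 0, I 2, I 3] := rfl
  rw [h, map_sub, Pi.sub_apply, M.cov_perm_four _ 1 0 2 3 (by decide)]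
  rfl

theorem cov_curl₂ (m : Tens A 2) (d c a b : Fin 4) : M.cov (M.curl₂ m) ![d, c, a, b] =
    M.cov (M.cov m) ![d, c, a, b] - M.cov (M.cov m) ![d, a, c, b] := by
  have h : M.curl₂ m = M.cov m - fun I => M.cov m ![I 1, I 0, I 2] := rfl
  rw [h, map_sub, Pi.sub_apply, M.cov_perm_three _ 1 0 2 (by decide)]
  rfl

section

variable {ψ : Tens A 3} (hψ : Sym ψ)
include hψ

theorem dv_symm (a b : Fin 4) : M.dv ψ ![a, b] = M.dv ψ ![b, a] := by
  simp only [dv_three]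
  exact congrArg M.con (funext fun d => funext fun e => M.cov_symm_snd hψ.2 d e a b)

theorem cov_dv_symm (c a b : Fin 4) : M.cov (M.dv ψ) ![c, a, b] = M.cov (M.dv ψ) ![c, b, a] :=
  M.cov_symm_two (M.dv_symm hψ) c a b

theorem tr_dv : M.tr (M.dv ψ) ![] = M.dv (M.tr ψ) ![] := by
  rw [tr_two, dv_one]
  simp only [dv_three, cov_tr_three]
  rw [con_comm]
  refine congrArg M.con (funext fun d => funext fun e => congrArg M.con
    (funext fun a => funext fun b => ?_))
  rw [M.cov_symm_fst hψ.1, M.cov_symm_snd hψ.2]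

theorem tr_detMid : M.tr (M.detMid ψ) ![] = 0 := by
  have h := M.tr_dv hψ
  rw [tr_two, dv_one] at h
  simp only [tr_two, detMid_apply, con_sub, h, sub_self]

/-- Up to sign, the bottom slot of the detour operator is the divergence of the field strength. -/
theorem dv_curl : M.dv (M.curl ψ) = M.detBot ψ := by
  refine tens3_ext fun c a b => ?_
  have h1 := M.con_cov_cov_three ψ c a b
  have h2 : M.con (fun d e => ψ ![d, a, e]) = M.tr ψ ![a] :=
    congrArg M.con (funext fun d => funext fun e => hψ.2 d a e)
  rw [h2, hψ.1 a c b, hψ.1 b a c, hψ.2 a b c, hψ.1 a c b] at h1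
  rw [detBot_apply, dv_four]
  simp only [cov_curl, con_sub, h1]
  rw [lp_three]
  algebra

/-- The middle slot of the detour operator is the trace of the field strength. -/
theorem con_curl (a b : Fin 4) :
    M.con (fun d e => M.curl ψ ![d, a, e, b]) = M.detMid ψ ![a, b] := by
  simp only [curl_apply, con_sub, detMid_apply, dv_three, cov_tr_three]
  congr 1
  exact congrArg M.con (funext fun d => funext fun e => M.cov_symm_fst hψ.1 d a e b)

/-- The field strength is skew in its first two indices, so its double divergence, the divergence
of the bottom slot on its form index, reduces to the curvature times its trace. -/
theorem dv_detBot (a b : Fin 4) : M.dv (M.detBot ψ) ![a, b] =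
    (M.L / 3) • (M.detMid ψ ![a, b] + M.detMid ψ ![b, a]) := by
  have h := M.dv_dv_skew_four (M.curl ψ) (fun a b c d => by simp only [curl_apply]; ring) a b
  have h2 : M.con (fun d e => M.curl ψ ![d, b, a, e]) =
      M.con fun d e => M.curl ψ ![d, b, e, a] := by
    refine congrArg M.con (funext fun d => funext fun e => ?_)
    rw [curl_apply, curl_apply, M.cov_symm_snd hψ.2 d, M.cov_symm_snd hψ.2 b]
  rwa [M.dv_curl hψ, h2, M.con_curl hψ, M.con_curl hψ] at h

theorem lp_symm_snd (a b c : Fin 4) : M.lp ψ ![a, b, c] = M.lp ψ ![a, c, b] := by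
  simp only [lp_three]
  refine congrArg M.con (funext fun d => funext fun e => ?_)
  have h : M.cov ψ = fun I => M.cov ψ ![I 0, I 1, I 3, I 2] :=
    tens4_ext fun d a b c => M.cov_symm_snd hψ.2 d a b c
  conv_lhs => rw [h]
  exact M.cov_perm_four (M.cov ψ) 0 1 3 2 (by decide) d ![e, a, b, c]

theorem lp_symm_fst (a b c : Fin 4) : M.lp ψ ![a, b, c] = M.lp ψ ![b, a, c] := by
  simp only [lp_three]
  refine congrArg M.con (funext fun d => funext fun e => ?_)
  have h : M.cov ψ = fun I => M.cov ψ ![I 0, I 2, I 1, I 3] :=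
    tens4_ext fun d a b c => M.cov_symm_fst hψ.1 d a b c
  conv_lhs => rw [h]
  exact M.cov_perm_four (M.cov ψ) 0 2 1 3 (by decide) d ![e, a, b, c]

theorem detBot_symm (c a b : Fin 4) : M.detBot ψ ![c, a, b] = M.detBot ψ ![c, b, a] := by
  rw [detBot_apply, detBot_apply, M.lp_symm_snd hψ c a b, M.cov_dv_symm hψ c a b, hψ.2 c a b]
  algebra

/-- The mixed-symmetry part of the bottom slot is a derivative of the middle slot. -/
theorem detBot_comm (c a b : Fin 4) :
    M.detBot ψ ![a, c, b] = M.detBot ψ ![c, a, b] + M.curl₂ (M.detMid ψ) ![c, a, b] := by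
  have h1 := M.lp_symm_fst hψ a c b
  have h2 : ∀ c a b, M.cov (M.detMid ψ) ![c, a, b] =
      M.cov (M.dv ψ) ![c, a, b] - M.cov (M.cov (M.tr ψ)) ![c, a, b] := fun c a b => by
    rw [detMid, map_sub, Pi.sub_apply]
  have h3 := M.ricci_one (M.tr ψ) c a b
  rw [detBot_apply, detBot_apply, curl₂_apply, h1, h2, h2, hψ.1 a c b, M.g_symm a c, h3]
  algebra

theorem det_apply (c a b : Fin 4) : M.det ψ ![c, a, b] = M.detBot ψ ![c, a, b] +
    (1 / 3 : ℝ) • (M.curl₂ (M.detMid ψ) ![c, a, b] + M.curl₂ (M.detMid ψ) ![c, b, a]) := by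
  rw [det, symm3_apply, M.detBot_symm hψ c b a, M.detBot_symm hψ a b c, M.detBot_symm hψ b a c,
    M.detBot_comm hψ c a b, M.detBot_comm hψ c b a, M.detBot_symm hψ c b a]
  algebra

theorem det_eq : M.det ψ = M.lp ψ - symm3 (M.cov (M.dv ψ)) +
    (2 * M.L / 3) • M.gSym (M.tr ψ) - (5 * M.L / 3) • ψ := by
  have h1 := M.lp_symm_fst hψ
  have h2 := M.lp_symm_snd hψ
  refine tens3_ext fun a b c => ?_
  simp only [det, Pi.add_apply, Pi.sub_apply, Pi.smul_apply, symm3_apply, gSym_apply,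
    detBot_apply]
  rw [h2 a c b, h1 b a c, h1 c a b, h2 a c b, h2 b c a, h1 b a c, h1 c b a, h2 b c a, h1 b a c,
    hψ.2 a c b, hψ.1 b a c, hψ.1 c a b, hψ.2 a c b, hψ.2 b c a, hψ.1 b a c, hψ.1 c b a, hψ.2 b c a,
    hψ.1 b a c, M.g_symm b a, M.g_symm c a, M.g_symm c b]
  algebra

/-- The divergence of a derivative of the middle slot. -/
theorem dv_curl₂_detMid (a b : Fin 4) : M.dv (M.curl₂ (M.detMid ψ)) ![a, b] =
    M.lp (M.detMid ψ) ![a, b] - M.cov (M.dv (M.detMid ψ)) ![a, b] - M.L • M.detMid ψ ![a, b] -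
      (M.L / 3) • M.detMid ψ ![b, a] := by
  rw [dv_three]
  simp only [cov_curl₂, con_sub]
  rw [con_cov_cov_two, M.tr_detMid hψ, lp_two]
  algebra

theorem dv_det (a b : Fin 4) : M.dv (M.det ψ) ![a, b] =
    (M.L / 3) • (M.detMid ψ ![a, b] + M.detMid ψ ![b, a]) + (1 / 3 : ℝ) •
      (M.dv (M.curl₂ (M.detMid ψ)) ![a, b] + M.dv (M.curl₂ (M.detMid ψ)) ![b, a]) := by
  have h : M.det ψ = M.detBot ψ + (1 / 3 : ℝ) • (M.curl₂ (M.detMid ψ) +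
      fun I => M.curl₂ (M.detMid ψ) ![I 0, I 2, I 1]) :=
    tens3_ext fun c a b => M.det_apply hψ c a b
  have h2 : ∀ d e, M.cov (fun I => M.curl₂ (M.detMid ψ) ![I 0, I 2, I 1]) ![d, e, a, b] =
      M.cov (M.curl₂ (M.detMid ψ)) ![d, e, b, a] := fun d e =>
    M.cov_perm_three _ 0 2 1 (by decide) d ![e, a, b]
  rw [← M.dv_detBot hψ]
  simp only [dv_three]
  rw [h]
  simp only [map_add, map_smul, Pi.add_apply, Pi.smul_apply, h2, con_add, con_smul]

theorem con_cov_detMid (c : Fin 4) :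
    M.con (fun a b => M.cov (M.detMid ψ) ![c, a, b]) = 0 := by
  rw [← cov_tr_two, show M.tr (M.detMid ψ) = 0 from tens0_ext (M.tr_detMid hψ), map_zero]
  rfl

theorem tr_det (c : Fin 4) : M.tr (M.det ψ) ![c] = -M.dv (M.detMid ψ) ![c] +
    (1 / 3 : ℝ) • M.con fun a b => M.cov (M.detMid ψ) ![a, c, b] := by
  have h1 : M.con (fun a b => M.detBot ψ ![a, b, c]) = -M.dv (M.detMid ψ) ![c] := by
    have e1 : M.con (fun a b => M.lp ψ ![a, b, c]) = M.lp (M.tr ψ) ![c] := by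
      rw [lp_one]
      simp only [lp_three, cov_cov_tr_three]
      exact M.con_comm _
    have e2 : M.dv (M.detMid ψ) ![c] = M.dv (M.dv ψ) ![c] - M.lp (M.tr ψ) ![c] := by
      rw [dv_two, detMid, map_sub]
      simp only [Pi.sub_apply, con_sub]
      rfl
    have e3 := M.con_left' c fun b => M.tr ψ ![b]
    simp only [detBot_apply, con_sub, con_add, con_smul, e1]
    rw [con_g, M.con_left c fun b => M.tr ψ ![b], e2, dv_two, tr_three]
    algebra
  have h2 : M.con (fun a b => M.curl₂ (M.detMid ψ) ![a, b, c]) = 0 :=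
    M.con_skew _ fun a b => by simp only [curl₂_apply]; ring
  have h3 := M.con_cov_detMid hψ c
  have h4 : M.con (fun a b => M.curl₂ (M.detMid ψ) ![a, c, b]) =
      M.con fun a b => M.cov (M.detMid ψ) ![a, c, b] := by
    simp only [curl₂_apply, con_sub, h3, sub_zero]
  rw [tr_three]
  simp only [M.det_apply hψ, con_add, con_smul, h1, h2, h4, zero_add]

end

/-! ### Linearity of traces, divergences and Laplacians -/

section

variable {k : ℕ} (r : ℝ)

theorem tr_add (S T : Tens A (k + 2)) : M.tr (S + T) = M.tr S + M.tr T := by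
  funext J; simp only [tr_apply, Pi.add_apply, con_add]

theorem tr_smul (T : Tens A (k + 2)) : M.tr (r • T) = r • M.tr T := by
  funext J; simp only [tr_apply, Pi.smul_apply, con_smul]

theorem tr_sub (S T : Tens A (k + 2)) : M.tr (S - T) = M.tr S - M.tr T := by
  funext J; simp only [tr_apply, Pi.sub_apply, con_sub]

theorem dv_add (S T : Tens A (k + 1)) : M.dv (S + T) = M.dv S + M.dv T := by
  simp only [dv, map_add, tr_add]

theorem dv_smul (T : Tens A (k + 1)) : M.dv (r • T) = r • M.dv T := by
  simp only [dv, map_smul, tr_smul]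

theorem dv_sub (S T : Tens A (k + 1)) : M.dv (S - T) = M.dv S - M.dv T := by
  simp only [dv, map_sub, tr_sub]

theorem lp_add (S T : Tens A k) : M.lp (S + T) = M.lp S + M.lp T := by
  simp only [MetricAlgebra.lp, map_add, tr_add]

theorem lp_smul (T : Tens A k) : M.lp (r • T) = r • M.lp T := by
  simp only [MetricAlgebra.lp, map_smul, tr_smul]

theorem lp_sub (S T : Tens A k) : M.lp (S - T) = M.lp S - M.lp T := by
  simp only [MetricAlgebra.lp, map_sub, tr_sub]

end

/-! ### The adjoint of the first operator annihilates the detour operator -/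

/-- The transpose of a tensor of rank two. -/
def tp {A : Type*} (m : Tens A 2) : Tens A 2 := fun I => m ![I 1, I 0]

theorem tp_apply {A : Type*} (m : Tens A 2) (a b : Fin 4) : tp m ![a, b] = m ![b, a] := rfl

theorem cov_tp (m : Tens A 2) (c a b : Fin 4) : M.cov (tp m) ![c, a, b] = M.cov m ![c, b, a] :=
  M.cov_perm_two m c a b

theorem dv_tp (m : Tens A 2) (c : Fin 4) :
    M.dv (tp m) ![c] = M.con fun a b => M.cov m ![a, c, b] := by
  simp only [dv_two, cov_tp]

/-- The double divergence of a tensor of rank two does not depend on the order of its indices. -/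
theorem dv_dv_tp (m : Tens A 2) : M.dv (M.dv (tp m)) = M.dv (M.dv m) := by
  have h := M.dv_dv_skew_two (m - tp m) fun a b => by
    simp only [Pi.sub_apply, tp_apply]; ring
  rw [dv_sub, dv_sub, Pi.sub_apply, sub_eq_zero] at h
  exact tens0_ext h.symm

/-- The formal adjoint of the first operator `½ gaugeOp`. -/
def adj (γ : Tens A 3) : Tens A 0 :=
  -((1 / 2 : ℝ) • M.dv (M.dv (M.dv γ))) - (2 * M.L / 3) • M.dv (M.tr γ)

theorem dv_dv_curl₂_detMid {ψ : Tens A 3} (hψ : Sym ψ) :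
    M.dv (M.dv (M.curl₂ (M.detMid ψ))) = (M.L / 3) • M.dv (tp (M.detMid ψ)) := by
  refine tens1_ext fun b => ?_
  rw [M.dv_dv_skew_three _ fun a b c => by simp only [curl₂_apply]; ring]
  simp only [curl₂_apply, con_sub, M.con_cov_detMid hψ, Pi.smul_apply, dv_tp, sub_zero]

/-- The Bianchi identity of the detour operator: the divergence and the trace of `det ψ` depend on
`ψ` only through the middle slot `m`, so that the adjoint reduces to a multiple of `∇.∇.m`, whose
coefficient is zero. -/
theorem adj_det {ψ : Tens A 3} (hψ : Sym ψ) : M.adj (M.det ψ) = 0 := by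
  have h1 : M.dv (M.det ψ) = (M.L / 3) • (M.detMid ψ + tp (M.detMid ψ)) + (1 / 3 : ℝ) •
      (M.dv (M.curl₂ (M.detMid ψ)) + tp (M.dv (M.curl₂ (M.detMid ψ)))) :=
    tens2_ext fun a b => M.dv_det hψ a b
  have h2 : M.tr (M.det ψ) = (1 / 3 : ℝ) • M.dv (tp (M.detMid ψ)) - M.dv (M.detMid ψ) :=
    tens1_ext fun c => by
      rw [M.tr_det hψ, Pi.sub_apply, Pi.smul_apply, dv_tp]; ring
  rw [adj, h1, h2]
  simp only [dv_add, dv_smul, dv_sub, dv_dv_tp, M.dv_dv_curl₂_detMid hψ]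
  module

/-! ### The partially massless theory -/

/-- The trace-adjusted field `φ + ½ g ⊙ φ̄`. -/
def traceAdj (φ : Tens A 3) : Tens A 3 := φ + (1 / 2 : ℝ) • M.gSym (M.tr φ)

/-- The inverse of the trace adjustment, `ψ - ¼ g ⊙ ψ̄`. -/
def traceAdjInv (ψ : Tens A 3) : Tens A 3 := ψ - (1 / 4 : ℝ) • M.gSym (M.tr ψ)

/-- The trace-free symmetric part of a tensor of rank two. -/
def tfSym (T : Tens A 2) : Tens A 2 := fun I =>
  (1 / 2 : ℝ) • (T ![I 0, I 1] + T ![I 1, I 0]) - (1 / 4 : ℝ) • (M.g (I 0) (I 1) * M.tr T ![])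

/-- The equation of motion of the field `φ`. -/
def pmEq (φ : Tens A 3) (χ : Tens A 0) : Tens A 3 :=
  M.lp φ - (5 * M.L / 3) • φ - (3 : ℝ) • symm3 (M.cov (M.dv φ)) +
    (3 : ℝ) • symm3 (M.cov (M.cov (M.tr φ))) - (3 : ℝ) • M.gSym (M.lp (M.tr φ)) +
    (3 : ℝ) • M.gSym (M.dv (M.dv φ)) - (3 / 2 : ℝ) • M.gSym (M.cov (M.dv (M.tr φ))) +
    (3 : ℝ) • M.gSym (M.cov χ)

/-- The equation of motion of the auxiliary scalar. -/
def pmAux (φ : Tens A 3) (χ : Tens A 0) : Tens A 0 := M.lp χ + (M.L / 3) • M.dv (M.tr φ)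

/-- The divergence constraint. -/
def pmDiv (φ : Tens A 3) (χ : Tens A 0) : Tens A 2 :=
  M.tfSym (M.cov (M.cov χ)) - M.L • M.tfSym (M.dv φ) + (2 * M.L) • M.tfSym (M.cov (M.tr φ))

/-- The scalar constraint. -/
def pmScal (φ : Tens A 3) (χ : Tens A 0) : Tens A 1 := M.cov χ + (M.L / 3) • M.tr φ

/-- The gauge transformation of `φ`. -/
def pmGF (ς : Tens A 0) : Tens A 3 :=
  symm3 (M.cov (M.tfSym (M.cov (M.cov ς)))) + (M.L / 2) • M.gSym (M.cov ς)

/-- The gauge transformation of `χ`. -/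
def pmGS (ς : Tens A 0) : Tens A 0 := -((M.L / 6) • (M.lp ς + (10 * M.L / 3) • ς))

theorem tfSym_apply (T : Tens A 2) (a b : Fin 4) : M.tfSym T ![a, b] =
    (1 / 2 : ℝ) • (T ![a, b] + T ![b, a]) - (1 / 4 : ℝ) • (M.g a b * M.tr T ![]) := rfl

/-! ### Linearity of the partially massless operators -/

theorem gSym_add (X Y : Tens A 1) : M.gSym (X + Y) = M.gSym X + M.gSym Y := by
  refine tens3_ext fun a b c => ?_
  simp only [gSym_apply, Pi.add_apply]; algebra

theorem gSym_smul (r : ℝ) (X : Tens A 1) : M.gSym (r • X) = r • M.gSym X := by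
  refine tens3_ext fun a b c => ?_
  simp only [gSym_apply, Pi.smul_apply]; algebra

theorem symm3_add (S T : Tens A 3) : symm3 (S + T) = symm3 S + symm3 T := by
  refine tens3_ext fun a b c => ?_
  simp only [symm3_apply, Pi.add_apply]; algebra

theorem symm3_cov_add (S T : Tens A 2) :
    symm3 (M.cov (S + T)) = symm3 (M.cov S) + symm3 (M.cov T) := by
  rw [map_add]; exact symm3_add _ _

theorem symm3_cov_smul (r : ℝ) (T : Tens A 2) :
    symm3 (M.cov (r • T)) = r • symm3 (M.cov T) := by
  refine tens3_ext fun a b c => ?_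
  simp only [map_smul, symm3_apply, Pi.smul_apply]; algebra

theorem symm3_cov_sub (S T : Tens A 2) :
    symm3 (M.cov (S - T)) = symm3 (M.cov S) - symm3 (M.cov T) := by
  refine tens3_ext fun a b c => ?_
  simp only [map_sub, symm3_apply, Pi.sub_apply]; algebra

theorem gSym_sub (X Y : Tens A 1) : M.gSym (X - Y) = M.gSym X - M.gSym Y := by
  refine tens3_ext fun a b c => ?_
  simp only [gSym_apply, Pi.sub_apply]; algebra

theorem gSym_cov_add (S T : Tens A 0) :
    M.gSym (M.cov (S + T)) = M.gSym (M.cov S) + M.gSym (M.cov T) := by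
  rw [map_add]; exact M.gSym_add _ _

theorem gSym_cov_smul (r : ℝ) (T : Tens A 0) :
    M.gSym (M.cov (r • T)) = r • M.gSym (M.cov T) := by
  rw [map_smul]; exact M.gSym_smul _ _

theorem tfSym_add (S T : Tens A 2) : M.tfSym (S + T) = M.tfSym S + M.tfSym T := by
  refine tens2_ext fun a b => ?_
  simp only [tfSym_apply, Pi.add_apply, tr_add]; algebra

theorem pmEq_add (φ φ' : Tens A 3) (χ χ' : Tens A 0) :
    M.pmEq (φ + φ') (χ + χ') = M.pmEq φ χ + M.pmEq φ' χ' := by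
  have h : symm3 (M.cov (M.cov (M.tr φ + M.tr φ'))) =
      symm3 (M.cov (M.cov (M.tr φ))) + symm3 (M.cov (M.cov (M.tr φ'))) := by
    rw [map_add]; exact M.symm3_cov_add _ _
  simp only [pmEq, lp_add, dv_add, tr_add, h, symm3_cov_add, gSym_cov_add, gSym_add]
  module

theorem pmAux_add (φ φ' : Tens A 3) (χ χ' : Tens A 0) :
    M.pmAux (φ + φ') (χ + χ') = M.pmAux φ χ + M.pmAux φ' χ' := by
  simp only [pmAux, lp_add, dv_add, tr_add]
  module

theorem pmDiv_add (φ φ' : Tens A 3) (χ χ' : Tens A 0) :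
    M.pmDiv (φ + φ') (χ + χ') = M.pmDiv φ χ + M.pmDiv φ' χ' := by
  simp only [pmDiv, dv_add, tr_add, map_add]
  rw [tfSym_add, tfSym_add, tfSym_add]
  module

theorem pmScal_add (φ φ' : Tens A 3) (χ χ' : Tens A 0) :
    M.pmScal (φ + φ') (χ + χ') = M.pmScal φ χ + M.pmScal φ' χ' := by
  simp only [pmScal, tr_add, map_add]
  module

/-! ### The trace adjustment -/

theorem tr_gSym' (X : Tens A 1) : M.tr (M.gSym X) = (2 : ℝ) • X :=
  tens1_ext fun c => M.tr_gSym X c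

theorem tr_traceAdj (φ : Tens A 3) : M.tr (M.traceAdj φ) = (2 : ℝ) • M.tr φ := by
  rw [traceAdj, tr_add, tr_smul, tr_gSym']; module

theorem tr_traceAdjInv (ψ : Tens A 3) : M.tr (M.traceAdjInv ψ) = (1 / 2 : ℝ) • M.tr ψ := by
  rw [traceAdjInv, tr_sub, tr_smul, tr_gSym']; module

theorem traceAdj_traceAdjInv (ψ : Tens A 3) : M.traceAdj (M.traceAdjInv ψ) = ψ := by
  rw [traceAdj, tr_traceAdjInv, traceAdjInv, gSym_smul]; module

theorem traceAdjInv_traceAdj (φ : Tens A 3) : M.traceAdjInv (M.traceAdj φ) = φ := by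
  rw [traceAdjInv, tr_traceAdj, traceAdj, gSym_smul]; module

theorem sym_gSym (X : Tens A 1) : Sym (M.gSym X) := by
  constructor <;> intro a b c <;>
  · simp only [gSym_apply, M.g_symm b a, M.g_symm c b]; algebra

theorem sym_traceAdj {φ : Tens A 3} (hφ : Sym φ) : Sym (M.traceAdj φ) := by
  constructor <;> intro a b c <;> simp only [traceAdj, Pi.add_apply, Pi.smul_apply]
  · rw [hφ.1, (M.sym_gSym _).1]
  · rw [hφ.2, (M.sym_gSym _).2]

/-! ### The equations of motion in terms of the trace-adjusted field -/

/-- The obstruction `∇.ψ_{ab} - ∇_{(a} ψ̄_{b)}` to the divergence constraint: the symmetric part of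
the middle slot of the detour operator. -/
def divObs (ψ : Tens A 3) : Tens A 2 :=
  M.dv ψ - (1 / 2 : ℝ) • (M.cov (M.tr ψ) + tp (M.cov (M.tr ψ)))

/-- The exterior derivative of a one-form. -/
def ext₁ (X : Tens A 1) : Tens A 2 := M.cov X - tp (M.cov X)

theorem divObs_apply (ψ : Tens A 3) (a b : Fin 4) : M.divObs ψ ![a, b] = M.dv ψ ![a, b] -
    (1 / 2 : ℝ) • (M.cov (M.tr ψ) ![a, b] + M.cov (M.tr ψ) ![b, a]) := rfl

theorem detMid_eq (ψ : Tens A 3) :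
    M.detMid ψ = M.divObs ψ - (1 / 2 : ℝ) • M.ext₁ (M.tr ψ) := by
  rw [detMid, divObs, ext₁]; module

theorem dv_ext₁ (X : Tens A 1) :
    M.dv (M.ext₁ X) = M.lp X - M.cov (M.dv X) - M.L • X := by
  refine tens1_ext fun c => ?_
  rw [ext₁, dv_sub, Pi.sub_apply, dv_tp, con_cov_cov_one]
  simp only [Pi.sub_apply, Pi.smul_apply]
  rw [lp_one, dv_two]; ring

theorem dv_dv_ext₁ (X : Tens A 1) : M.dv (M.dv (M.ext₁ X)) = 0 := by
  rw [ext₁, dv_sub, dv_sub, dv_dv_tp, sub_self]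

/-- The divergence of the symmetrised derivative of a one-form. -/
theorem dv_symm_cov (X : Tens A 1) : M.dv (M.cov X + tp (M.cov X)) =
    M.lp X + M.cov (M.dv X) + M.L • X := by
  refine tens1_ext fun c => ?_
  rw [dv_add, Pi.add_apply, dv_tp, con_cov_cov_one]
  simp only [Pi.add_apply, Pi.smul_apply]
  rw [lp_one, dv_two]; ring

theorem dv_divObs (ψ : Tens A 3) : M.dv (M.divObs ψ) = M.dv (M.dv ψ) -
    (1 / 2 : ℝ) • (M.lp (M.tr ψ) + M.cov (M.dv (M.tr ψ)) + M.L • M.tr ψ) := by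
  rw [divObs, dv_sub, dv_smul, dv_symm_cov]

theorem divObs_symm {ψ : Tens A 3} (hψ : Sym ψ) (a b : Fin 4) :
    M.divObs ψ ![a, b] = M.divObs ψ ![b, a] := by
  rw [divObs_apply, divObs_apply, M.dv_symm hψ a b]; algebra

theorem tr_divObs {ψ : Tens A 3} (hψ : Sym ψ) : M.tr (M.divObs ψ) = 0 := by
  refine tens0_ext ?_
  have h := M.tr_dv hψ
  have h2 : M.tr (tp (M.cov (M.tr ψ))) ![] = M.tr (M.cov (M.tr ψ)) ![] := by
    rw [tr_two, tr_two, ← con_swap]; rfl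
  rw [divObs, tr_sub, tr_smul, tr_add]
  simp only [Pi.sub_apply, Pi.smul_apply, Pi.add_apply, h, h2, Pi.zero_apply]
  rw [dv]; algebra

theorem symm3_cov_tp (T : Tens A 2) : symm3 (M.cov (tp T)) = symm3 (M.cov T) := by
  refine tens3_ext fun a b c => ?_
  simp only [symm3_apply, cov_tp]; algebra

theorem cov_gOut_zero (Y : Tens A 0) (a b c : Fin 4) :
    M.cov (M.gOut Y) ![a, b, c] = M.g b c * M.cov Y ![a] := M.cov_gOut Y a b c ![]

theorem symm3_cov_gOut (Y : Tens A 0) : symm3 (M.cov (M.gOut Y)) = M.gSym (M.cov Y) := by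
  refine tens3_ext fun a b c => ?_
  simp only [symm3_apply, gSym_apply, cov_gOut_zero, M.g_symm b a, M.g_symm c b, M.g_symm c a]
  algebra

theorem dv_gOut (Y : Tens A 0) : M.dv (M.gOut Y) = M.cov Y := by
  refine tens1_ext fun c => ?_
  rw [dv_two]
  simp only [cov_gOut_zero]
  exact M.con_right c fun a => M.cov Y ![a]

theorem dv_traceAdjInv (ψ : Tens A 3) : M.dv (M.traceAdjInv ψ) = M.dv ψ -
    (1 / 12 : ℝ) • ((M.cov (M.tr ψ) + tp (M.cov (M.tr ψ))) + M.gOut (M.dv (M.tr ψ))) := by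
  refine tens2_ext fun b c => ?_
  have e : M.gOut (M.dv (M.tr ψ)) ![b, c] = M.g b c * M.dv (M.tr ψ) ![] := M.gOut_cons _ b c ![]
  rw [traceAdjInv, dv_sub, dv_smul]
  simp only [Pi.sub_apply, Pi.smul_apply, Pi.add_apply, dv_gSym, tp_apply, e]
  algebra

/-- The obstruction, the exterior derivative of the trace and the scalar constraint express the
difference between the equation of motion of `φ` and the detour operator on the trace-adjusted
field. -/
theorem pmEq_traceAdjInv {ψ : Tens A 3} (hψ : Sym ψ) (χ : Tens A 0) :
    M.pmEq (M.traceAdjInv ψ) χ = M.det ψ - (2 : ℝ) • symm3 (M.cov (M.divObs ψ)) +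
      (3 : ℝ) • M.gSym (M.dv (M.divObs ψ)) - (1 / 2 : ℝ) • M.gSym (M.dv (M.ext₁ (M.tr ψ))) +
      (3 : ℝ) • M.gSym (M.pmScal (M.traceAdjInv ψ) χ) := by
  obtain ⟨Y, hY⟩ : ∃ Y : Tens A 1, M.cov (M.dv (M.tr ψ)) = Y := ⟨_, rfl⟩
  obtain ⟨Z, hZ⟩ : ∃ Z : Tens A 1, M.cov χ = Z := ⟨_, rfl⟩
  have hlp : M.lp (M.traceAdjInv ψ) = M.lp ψ - (1 / 4 : ℝ) • M.gSym (M.lp (M.tr ψ)) := by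
    rw [traceAdjInv, lp_sub, lp_smul, lp_gSym]
  have hdd : M.dv (M.dv (M.traceAdjInv ψ)) = M.dv (M.dv ψ) - (1 / 12 : ℝ) •
      (M.lp (M.tr ψ) + Y + M.L • M.tr ψ + Y) := by
    rw [← hY, dv_traceAdjInv, dv_sub, dv_smul, dv_add, dv_symm_cov, dv_gOut]
  have hs : symm3 (M.cov (M.dv (M.traceAdjInv ψ))) = symm3 (M.cov (M.dv ψ)) - (1 / 12 : ℝ) •
      ((2 : ℝ) • symm3 (M.cov (M.cov (M.tr ψ))) + M.gSym Y) := by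
    rw [← hY, dv_traceAdjInv, symm3_cov_sub, symm3_cov_smul, symm3_cov_add, symm3_cov_add,
      symm3_cov_tp, symm3_cov_gOut]
    module
  have hB : symm3 (M.cov (M.divObs ψ)) =
      symm3 (M.cov (M.dv ψ)) - symm3 (M.cov (M.cov (M.tr ψ))) := by
    rw [divObs, symm3_cov_sub, symm3_cov_smul, symm3_cov_add, symm3_cov_tp]
    module
  have hp : symm3 (M.cov (M.cov ((1 / 2 : ℝ) • M.tr ψ))) =
      (1 / 2 : ℝ) • symm3 (M.cov (M.cov (M.tr ψ))) := by
    rw [map_smul]; exact M.symm3_cov_smul _ _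
  have hB2 : M.dv (M.divObs ψ) = M.dv (M.dv ψ) -
      (1 / 2 : ℝ) • (M.lp (M.tr ψ) + Y + M.L • M.tr ψ) := by
    rw [dv_divObs, ← hY]
  have hF : M.dv (M.ext₁ (M.tr ψ)) = M.lp (M.tr ψ) - Y - M.L • M.tr ψ := by
    rw [dv_ext₁, ← hY]
  have hW : M.pmScal (M.traceAdjInv ψ) χ = Z + (M.L / 3) • ((1 / 2 : ℝ) • M.tr ψ) := by
    rw [pmScal, tr_traceAdjInv, ← hZ]
  rw [pmEq, M.det_eq hψ, hdd, hlp, hs, hB, hB2, hF, hW, tr_traceAdjInv, hp, traceAdjInv, lp_smul,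
    dv_smul, gSym_cov_smul, hY, hZ]
  simp only [gSym_sub, gSym_smul, gSym_add]
  module

/-! ### The constraints as integrability conditions -/

theorem tr_zero {k : ℕ} : M.tr (0 : Tens A (k + 2)) = 0 := by
  simpa using M.tr_smul 0 (0 : Tens A (k + 2))

theorem dv_zero {k : ℕ} : M.dv (0 : Tens A (k + 1)) = 0 := by
  simpa using M.dv_smul 0 (0 : Tens A (k + 1))

theorem gOut_zero : M.gOut (0 : Tens A 0) = 0 := by
  funext I; simp only [gOut, Pi.zero_apply, mul_zero]

theorem ext₁_zero : M.ext₁ 0 = 0 := by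
  rw [ext₁, map_zero]; exact sub_self _

theorem tp_sub {A : Type*} [CommRing A] (S T : Tens A 2) : tp (S - T) = tp S - tp T := rfl

theorem tp_smul (r : ℝ) (T : Tens A 2) : tp (r • T) = r • tp T := rfl

theorem tp_tp {A : Type*} (T : Tens A 2) : tp (tp T) = T := tens2_ext fun _ _ => rfl

theorem tr_tp (T : Tens A 2) : M.tr (tp T) = M.tr T :=
  tens0_ext (M.con_swap fun a b => T ![a, b])

theorem lp_tp (T : Tens A 2) : M.lp (tp T) = tp (M.lp T) := by
  refine tens2_ext fun a b => ?_
  have h : M.cov (tp T) = fun I => M.cov T ![I 0, I 2, I 1] :=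
    tens3_ext fun c a b => M.cov_tp T c a b
  rw [tp_apply, lp_two, lp_two, h]
  exact congrArg M.con (funext fun d => funext fun e =>
    M.cov_perm_three (M.cov T) 0 2 1 (by decide) d ![e, a, b])

theorem tr_gOut (Y : Tens A 0) : M.tr (M.gOut Y) = (4 : ℝ) • Y := by
  refine tens0_ext ?_
  have h : ∀ a b, M.gOut Y ![a, b] = M.g a b * Y ![] := fun a b => M.gOut_cons Y a b ![]
  rw [tr_two]
  simp only [h, con_g, Pi.smul_apply]
  algebra

theorem dv_gSym_eq (X : Tens A 1) :
    M.dv (M.gSym X) = (1 / 3 : ℝ) • (M.cov X + tp (M.cov X) + M.gOut (M.dv X)) :=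
  tens2_ext fun b c => M.dv_gSym X b c

theorem divObs_eq (ψ : Tens A 3) (hψ : Sym ψ) :
    M.divObs ψ = (1 / 2 : ℝ) • (M.detMid ψ + tp (M.detMid ψ)) := by
  refine tens2_ext fun a b => ?_
  simp only [divObs_apply, Pi.smul_apply, Pi.add_apply, tp_apply, detMid_apply]
  rw [M.dv_symm hψ b a]; algebra

theorem ext₁_tr (ψ : Tens A 3) (hψ : Sym ψ) :
    M.ext₁ (M.tr ψ) = tp (M.detMid ψ) - M.detMid ψ := by
  refine tens2_ext fun a b => ?_
  simp only [ext₁, Pi.sub_apply, tp_apply, detMid_apply]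
  rw [M.dv_symm hψ b a]; algebra

/-- The middle slot splits into the obstruction and the exterior derivative of the trace. -/
theorem detMid_eq_zero_iff {ψ : Tens A 3} (hψ : Sym ψ) :
    M.detMid ψ = 0 ↔ M.divObs ψ = 0 ∧ M.ext₁ (M.tr ψ) = 0 := by
  constructor
  · intro h
    have h2 : tp (0 : Tens A 2) = 0 := rfl
    rw [M.divObs_eq ψ hψ, M.ext₁_tr ψ hψ, h, h2]; simp
  · rintro ⟨h1, h2⟩
    rw [detMid_eq, h1, h2]; simp

/-- If the middle slot vanishes then the bottom slot is totally symmetric. -/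
theorem detBot_eq_det {ψ : Tens A 3} (hψ : Sym ψ) (h : M.detMid ψ = 0) :
    M.detBot ψ = M.det ψ := by
  refine tens3_ext fun c a b => ?_
  rw [M.det_apply hψ, curl₂_apply, curl₂_apply, h, map_zero]
  simp

theorem dv_detMid (ψ : Tens A 3) :
    M.dv (M.detMid ψ) = M.dv (M.divObs ψ) - (1 / 2 : ℝ) • M.dv (M.ext₁ (M.tr ψ)) := by
  rw [detMid_eq, dv_sub, dv_smul]

theorem dv_tp_detMid {ψ : Tens A 3} (hψ : Sym ψ) :
    M.dv (tp (M.detMid ψ)) = M.dv (M.divObs ψ) + (1 / 2 : ℝ) • M.dv (M.ext₁ (M.tr ψ)) := by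
  have h : tp (M.detMid ψ) = M.divObs ψ + (1 / 2 : ℝ) • M.ext₁ (M.tr ψ) := by
    rw [M.divObs_eq ψ hψ, M.ext₁_tr ψ hψ]; module
  rw [h, dv_add, dv_smul]

/-- The divergence of `det ψ`, with the middle slot split into the obstruction and the exterior
derivative of the trace. -/
theorem dv_det_eq {ψ : Tens A 3} (hψ : Sym ψ) : M.dv (M.det ψ) =
    (2 / 3 : ℝ) • M.lp (M.divObs ψ) - (2 * M.L / 9) • M.divObs ψ -
      (1 / 3 : ℝ) • (M.cov (M.dv (M.divObs ψ)) + tp (M.cov (M.dv (M.divObs ψ)))) +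
      (1 / 6 : ℝ) • (M.cov (M.dv (M.ext₁ (M.tr ψ))) + tp (M.cov (M.dv (M.ext₁ (M.tr ψ))))) := by
  obtain ⟨X, hX⟩ : ∃ X : Tens A 2, M.cov (M.dv (M.divObs ψ)) = X := ⟨_, rfl⟩
  obtain ⟨Y, hY⟩ : ∃ Y : Tens A 2, M.cov (M.dv (M.ext₁ (M.tr ψ))) = Y := ⟨_, rfl⟩
  have h1 : M.dv (M.det ψ) = (M.L / 3) • (M.detMid ψ + tp (M.detMid ψ)) + (1 / 3 : ℝ) •
      (M.dv (M.curl₂ (M.detMid ψ)) + tp (M.dv (M.curl₂ (M.detMid ψ)))) :=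
    tens2_ext fun a b => M.dv_det hψ a b
  have h2 : M.dv (M.curl₂ (M.detMid ψ)) = M.lp (M.detMid ψ) - (X - (1 / 2 : ℝ) • Y) -
      M.L • M.detMid ψ - (M.L / 3) • tp (M.detMid ψ) := by
    have h : M.cov (M.dv (M.detMid ψ)) = X - (1 / 2 : ℝ) • Y := by
      rw [← hX, ← hY, dv_detMid, map_sub, map_smul]
    rw [← h]
    exact tens2_ext fun a b => M.dv_curl₂_detMid hψ a b
  rw [hX, hY, h1, h2, M.divObs_eq ψ hψ, lp_smul, lp_add, lp_tp]
  simp only [tp_sub, tp_smul, tp_tp]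
  module

/-- The divergence of the symmetrised derivative of a trace-free symmetric tensor. -/
theorem dv_symm3_cov {B : Tens A 2} (hB : ∀ a b, B ![a, b] = B ![b, a]) (hB₀ : M.tr B = 0) :
    M.dv (symm3 (M.cov B)) = (1 / 3 : ℝ) • (M.lp B + (M.cov (M.dv B) + tp (M.cov (M.dv B)))) +
      (8 * M.L / 9) • B := by
  refine tens2_ext fun a b => ?_
  have hc : ∀ d c a b, M.cov (M.cov B) ![d, c, a, b] = M.cov (M.cov B) ![d, c, b, a] :=
    M.cov_symm_snd (M.cov_symm_two hB)
  have h1 := M.con_cov_cov_two B a b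
  have h2 := M.con_cov_cov_two B b a
  have h3 : ∀ d e, M.cov (M.cov B) ![d, a, b, e] = M.cov (M.cov B) ![d, a, e, b] := fun d e =>
    hc d a b e
  have h4 : ∀ d e, M.cov (M.cov B) ![d, b, a, e] = M.cov (M.cov B) ![d, b, e, a] := fun d e =>
    hc d b a e
  have h5 : ∀ d e, M.cov (M.cov B) ![d, e, b, a] = M.cov (M.cov B) ![d, e, a, b] := fun d e =>
    hc d e b a
  rw [dv_three]
  simp only [cov_symm3, con_smul, con_add, h3, h4, h5, h1, h2, hB₀, Pi.add_apply, Pi.smul_apply,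
    tp_apply, hB b a, lp_two, Pi.zero_apply, mul_zero]
  algebra

theorem tr_symm3_cov {B : Tens A 2} (hB : ∀ a b, B ![a, b] = B ![b, a]) (hB₀ : M.tr B = 0) :
    M.tr (symm3 (M.cov B)) = (2 / 3 : ℝ) • M.dv B := by
  refine tens1_ext fun c => ?_
  have h0 : M.con (fun a b => M.cov B ![c, a, b]) = 0 := by
    rw [← cov_tr_two, hB₀, map_zero]; rfl
  have h1 : ∀ a b, M.cov B ![a, c, b] = M.cov B ![a, b, c] := fun a b => M.cov_symm_two hB a c b
  have h2 : ∀ a b, M.cov B ![c, b, a] = M.cov B ![c, a, b] := fun a b => M.cov_symm_two hB c b a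
  have h3 := M.con_swap fun a b => M.cov B ![a, b, c]
  rw [tr_three]
  simp only [symm3_apply, con_smul, con_add, h1, h2, h3, h0, Pi.smul_apply, dv_two]
  algebra

section

variable {ψ : Tens A 3} (hψ : Sym ψ) (χ : Tens A 0)
include hψ

/-- In the divergence of the equation of motion all terms of third order cancel, except for the
multiple `∇.∇.B` of the metric, `B` being the obstruction. -/
theorem dv_pmEq : M.dv (M.pmEq (M.traceAdjInv ψ) χ) = -((2 * M.L) • M.divObs ψ) +
    (M.cov (M.pmScal (M.traceAdjInv ψ) χ) + tp (M.cov (M.pmScal (M.traceAdjInv ψ) χ))) +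
    M.gOut (M.dv (M.pmScal (M.traceAdjInv ψ) χ) + M.dv (M.dv (M.divObs ψ))) := by
  have h : ∀ Y Z : Tens A 0, M.gOut (Y + Z) = M.gOut Y + M.gOut Z := fun Y Z => by
    funext I; simp only [gOut, Pi.add_apply, mul_add]
  rw [M.pmEq_traceAdjInv hψ]
  simp only [dv_add, dv_sub, dv_smul, dv_gSym_eq, M.dv_det_eq hψ,
    M.dv_symm3_cov (M.divObs_symm hψ) (M.tr_divObs hψ), dv_dv_ext₁, h, gOut_zero]
  module

theorem tr_pmEq : M.tr (M.pmEq (M.traceAdjInv ψ) χ) = (4 : ℝ) • M.dv (M.divObs ψ) -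
    (1 / 3 : ℝ) • M.dv (M.ext₁ (M.tr ψ)) + (6 : ℝ) • M.pmScal (M.traceAdjInv ψ) χ := by
  have h : M.tr (M.det ψ) = (1 / 3 : ℝ) • M.dv (tp (M.detMid ψ)) - M.dv (M.detMid ψ) :=
    tens1_ext fun c => by
      rw [M.tr_det hψ, Pi.sub_apply, Pi.smul_apply, dv_tp]; ring
  rw [M.pmEq_traceAdjInv hψ]
  simp only [tr_add, tr_sub, tr_smul, tr_gSym',
    M.tr_symm3_cov (M.divObs_symm hψ) (M.tr_divObs hψ), h, M.dv_tp_detMid hψ, dv_detMid]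
  module

omit hψ in
theorem dv_pmScal (φ : Tens A 3) : M.dv (M.pmScal φ χ) = M.pmAux φ χ := by
  rw [pmScal, dv_add, dv_smul]; rfl

omit hψ in
theorem ext₁_pmScal :
    M.ext₁ (M.pmScal (M.traceAdjInv ψ) χ) = (M.L / 6) • M.ext₁ (M.tr ψ) := by
  refine tens2_ext fun a b => ?_
  rw [pmScal, tr_traceAdjInv]
  simp only [ext₁, map_add, map_smul, Pi.sub_apply, Pi.add_apply, Pi.smul_apply, tp_apply]
  rw [M.hess_symm χ a b]; algebra

/-- The equations of motion imply both constraints. With `B` the obstruction and `W` the scalar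
constraint, the equation of motion of the auxiliary scalar is `∇.W = 0`, the divergence of the
equation of motion of `φ` expresses `B` by the symmetrised derivative of `W`, and the trace of the
latter equation then becomes `10 L W = 0`. -/
theorem constraints_of_pmSystem (hL : M.L ≠ 0) (hE : M.pmEq (M.traceAdjInv ψ) χ = 0)
    (hX : M.pmAux (M.traceAdjInv ψ) χ = 0) :
    M.pmScal (M.traceAdjInv ψ) χ = 0 ∧ M.divObs ψ = 0 := by
  set W := M.pmScal (M.traceAdjInv ψ) χ with hW
  have hdW : M.dv W = 0 := by rw [hW, dv_pmScal, hX]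
  have e1 := M.dv_pmEq hψ χ
  rw [hE, ← hW, hdW, zero_add (M.dv (M.dv (M.divObs ψ))), dv_zero] at e1
  -- `B` is trace-free and `∇.W = 0`, so the trace of `e1` leaves only the multiple of the metric
  have e2 : M.dv (M.dv (M.divObs ψ)) = 0 := by
    have h := congrArg M.tr e1
    have hn : -((2 * M.L) • M.divObs ψ) = (-(2 * M.L)) • M.divObs ψ := by module
    have hc : M.tr (M.cov W) = 0 := hdW
    rw [hn, tr_add, tr_add, tr_add, tr_tp, tr_gOut, tr_smul, M.tr_divObs hψ, hc, tr_zero] at h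
    have h4 : (4 : ℝ) • M.dv (M.dv (M.divObs ψ)) = 0 := by rw [h]; simp
    exact (smul_eq_zero_iff_right (by norm_num)).mp h4
  rw [e2, gOut_zero, add_zero] at e1
  have e3 : (2 * M.L) • M.divObs ψ = M.cov W + tp (M.cov W) := by
    rw [← sub_eq_zero, ← neg_eq_zero, e1]; abel
  have e4 : (2 * M.L) • M.dv (M.divObs ψ) = M.lp W + M.L • W := by
    rw [← dv_smul, e3, dv_symm_cov, hdW, map_zero, add_zero]
  -- the gradient part of `W` is closed, so the exterior derivative of `W` is that of the trace
  have e5 : (M.L / 6) • M.dv (M.ext₁ (M.tr ψ)) = M.lp W - M.L • W := by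
    rw [← dv_smul, ← M.ext₁_pmScal χ, ← hW, dv_ext₁, hdW, map_zero, sub_zero]
  have e6 := M.tr_pmEq hψ χ
  rw [hE, tr_zero, ← hW] at e6
  -- the second derivatives of `W` cancel
  have e7 : (10 * M.L) • W = 0 := by
    linear_combination (norm := module) (-M.L) • e6 - (2 : ℝ) • e4 + (2 : ℝ) • e5
  have hW0 : W = 0 := (smul_eq_zero_iff_right (by positivity)).mp e7
  refine ⟨hW0, ?_⟩
  have e8 : (2 * M.L) • M.divObs ψ = 0 := by
    rw [e3, hW0, map_zero]
    have h2 : tp (0 : Tens A 2) = 0 := rfl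
    exact (congrArg (0 + ·) h2).trans (add_zero _)
  exact (smul_eq_zero_iff_right (by positivity)).mp e8

/-- The divergence constraint in terms of the obstruction and the scalar constraint. -/
theorem pmDiv_traceAdjInv : M.pmDiv (M.traceAdjInv ψ) χ =
    M.tfSym (M.cov (M.pmScal (M.traceAdjInv ψ) χ)) - M.L • M.divObs ψ := by
  have hB : M.divObs ψ = M.tfSym (M.divObs ψ) := by
    refine tens2_ext fun a b => ?_
    rw [tfSym_apply, M.tr_divObs hψ, ← M.divObs_symm hψ a b, Pi.zero_apply]
    algebra
  rw [hB]
  refine tens2_ext fun a b => ?_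
  have e : M.gOut (M.dv (M.tr ψ)) ![a, b] = M.g a b * M.dv (M.tr ψ) ![] := M.gOut_cons _ a b ![]
  have e' : M.gOut (M.dv (M.tr ψ)) ![b, a] = M.g b a * M.dv (M.tr ψ) ![] := M.gOut_cons _ b a ![]
  rw [pmDiv, pmScal, tr_traceAdjInv, dv_traceAdjInv, divObs]
  simp only [Pi.sub_apply, Pi.smul_apply, Pi.add_apply, tfSym_apply, tr_sub, tr_smul, tr_add,
    tr_tp, tr_gOut, map_add, map_smul, tp_apply, e, e', M.g_symm b a]
  have h : M.tr (M.cov (M.tr ψ)) = M.dv (M.tr ψ) := rfl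
  rw [h]
  algebra

theorem pmDiv_eq_zero_iff (hL : M.L ≠ 0) (hW : M.pmScal (M.traceAdjInv ψ) χ = 0) :
    M.pmDiv (M.traceAdjInv ψ) χ = 0 ↔ M.divObs ψ = 0 := by
  have h : M.tfSym (M.cov (0 : Tens A 1)) = 0 := by
    refine tens2_ext fun a b => ?_
    rw [map_zero, tfSym_apply]
    simp [tr_two, con_zero]
  rw [M.pmDiv_traceAdjInv hψ, hW, h, zero_sub, neg_eq_zero, smul_eq_zero_iff_right hL]

omit hψ in
theorem ext₁_tr_eq_zero (hL : M.L ≠ 0) (hW : M.pmScal (M.traceAdjInv ψ) χ = 0) :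
    M.ext₁ (M.tr ψ) = 0 := by
  have h := M.ext₁_pmScal (ψ := ψ) χ
  rw [hW, ext₁_zero] at h
  exact (smul_eq_zero_iff_right (by positivity)).mp h.symm

/-- Modulo the constraints, the equation of motion is the detour operator. -/
theorem pmEq_eq_det (hL : M.L ≠ 0) (hW : M.pmScal (M.traceAdjInv ψ) χ = 0)
    (hB : M.divObs ψ = 0) : M.pmEq (M.traceAdjInv ψ) χ = M.det ψ := by
  have hF := M.ext₁_tr_eq_zero χ hL hW
  have h1 : symm3 (M.cov (0 : Tens A 2)) = 0 := by
    simpa using M.symm3_cov_smul (0 : ℝ) 0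
  have h3 : M.gSym (0 : Tens A 1) = 0 := by simpa using M.gSym_smul (0 : ℝ) 0
  rw [M.pmEq_traceAdjInv hψ, hW, hB, hF, h1, dv_zero, h3]
  simp

/-- The partially massless system is equivalent to the vanishing of the full detour operator
together with the scalar constraint. -/
theorem pmSystem_iff (hL : M.L ≠ 0) :
    (M.pmEq (M.traceAdjInv ψ) χ = 0 ∧ M.pmAux (M.traceAdjInv ψ) χ = 0) ↔
      (M.detMid ψ = 0 ∧ M.detBot ψ = 0) ∧ M.pmScal (M.traceAdjInv ψ) χ = 0 := by
  constructor
  · rintro ⟨hE, hX⟩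
    obtain ⟨hW, hB⟩ := M.constraints_of_pmSystem hψ χ hL hE hX
    have hF := M.ext₁_tr_eq_zero χ hL hW
    have hm := (M.detMid_eq_zero_iff hψ).mpr ⟨hB, hF⟩
    exact ⟨⟨hm, by rw [M.detBot_eq_det hψ hm, ← M.pmEq_eq_det hψ χ hL hW hB, hE]⟩, hW⟩
  · rintro ⟨⟨hm, hb⟩, hW⟩
    have hB := ((M.detMid_eq_zero_iff hψ).mp hm).1
    refine ⟨by rw [M.pmEq_eq_det hψ χ hL hW hB, ← M.detBot_eq_det hψ hm, hb], ?_⟩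
    rw [← dv_pmScal, hW]
    exact M.dv_zero

end

/-! ### Gauge invariance -/

/-- Pure gauge fields have no field strength. -/
theorem curl_gaugeOp (σ : Tens A 0) : M.curl (M.gaugeOp σ) = 0 := by
  refine tens4_ext fun d c a b => ?_
  rw [curl_apply, M.cov_gaugeOp_comm σ d c a b, sub_self]; rfl

theorem detMid_gaugeOp (σ : Tens A 0) : M.detMid (M.gaugeOp σ) = 0 := by
  refine tens2_ext fun a b => ?_
  rw [← M.con_curl (M.sym_gaugeOp σ), curl_gaugeOp]
  exact M.con_zero

theorem detBot_gaugeOp (σ : Tens A 0) : M.detBot (M.gaugeOp σ) = 0 := by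
  rw [← M.dv_curl (M.sym_gaugeOp σ), curl_gaugeOp]
  exact M.dv_zero

theorem pmGF_eq (ς : Tens A 0) : M.pmGF ς = symm3 (M.cov (M.cov (M.cov ς))) -
    (1 / 4 : ℝ) • M.gSym (M.cov (M.lp ς)) + (M.L / 2) • M.gSym (M.cov ς) := by
  have h : M.tfSym (M.cov (M.cov ς)) = M.cov (M.cov ς) - (1 / 4 : ℝ) • M.gOut (M.lp ς) := by
    refine tens2_ext fun a b => ?_
    have e : M.gOut (M.lp ς) ![a, b] = M.g a b * M.lp ς ![] := M.gOut_cons _ a b ![]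
    rw [tfSym_apply, ← M.hess_symm ς a b, tr_hess]
    simp only [Pi.sub_apply, Pi.smul_apply, e]
    algebra
  rw [pmGF, h]
  have h2 := M.symm3_cov_sub (M.cov (M.cov ς)) ((1 / 4 : ℝ) • M.gOut (M.lp ς))
  rw [M.symm3_cov_smul, M.symm3_cov_gOut] at h2
  rw [h2]

theorem tr_pmGF (ς : Tens A 0) :
    M.tr (M.pmGF ς) = (1 / 2 : ℝ) • M.cov (M.lp ς) + (5 * M.L / 3) • M.cov ς := by
  have h : M.tr (symm3 (M.cov (M.cov (M.cov ς)))) =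
      M.cov (M.lp ς) + (2 * M.L / 3) • M.cov ς := tens1_ext fun c => M.tr_symm3_hess ς c
  rw [pmGF_eq, tr_add, tr_sub, tr_smul, tr_smul, tr_gSym', tr_gSym', h]
  module

theorem traceAdj_pmGF (ς : Tens A 0) : M.traceAdj (M.pmGF ς) = M.gaugeOp ς := by
  have h : M.gSym ((1 / 2 : ℝ) • M.cov (M.lp ς) + (5 * M.L / 3) • M.cov ς) =
      (1 / 2 : ℝ) • M.gSym (M.cov (M.lp ς)) + (5 * M.L / 3) • M.gSym (M.cov ς) := by
    rw [← gSym_smul, ← gSym_smul]; exact M.gSym_add _ _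
  rw [traceAdj, tr_pmGF, h, pmGF_eq, gaugeOp]
  module

theorem pmGF_eq_traceAdjInv (ς : Tens A 0) : M.pmGF ς = M.traceAdjInv (M.gaugeOp ς) := by
  rw [← traceAdj_pmGF, traceAdjInv_traceAdj]

theorem pmScal_gauge (ς : Tens A 0) : M.pmScal (M.pmGF ς) (M.pmGS ς) = 0 := by
  rw [pmScal, tr_pmGF, pmGS, map_neg, map_smul, map_add, map_smul]
  module

/-- Pure gauge fields solve the system: their trace-adjusted field is in the image of the first
operator, which the detour operator annihilates. -/
theorem pmSystem_gauge (hL : M.L ≠ 0) (ς : Tens A 0) :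
    M.pmEq (M.pmGF ς) (M.pmGS ς) = 0 ∧ M.pmAux (M.pmGF ς) (M.pmGS ς) = 0 := by
  have h := M.pmScal_gauge ς
  rw [pmGF_eq_traceAdjInv] at h ⊢
  exact (M.pmSystem_iff (M.sym_gaugeOp ς) _ hL).mpr
    ⟨⟨M.detMid_gaugeOp ς, M.detBot_gaugeOp ς⟩, h⟩

theorem pmDiv_gauge (hL : M.L ≠ 0) (ς : Tens A 0) : M.pmDiv (M.pmGF ς) (M.pmGS ς) = 0 := by
  have h := M.pmScal_gauge ς
  rw [pmGF_eq_traceAdjInv] at h ⊢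
  exact (M.pmDiv_eq_zero_iff (M.sym_gaugeOp ς) _ hL h).mpr
    ((M.detMid_eq_zero_iff (M.sym_gaugeOp ς)).mp (M.detMid_gaugeOp ς)).1

end ConstCurvAlgebra

/-! ### Tractor calculus over an algebra of constant curvature -/

/-- The slots `(τ, v_a, w_ab)` of a tractor-valued tensor, with entries in `A`; the tractor indices
come first. -/
@[ext]
structure TractorArray (A : Type*) (k : ℕ) where
  top : Tens A k
  mid : Tens A (k + 1)
  bot : Tens A (k + 2)

namespace ConstCurvAlgebra

open MetricAlgebra Matrix

variable {A : Type*} [CommRing A] [Algebra ℝ A] (M : ConstCurvAlgebra A)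

/-- The tractor connection, with `Q = (Λ/3) g`. -/
def tcov {k : ℕ} (ξ : TractorArray A k) : TractorArray A (k + 1) where
  top I := M.cov ξ.top I - (2 : ℝ) • ξ.mid I
  mid I :=
    let a := I 0
    let c := I 1
    let J := Fin.tail (Fin.tail I)
    M.cov ξ.mid (vecCons c (vecCons a J)) + (M.L / 3) • (M.g c a * ξ.top J) -
      ξ.bot (vecCons c (vecCons a J))
  bot I :=
    let a := I 0
    let b := I 1
    let c := I 2
    let J := Fin.tail (Fin.tail (Fin.tail I))
    M.cov ξ.bot (vecCons c (vecCons a (vecCons b J))) +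
      (M.L / 3) • (M.g c a * ξ.mid (vecCons b J)) + (M.L / 3) • (M.g c b * ξ.mid (vecCons a J))

/-- The twisted exterior derivative on tractor-valued one-forms. -/
def textD (ξ : TractorArray A 1) : TractorArray A 2 where
  top I := (M.tcov ξ).top ![I 0, I 1] - (M.tcov ξ).top ![I 1, I 0]
  mid I := (M.tcov ξ).mid ![I 0, I 1, I 2] - (M.tcov ξ).mid ![I 0, I 2, I 1]
  bot I := (M.tcov ξ).bot ![I 0, I 1, I 2, I 3] - (M.tcov ξ).bot ![I 0, I 1, I 3, I 2]

/-- The twisted codifferential on tractor-valued two-forms. -/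
def tcodiff (ξ : TractorArray A 2) : TractorArray A 1 where
  top I := -M.con fun d e => (M.tcov ξ).top ![d, e, I 0]
  mid I := -M.con fun d e => (M.tcov ξ).mid ![I 0, d, e, I 1]
  bot I := -M.con fun d e => (M.tcov ξ).bot ![I 0, I 1, d, e, I 2]

/-- The splitting operator on scalars. -/
def tsplit₀ (σ : Tens A 0) : TractorArray A 0 where
  top := σ
  mid := (1 / 2 : ℝ) • M.cov σ
  bot := (1 / 2 : ℝ) • M.cov (M.cov σ) + (M.L / 3) • M.gOut σ

/-- The splitting operator on symmetric tensors; the form index comes last in the bottom slot. -/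
def tsplit₁ (ψ : Tens A 3) : TractorArray A 1 where
  top := 0
  mid := 0
  bot I := ψ ![I 2, I 0, I 1]

/-- The value of the detour operator on the image of the splitting operator; the form index, which
comes first in `detMid` and `detBot`, is moved behind the tractor indices. -/
def detTractor (ψ : Tens A 3) : TractorArray A 1 where
  top := 0
  mid := tp (M.detMid ψ)
  bot I := -M.detBot ψ ![I 2, I 0, I 1]

theorem symm3_rotate (T : Tens A 3) : symm3 (fun I => T ![I 2, I 0, I 1]) = symm3 T := by
  refine tens3_ext fun a b c => ?_
  change (1 / 6 : ℝ) • (T ![c, a, b] + T ![b, a, c] + T ![c, b, a] + T ![a, b, c] + T ![b, c, a] +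
    T ![a, c, b]) = _
  rw [symm3_apply]
  module

theorem symm3_of_sym {T : Tens A 3} (hT : Sym T) : symm3 T = T := by
  refine tens3_ext fun a b c => ?_
  rw [symm3_apply, hT.2 c b a, hT.1 c a b, hT.2 a c b, hT.1 b c a, hT.2 c b a, hT.1 c a b,
    hT.2 a c b, hT.1 b a c]
  module

theorem symm3_tsplit₁_bot {ψ : Tens A 3} (hψ : Sym ψ) : symm3 (tsplit₁ ψ).bot = ψ :=
  (symm3_rotate ψ).trans (symm3_of_sym hψ)

theorem symm3_detTractor_bot (ψ : Tens A 3) : symm3 (M.detTractor ψ).bot = -M.det ψ := by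
  refine (symm3_rotate (-M.detBot ψ)).trans ?_
  refine tens3_ext fun a b c => ?_
  simp only [det, Pi.neg_apply, symm3_apply]
  module

theorem sym_smul {T : Tens A 3} (hT : Sym T) (r : ℝ) : Sym (r • T) :=
  ⟨fun a b c => congrArg (r • ·) (hT.1 a b c), fun a b c => congrArg (r • ·) (hT.2 a b c)⟩

theorem cov_bot_tsplit₁ (ψ : Tens A 3) (d a b c : Fin 4) :
    M.cov (tsplit₁ ψ).bot ![d, a, b, c] = M.cov ψ ![d, c, a, b] :=
  M.cov_perm_three ψ 2 0 1 (by decide) d ![a, b, c]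

/-- The commuting square of the splitting operators; the first operator is `½ gaugeOp`. -/
theorem tcov_tsplit₀ (σ : Tens A 0) :
    M.tcov (M.tsplit₀ σ) = tsplit₁ ((1 / 2 : ℝ) • M.gaugeOp σ) := by
  have h1 : (M.tcov (M.tsplit₀ σ)).top = 0 := by
    refine tens1_ext fun a => ?_
    simp only [tcov, tsplit₀, Pi.smul_apply, Pi.zero_apply]
    algebra
  have h2 : (M.tcov (M.tsplit₀ σ)).mid = 0 := by
    refine tens2_ext fun a c => ?_
    have e1 : M.gOut σ ![c, a] = M.g c a * σ ![] := M.gOut_cons σ c a ![]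
    change M.cov ((1 / 2 : ℝ) • M.cov σ) ![c, a] + (M.L / 3) • (M.g c a * σ ![]) -
      ((1 / 2 : ℝ) • M.cov (M.cov σ) + (M.L / 3) • M.gOut σ) ![c, a] = 0
    rw [map_smul]
    simp only [Pi.smul_apply, Pi.add_apply, e1]
    algebra
  have h3 : (M.tcov (M.tsplit₀ σ)).bot = (tsplit₁ ((1 / 2 : ℝ) • M.gaugeOp σ)).bot := by
    refine tens3_ext fun a b c => ?_
    change M.cov ((1 / 2 : ℝ) • M.cov (M.cov σ) + (M.L / 3) • M.gOut σ) ![c, a, b] +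
      (M.L / 3) • (M.g c a * ((1 / 2 : ℝ) • M.cov σ) ![b]) +
      (M.L / 3) • (M.g c b * ((1 / 2 : ℝ) • M.cov σ) ![a]) =
      ((1 / 2 : ℝ) • M.gaugeOp σ) ![c, a, b]
    rw [map_add, map_smul, map_smul]
    simp only [Pi.smul_apply, Pi.add_apply, cov_gOut_zero, gaugeOp_apply]
    algebra
  exact TractorArray.ext h1 h2 h3

theorem textD_tsplit₁ {ψ : Tens A 3} (hψ : Sym ψ) :
    M.textD (tsplit₁ ψ) = ⟨0, 0, fun I => M.curl ψ ![I 2, I 3, I 0, I 1]⟩ := by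
  have h1 : (M.textD (tsplit₁ ψ)).top = 0 := by
    refine tens2_ext fun d c => ?_
    simp only [textD, tcov, tsplit₁, map_zero, Pi.zero_apply, smul_zero, sub_zero]
  have h2 : (M.textD (tsplit₁ ψ)).mid = 0 := by
    refine tens3_ext fun a d c => ?_
    change (M.cov 0 ![d, a, c] + (M.L / 3) • (M.g d a * 0) - ψ ![c, d, a]) -
      (M.cov 0 ![c, a, d] + (M.L / 3) • (M.g c a * 0) - ψ ![d, c, a]) = 0
    rw [map_zero, hψ.1 c d a]
    simp
  have h3 : (M.textD (tsplit₁ ψ)).bot = fun I => M.curl ψ ![I 2, I 3, I 0, I 1] := by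
    refine tens4_ext fun a b d c => ?_
    change (M.cov (tsplit₁ ψ).bot ![d, a, b, c] + (M.L / 3) • (M.g d a * 0) +
      (M.L / 3) • (M.g d b * 0)) - (M.cov (tsplit₁ ψ).bot ![c, a, b, d] +
      (M.L / 3) • (M.g c a * 0) + (M.L / 3) • (M.g c b * 0)) = M.curl ψ ![d, c, a, b]
    rw [cov_bot_tsplit₁, cov_bot_tsplit₁, curl_apply]
    simp
  exact TractorArray.ext h1 h2 h3

/-- The slots of the Yang–Mills detour operator on the image of the splitting operator. -/
theorem tcodiff_textD_tsplit₁ {ψ : Tens A 3} (hψ : Sym ψ) :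
    M.tcodiff (M.textD (tsplit₁ ψ)) = M.detTractor ψ := by
  rw [M.textD_tsplit₁ hψ]
  set F : TractorArray A 2 := ⟨0, 0, fun I => M.curl ψ ![I 2, I 3, I 0, I 1]⟩ with hF
  have h1 : (M.tcodiff F).top = 0 := by
    refine tens1_ext fun c => ?_
    simp only [tcodiff, tcov, hF, map_zero, Pi.zero_apply, smul_zero, sub_zero, con_zero, neg_zero]
  have h2 : (M.tcodiff F).mid = tp (M.detMid ψ) := by
    refine tens2_ext fun a c => ?_
    have e : ∀ d e, (M.tcov F).mid ![a, d, e, c] = -M.curl ψ ![e, c, d, a] := fun d e => by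
      change M.cov 0 ![d, a, e, c] + (M.L / 3) • (M.g d a * 0) - M.curl ψ ![e, c, d, a] = _
      rw [map_zero]; simp
    change -M.con (fun d e => (M.tcov F).mid ![a, d, e, c]) = M.detMid ψ ![c, a]
    simp only [e]
    rw [con_neg, neg_neg, ← M.con_curl hψ, ← con_swap]
  have h3 : (M.tcodiff F).bot = fun I => -M.detBot ψ ![I 2, I 0, I 1] := by
    refine tens3_ext fun a b c => ?_
    have e : ∀ d e, (M.tcov F).bot ![a, b, d, e, c] = M.cov (M.curl ψ) ![d, e, c, a, b] :=
      fun d e => by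
        change M.cov F.bot ![d, a, b, e, c] + (M.L / 3) • (M.g d a * 0) +
          (M.L / 3) • (M.g d b * 0) = _
        rw [mul_zero, mul_zero, smul_zero, add_zero, add_zero]
        exact M.cov_perm_four (M.curl ψ) 2 3 0 1 (by decide) d ![a, b, e, c]
    change -M.con (fun d e => (M.tcov F).bot ![a, b, d, e, c]) = -M.detBot ψ ![c, a, b]
    rw [← M.dv_curl hψ, dv_four]
    simp only [e]
  exact TractorArray.ext h1 h2 h3

/-! ### Characterisation of the splitting operators -/

theorem tsplit₀_bot_symm (σ : Tens A 0) (a b : Fin 4) :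
    (M.tsplit₀ σ).bot ![a, b] = (M.tsplit₀ σ).bot ![b, a] := by
  have e : ∀ a b, (M.tsplit₀ σ).bot ![a, b] =
      (1 / 2 : ℝ) • M.cov (M.cov σ) ![a, b] + (M.L / 3) • (M.g a b * σ ![]) := fun a b =>
    congrArg ((1 / 2 : ℝ) • M.cov (M.cov σ) ![a, b] + (M.L / 3) • ·) (M.gOut_cons σ a b ![])
  rw [e, e, M.hess_symm σ a b, M.g_symm a b]

/-- Normalisation of tractors: if the codifferential of the derivative of `ξ` is zero, the top slot
determines the middle slot, and the two determine the bottom slot, which is symmetric. -/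
theorem eq_tsplit₀_iff {ξ : TractorArray A 0} (hξ : ∀ a b, ξ.bot ![a, b] = ξ.bot ![b, a])
    (σ : Tens A 0) : ξ = M.tsplit₀ σ ↔ ξ.top = σ ∧ (M.tcov ξ).top = 0 ∧
      ∀ a b, (M.tcov ξ).mid ![b, a] + (M.tcov ξ).mid ![a, b] = 0 := by
  constructor
  · rintro rfl
    rw [M.tcov_tsplit₀]
    exact ⟨rfl, rfl, fun a b => add_zero _⟩
  · rintro ⟨h1, h2, h3⟩
    have h4 : ξ.mid = (1 / 2 : ℝ) • M.cov σ := by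
      refine tens1_ext fun a => ?_
      have e : M.cov ξ.top ![a] - (2 : ℝ) • ξ.mid ![a] = 0 := congrFun h2 ![a]
      rw [h1] at e
      rw [Pi.smul_apply]
      linear_combination (norm := module) (-1 / 2 : ℝ) • e
    have e : ∀ a c, (M.tcov ξ).mid ![a, c] = (1 / 2 : ℝ) • M.cov (M.cov σ) ![c, a] +
        (M.L / 3) • (M.g c a * σ ![]) - ξ.bot ![c, a] := fun a c => by
      rw [← Pi.smul_apply, ← map_smul, ← h4, ← h1]
      rfl
    refine TractorArray.ext h1 h4 (tens2_ext fun a b => ?_)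
    have h5 := h3 a b
    have e2 : M.gOut σ ![a, b] = M.g a b * σ ![] := M.gOut_cons σ a b ![]
    rw [e, e, hξ b a, M.hess_symm σ b a, M.g_symm b a] at h5
    simp only [tsplit₀, Pi.add_apply, Pi.smul_apply, e2]
    linear_combination (norm := module) (-1 / 2 : ℝ) • h5

/-- Normalisation of tractor-valued one-forms. If the codifferential of `ξ` is zero, so are the top
slot and the symmetric part of the middle slot; if moreover that of `d ξ` is zero, so are the skew
part of the middle slot and the hook part of the bottom slot; what is left is the projection `ψ`. -/
theorem eq_tsplit₁_iff {ξ : TractorArray A 1} (hξ : ∀ a b c, ξ.bot ![a, b, c] = ξ.bot ![b, a, c])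
    {ψ : Tens A 3} (hψ : Sym ψ) : ξ = tsplit₁ ψ ↔
      (ξ.top = 0 ∧ ∀ a b, ξ.mid ![b, a] + ξ.mid ![a, b] = 0) ∧ symm3 ξ.bot = ψ ∧
      (M.textD ξ).top = 0 ∧
      ∀ a b c, (M.textD ξ).mid ![b, a, c] + (M.textD ξ).mid ![a, b, c] = 0 := by
  constructor
  · rintro rfl
    rw [M.textD_tsplit₁ hψ]
    exact ⟨⟨rfl, fun a b => add_zero _⟩, symm3_tsplit₁_bot hψ, rfl, fun a b c => add_zero _⟩
  · rintro ⟨⟨h1, h2⟩, h3, h4, h5⟩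
    have hm : ξ.mid = 0 := by
      refine tens2_ext fun a b => ?_
      have e : (M.cov ξ.top ![a, b] - (2 : ℝ) • ξ.mid ![a, b]) -
          (M.cov ξ.top ![b, a] - (2 : ℝ) • ξ.mid ![b, a]) = 0 := congrFun h4 ![a, b]
      rw [h1, map_zero, Pi.zero_apply, Pi.zero_apply] at e
      have e2 := h2 a b
      rw [Pi.zero_apply]
      linear_combination (norm := module) (1 / 2 : ℝ) • e2 - (1 / 4 : ℝ) • e
    have hd : ∀ a d c, (M.textD ξ).mid ![a, d, c] = ξ.bot ![c, a, d] - ξ.bot ![d, a, c] := by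
      intro a d c
      change (M.cov ξ.mid ![d, a, c] + (M.L / 3) • (M.g d a * ξ.top ![c]) - ξ.bot ![d, a, c]) -
        (M.cov ξ.mid ![c, a, d] + (M.L / 3) • (M.g c a * ξ.top ![d]) - ξ.bot ![c, a, d]) = _
      rw [hm, h1, map_zero]
      simp only [Pi.zero_apply, mul_zero, smul_zero, zero_add, zero_sub]
      ring
    -- the hook part of the bottom slot vanishes
    have hc : ∀ a b c, ξ.bot ![a, b, c] = ξ.bot ![b, c, a] := fun a b c => by
      have e1 := h5 a b c
      have e2 := h5 b c a
      rw [hd, hd] at e1 e2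
      rw [hξ c b a, hξ b a c, hξ c a b] at e1
      rw [hξ c b a, hξ a b c, hξ a c b] at e2
      have e3 := hξ a c b
      have e4 := hξ a b c
      linear_combination (norm := module) (-1 / 3 : ℝ) • e1 + (1 / 3 : ℝ) • e2 +
        (1 / 3 : ℝ) • e3 + (1 / 3 : ℝ) • e4
    have hs : Sym ξ.bot := ⟨hξ, fun a b c => (hc a b c).trans ((hξ b c a).trans (hc a c b).symm)⟩
    rw [symm3_of_sym hs] at h3
    refine TractorArray.ext h1 hm (tens3_ext fun a b c => ?_)
    rw [h3]
    change ψ ![a, b, c] = ψ ![c, a, b]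
    rw [hψ.1 c a b, hψ.2 a c b]

theorem ext₁_smul (r : ℝ) (X : Tens A 1) : M.ext₁ (r • X) = r • M.ext₁ X := by
  rw [ext₁, ext₁, map_smul, tp_smul, smul_sub]

theorem gaugeOp_smul (r : ℝ) (σ : Tens A 0) : M.gaugeOp (r • σ) = r • M.gaugeOp σ := by
  rw [gaugeOp, gaugeOp, map_smul, map_smul, symm3_cov_smul, gSym_smul]
  module

theorem detTractor_gaugeOp (σ : Tens A 0) : M.detTractor (M.gaugeOp σ) = ⟨0, 0, 0⟩ := by
  rw [detTractor, M.detMid_gaugeOp, M.detBot_gaugeOp]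
  exact TractorArray.ext rfl rfl (funext fun _ => neg_zero)

theorem det_gaugeOp (σ : Tens A 0) : M.det (M.gaugeOp σ) = 0 := by
  rw [← M.detBot_eq_det (M.sym_gaugeOp σ) (M.detMid_gaugeOp σ), M.detBot_gaugeOp]

theorem adj_neg (γ : Tens A 3) : M.adj (-γ) = -M.adj γ := by
  rw [← neg_one_smul ℝ γ, adj, adj, dv_smul, dv_smul, dv_smul, tr_smul, dv_smul]
  module

theorem detMid_eq_zero_of_tp {ψ : Tens A 3} : tp (M.detMid ψ) = 0 ↔ M.detMid ψ = 0 :=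
  ⟨fun h => by rw [← tp_tp (M.detMid ψ), h]; rfl, fun h => by rw [h]; rfl⟩

theorem detTractor_eq {ψ : Tens A 3} (hψ : Sym ψ) (h : M.detMid ψ = 0) :
    M.detTractor ψ = tsplit₁ (-M.det ψ) := by
  refine TractorArray.ext rfl (by rw [detTractor, h]; rfl) ?_
  rw [detTractor, M.detBot_eq_det hψ h]
  rfl

theorem detTractor_eq_zero_iff {ψ : Tens A 3} :
    ((M.detTractor ψ).top = 0 ∧ (M.detTractor ψ).mid = 0 ∧ (M.detTractor ψ).bot = 0) ↔
      M.detMid ψ = 0 ∧ M.detBot ψ = 0 := by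
  refine ⟨fun h => ⟨M.detMid_eq_zero_of_tp.mp h.2.1, tens3_ext fun c a b => ?_⟩,
    fun h => ⟨rfl, M.detMid_eq_zero_of_tp.mpr h.1, ?_⟩⟩
  · exact neg_eq_zero.mp (congrFun h.2.2 ![a, b, c])
  · rw [detTractor, h.2]
    exact funext fun _ => neg_zero

/-- The scalar constraint says that the trace of the adjusted field is a gradient. -/
theorem pmScal_eq_zero_iff (hL : M.L ≠ 0) (ψ : Tens A 3) (χ : Tens A 0) :
    M.pmScal (M.traceAdjInv ψ) χ = 0 ↔ M.tr ψ = (-(6 / M.L)) • M.cov χ := by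
  have h : M.pmScal (M.traceAdjInv ψ) χ = (M.L / 6) • (M.tr ψ - (-(6 / M.L)) • M.cov χ) := by
    rw [pmScal, tr_traceAdjInv, smul_sub, smul_smul, smul_smul,
      show M.L / 6 * -(6 / M.L) = -1 by field_simp]
    module
  rw [h, smul_eq_zero_iff_right (by positivity), sub_eq_zero]

end ConstCurvAlgebra

/-! ### The algebra of smooth functions on an open set of the coordinate space -/

/-- The algebra of smooth functions on `U`, as restrictions to `U` of functions on the whole
coordinate space, since component arrays are defined there and only their values on `U` matter. -/
def SmoothFun (U : Set Coord) : Subalgebra ℝ (U → ℝ) where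
  carrier := {f | ∃ F : Coord → ℝ, ContDiffOn ℝ ∞ F U ∧ ∀ y : U, F y = f y}
  mul_mem' := by
    rintro f f' ⟨F, hF, hf⟩ ⟨F', hF', hf'⟩
    exact ⟨F * F', hF.mul hF', fun y => by simp [hf, hf']⟩
  add_mem' := by
    rintro f f' ⟨F, hF, hf⟩ ⟨F', hF', hf'⟩
    exact ⟨F + F', hF.add hF', fun y => by simp [hf, hf']⟩
  algebraMap_mem' r := ⟨fun _ => r, contDiffOn_const, fun _ => rfl⟩

namespace SmoothFun

variable {U : Set Coord}

/-- Evaluation at a point. -/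
def ev (y : U) : SmoothFun U →ₐ[ℝ] ℝ := (Pi.evalAlgHom ℝ (fun _ : U => ℝ) y).comp (SmoothFun U).val

theorem ext_ev {f f' : SmoothFun U} (h : ∀ y, ev y f = ev y f') : f = f' :=
  Subtype.ext (funext h)

/-- The restriction to `U` of a function that is smooth on `U`. -/
def mk (F : Coord → ℝ) (hF : ContDiffOn ℝ ∞ F U) : SmoothFun U :=
  ⟨fun y => F y, F, hF, fun _ => rfl⟩

theorem ev_mk (F : Coord → ℝ) (hF : ContDiffOn ℝ ∞ F U) (y : U) : ev y (mk F hF) = F y := rfl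

/-- A function on the coordinate space, smooth on `U`, that restricts to `f`. -/
def lift (f : SmoothFun U) : Coord → ℝ := f.2.choose

theorem contDiffOn_lift (f : SmoothFun U) : ContDiffOn ℝ ∞ (SmoothFun.lift f) U := f.2.choose_spec.1

theorem lift_apply (f : SmoothFun U) (y : U) : (SmoothFun.lift f) y = ev y f := f.2.choose_spec.2 y

end SmoothFun

section pd

variable {U : Set Coord} (hU : IsOpen U) {F F' : Coord → ℝ}
include hU

theorem pd_congr (h : ∀ y ∈ U, F y = F' y) (a : Fin 4) {y : Coord} (hy : y ∈ U) :
    pd a F y = pd a F' y := by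
  have : F =ᶠ[nhds y] F' := Filter.eventuallyEq_of_mem (hU.mem_nhds hy) h
  rw [pd, pd, this.fderiv_eq]

theorem differentiableAt_of_smooth (hF : ContDiffOn ℝ ∞ F U) {y : Coord} (hy : y ∈ U) :
    DifferentiableAt ℝ F y :=
  (hF.contDiffAt (hU.mem_nhds hy)).differentiableAt (by simp)

theorem contDiffOn_pd (hF : ContDiffOn ℝ ∞ F U) (a : Fin 4) : ContDiffOn ℝ ∞ (pd a F) U :=
  (hF.fderiv_of_isOpen hU (m := ∞) (by simp)).clm_apply contDiffOn_const

theorem pd_add (hF : ContDiffOn ℝ ∞ F U) (hF' : ContDiffOn ℝ ∞ F' U) (a : Fin 4) {y : Coord}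
    (hy : y ∈ U) : pd a (fun z => F z + F' z) y = pd a F y + pd a F' y := by
  rw [pd, fderiv_fun_add (differentiableAt_of_smooth hU hF hy)
    (differentiableAt_of_smooth hU hF' hy)]
  rfl

theorem pd_mul (hF : ContDiffOn ℝ ∞ F U) (hF' : ContDiffOn ℝ ∞ F' U) (a : Fin 4) {y : Coord}
    (hy : y ∈ U) : pd a (fun z => F z * F' z) y = F y * pd a F' y + F' y * pd a F y := by
  rw [pd, fderiv_fun_mul (differentiableAt_of_smooth hU hF hy)
    (differentiableAt_of_smooth hU hF' hy)]
  rfl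

theorem pd_const_mul (hF : ContDiffOn ℝ ∞ F U) (r : ℝ) (a : Fin 4) {y : Coord}
    (hy : y ∈ U) : pd a (fun z => r * F z) y = r * pd a F y := by
  rw [pd, fderiv_const_mul (differentiableAt_of_smooth hU hF hy)]
  rfl

/-- Symmetry of second partial derivatives. -/
theorem pd_comm (hF : ContDiffOn ℝ ∞ F U) (a b : Fin 4) {y : Coord} (hy : y ∈ U) :
    pd a (pd b F) y = pd b (pd a F) y := by
  have h1 : ∀ c, pd c F = fun z => fderiv ℝ F z (EuclideanSpace.single c (1 : ℝ)) := fun _ => rfl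
  have h2 : DifferentiableAt ℝ (fderiv ℝ F) y :=
    ((hF.fderiv_of_isOpen hU (m := ∞) (by simp)).contDiffAt (hU.mem_nhds hy)).differentiableAt
      (by simp)
  have h3 : ∀ c d, pd d (pd c F) y = fderiv ℝ (fderiv ℝ F) y (EuclideanSpace.single d (1 : ℝ))
      (EuclideanSpace.single c (1 : ℝ)) := fun c d => by
    rw [pd, h1, fderiv_clm_apply h2 (differentiableAt_const _)]
    simp
  rw [h3, h3]
  have h4 : IsSymmSndFDerivAt ℝ F y := by
    refine (hF.contDiffAt (hU.mem_nhds hy)).isSymmSndFDerivAt ?_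
    rw [minSmoothness_of_isRCLikeNormedField]
    exact WithTop.coe_le_coe.2 (le_top : (2 : ℕ∞) ≤ ⊤)
  exact h4 _ _

open SmoothFun in
/-- The partial derivative, as a derivation of the algebra of smooth functions. -/
def SmoothFun.deriv (a : Fin 4) : Derivation ℝ (SmoothFun U) (SmoothFun U) :=
  Derivation.mk'
    { toFun := fun f => mk (pd a (lift f)) (contDiffOn_pd hU (contDiffOn_lift f) a)
      map_add' := fun f f' => ext_ev fun y => by
        rw [map_add, ev_mk, ev_mk, ev_mk,
          ← pd_add hU (contDiffOn_lift f) (contDiffOn_lift f') a y.2]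
        refine pd_congr hU (fun z hz => ?_) a y.2
        rw [lift_apply (f + f') ⟨z, hz⟩, lift_apply f ⟨z, hz⟩, lift_apply f' ⟨z, hz⟩,
          map_add]
      map_smul' := fun r f => ext_ev fun y => by
        rw [RingHom.id_apply, map_smul, ev_mk, ev_mk, smul_eq_mul,
          ← pd_const_mul hU (contDiffOn_lift f) r a y.2]
        refine pd_congr hU (fun z hz => ?_) a y.2
        rw [lift_apply (r • f) ⟨z, hz⟩, lift_apply f ⟨z, hz⟩, map_smul,
          smul_eq_mul] }
    fun f f' => ext_ev fun y => by
      change pd a (lift (f * f')) y = f.1 y * pd a (lift f') y + f'.1 y * pd a (lift f) y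
      have e1 : f.1 y = (lift f) y := (lift_apply f y).symm
      have e2 : f'.1 y = (lift f') y := (lift_apply f' y).symm
      rw [e1, e2, ← pd_mul hU (contDiffOn_lift f) (contDiffOn_lift f') a y.2]
      refine pd_congr hU (fun z hz => ?_) a y.2
      rw [lift_apply (f * f') ⟨z, hz⟩, lift_apply f ⟨z, hz⟩, lift_apply f' ⟨z, hz⟩,
        map_mul]

theorem SmoothFun.ev_deriv (a : Fin 4) (f : SmoothFun U) (hF : ∀ z : U, F z = SmoothFun.ev z f)
    (y : U) : SmoothFun.ev y (SmoothFun.deriv hU a f) = pd a F y :=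
  pd_congr hU (fun z hz => by rw [SmoothFun.lift_apply f ⟨z, hz⟩, ← hF ⟨z, hz⟩]) a y.2

theorem SmoothFun.deriv_comm (a b : Fin 4) (f : SmoothFun U) :
    SmoothFun.deriv hU a (SmoothFun.deriv hU b f) =
      SmoothFun.deriv hU b (SmoothFun.deriv hU a f) := by
  have h : ∀ c (z : U), pd c (SmoothFun.lift f) z = SmoothFun.ev z (SmoothFun.deriv hU c f) :=
    fun c z => rfl
  refine SmoothFun.ext_ev fun y => ?_
  rw [SmoothFun.ev_deriv hU a _ (h b), SmoothFun.ev_deriv hU b _ (h a),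
    pd_comm hU (SmoothFun.contDiffOn_lift f) a b y.2]

end pd

/-! ### Metrics of constant curvature in coordinates -/

/-- Component arrays of a metric of constant curvature on an open set. -/
structure IsCurvedMetric (U : Set Coord) (G : Comp 2) (Λ : ℝ) : Prop where
  isOpen : IsOpen U
  smooth : G.SmoothOn U
  symm : ∀ y ∈ U, ∀ a b, G y ![a, b] = G y ![b, a]
  nondeg : ∀ y ∈ U, IsUnit (Matrix.of fun a b => G y ![a, b]).det
  curv : ∀ y ∈ U, ∀ a b d c, riem G y a b d c =
    Λ / 3 * (kron d a * G y ![b, c] - kron d b * G y ![a, c])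

theorem contDiffOn_det {U : Set Coord} {m : Coord → Matrix (Fin 4) (Fin 4) ℝ}
    (hm : ∀ a b, ContDiffOn ℝ ∞ (fun y => m y a b) U) : ContDiffOn ℝ ∞ (fun y => (m y).det) U := by
  simp only [Matrix.det_apply]
  exact ContDiffOn.sum fun π _ => (contDiffOn_prod fun i _ => hm _ _).const_smul _

namespace IsCurvedMetric

open SmoothFun

variable {U : Set Coord} {G : Comp 2} {Λ : ℝ} (hG : IsCurvedMetric U G Λ)
include hG

theorem mono {V : Set Coord} (hV : IsOpen V) (hVU : V ⊆ U) : IsCurvedMetric V G Λ where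
  isOpen := hV
  smooth I := (hG.smooth I).mono hVU
  symm y hy := hG.symm y (hVU hy)
  nondeg y hy := hG.nondeg y (hVU hy)
  curv y hy := hG.curv y (hVU hy)

/-- The entries of the inverse metric are smooth, by Cramer's rule. -/
theorem ginv_smooth (a b : Fin 4) : ContDiffOn ℝ ∞ (fun y => ginv G y a b) U := by
  have h1 : ∀ y, ginv G y a b = (Matrix.of fun a b => G y ![a, b]).det⁻¹ *
      ((Matrix.of fun a b => G y ![a, b]).updateRow b (Pi.single a 1)).det := fun y => by
    rw [ginv, Matrix.inv_def, Ring.inverse_eq_inv', Matrix.smul_apply, smul_eq_mul,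
      Matrix.adjugate_apply]
  simp only [h1]
  refine ContDiffOn.mul (ContDiffOn.inv (contDiffOn_det fun a b => hG.smooth _)
    fun y hy => (hG.nondeg y hy).ne_zero) (contDiffOn_det fun c d => ?_)
  by_cases hc : c = b
  · subst hc
    simp only [Matrix.updateRow_self]
    exact contDiffOn_const
  · simp only [Matrix.updateRow_ne hc]
    exact hG.smooth _

theorem ginv_symm {y : Coord} (hy : y ∈ U) (a b : Fin 4) : ginv G y a b = ginv G y b a := by
  have h : (Matrix.of fun a b => G y ![a, b]).transpose = Matrix.of fun a b => G y ![a, b] := by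
    ext a b; exact hG.symm y hy b a
  have h2 := Matrix.transpose_nonsing_inv (Matrix.of fun a b => G y ![a, b])
  rw [h] at h2
  exact congrFun (congrFun h2 b) a

theorem ginv_mul {y : Coord} (hy : y ∈ U) :
    ginv G y * (Matrix.of fun a b => G y ![a, b]) = 1 := Matrix.nonsing_inv_mul _ (hG.nondeg y hy)

/-- The metric algebra of smooth functions on `U`. -/
def metricAlg : MetricAlgebra (SmoothFun U) where
  D := SmoothFun.deriv hG.isOpen
  D_comm := SmoothFun.deriv_comm hG.isOpen
  g := Matrix.of fun a b => SmoothFun.mk (fun y => G y ![a, b]) (hG.smooth _)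
  h := Matrix.of fun a b => SmoothFun.mk (fun y => ginv G y a b) (hG.ginv_smooth a b)
  g_symm a b := ext_ev fun y => hG.symm y y.2 a b
  h_symm a b := ext_ev fun y => hG.ginv_symm y.2 a b
  h_mul_g := by
    ext1 a c
    refine ext_ev fun y => ?_
    have h := congrFun (congrFun (hG.ginv_mul y.2) a) c
    rw [Matrix.mul_apply] at h ⊢
    rw [map_sum]
    simp only [Matrix.of_apply, map_mul, ev_mk]
    refine h.trans ?_
    rw [Matrix.one_apply, Matrix.one_apply]
    split <;> simp

theorem ev_Γ (y : U) (a d b : Fin 4) : christoffel G y d a b = ev y (hG.metricAlg.Γ a d b) := by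
  have h : ∀ a b c, ev y (SmoothFun.deriv hG.isOpen a (hG.metricAlg.g b c)) =
      pd a (fun z => G z ![b, c]) y := fun a b c =>
    ev_deriv hG.isOpen a _ (fun z => rfl) y
  simp only [christoffel, MetricAlgebra.Γ, Matrix.of_apply, map_smul, map_sum, map_mul, map_add,
    map_sub, smul_eq_mul]
  simp only [metricAlg, Matrix.of_apply] at h ⊢
  simp only [h, ev_mk]

/-- The algebra of smooth functions on `U`, with its calculus of constant curvature. -/
def alg : ConstCurvAlgebra (SmoothFun U) where
  toMetricAlgebra := hG.metricAlg
  L := Λ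
  curv a b d c := ext_ev fun y => by
    have h := hG.curv y y.2 a b d c
    have hΓ : ∀ a d b (z : U), christoffel G z d a b = ev z (hG.metricAlg.Γ a d b) :=
      fun a d b z => hG.ev_Γ z a d b
    have hD : ∀ a b d c, ev y (hG.metricAlg.D a (hG.metricAlg.Γ b d c)) =
        pd a (fun z => christoffel G z d b c) y := fun a b d c =>
      ev_deriv hG.isOpen a _ (hΓ b d c) y
    have h2 : ∀ b c, G y ![b, c] = ev y (hG.metricAlg.g b c) := fun _ _ => rfl
    rw [riem] at h
    simp only [hΓ, ← hD, h2, kron] at h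
    simp only [MetricAlgebra.R, Matrix.add_apply, Matrix.sub_apply, Matrix.map_apply,
      Matrix.mul_apply, map_add, map_sub, map_sum, map_mul, map_smul, smul_eq_mul, apply_ite (ev y),
      map_zero]
    rw [Finset.sum_sub_distrib] at h
    rw [h]
    split_ifs <;> ring

end IsCurvedMetric

/-! ### Component arrays as tensors over the algebra of smooth functions -/

/-- The component array `T` restricts on `U` to the tensor `t` over the algebra of smooth
functions. -/
def Rep (U : Set Coord) {k : ℕ} (T : Comp k) (t : Tens (SmoothFun U) k) : Prop :=
  ∀ (y : U) I, T y I = SmoothFun.ev y (t I)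

namespace Rep

open SmoothFun

variable {U : Set Coord} {k : ℕ} {S T : Comp k} {s t : Tens (SmoothFun U) k}

theorem exists_of_smoothOn (hT : T.SmoothOn U) : ∃ t, Rep U T t :=
  ⟨fun I => SmoothFun.mk _ (hT I), fun _ _ => rfl⟩

theorem smoothOn (hT : Rep U T t) : T.SmoothOn U := fun I =>
  (contDiffOn_lift (t I)).congr fun y hy => (hT ⟨y, hy⟩ I).trans (lift_apply (t I) ⟨y, hy⟩).symm

theorem eqOn_iff (hS : Rep U S s) (hT : Rep U T t) : Comp.EqOn U S T ↔ s = t := by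
  refine ⟨fun h => funext fun I => ext_ev fun y => ?_, fun h y hy I => ?_⟩
  · rw [← hS y I, ← hT y I, h y y.2]
  · rw [hS ⟨y, hy⟩ I, hT ⟨y, hy⟩ I, h]

theorem zero : Rep U (fun _ _ => 0) (0 : Tens (SmoothFun U) k) := fun _ _ => (map_zero _).symm

theorem zeroOn_iff (hT : Rep U T t) : Comp.ZeroOn U T ↔ t = 0 := hT.eqOn_iff zero

theorem congr (hT : Rep U T t) (h : Comp.EqOn U S T) : Rep U S t := fun y I =>
  (h y y.2 I).trans (hT y I)

theorem add (hS : Rep U S s) (hT : Rep U T t) : Rep U (S + T) (s + t) := fun y I => by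
  rw [Pi.add_apply, Pi.add_apply, Pi.add_apply, map_add, hS, hT]

theorem smul (r : ℝ) (hT : Rep U T t) : Rep U (fun y I => r * T y I) (r • t) := fun y I => by
  rw [Pi.smul_apply, map_smul, ← hT, smul_eq_mul]

theorem neg (hT : Rep U T t) : Rep U (fun y I => -T y I) (-t) := fun y I => by
  rw [Pi.neg_apply, map_neg, ← hT]

theorem symm3 {T : Comp 3} {t : Tens (SmoothFun U) 3} (hT : Rep U T t) :
    Rep U (symm3 T) (ConstCurvAlgebra.symm3 t) := fun y I => by
  simp only [PMSpinThree.symm3, sym3, ConstCurvAlgebra.symm3, map_smul, map_add, smul_eq_mul,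
    hT y]
  ring

theorem sym_of_symmOn {T : Comp 3} {t : Tens (SmoothFun U) 3} (hT : Rep U T t)
    (h : T.SymmOn U) : ConstCurvAlgebra.Sym t := by
  have key : ∀ (y : U) (π : Equiv.Perm (Fin 3)) (I J : Fin 3 → Fin 4), (fun i => I (π i)) = J →
      ev y (t J) = ev y (t I) := fun y π I J hJ => by
    rw [← hT y, ← hT y, ← hJ, h y y.2]
  refine ⟨fun a b c => ext_ev fun y => key y (Equiv.swap 0 1) _ _ ?_,
    fun a b c => ext_ev fun y => key y (Equiv.swap 1 2) _ _ ?_⟩ <;>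
  · funext i; fin_cases i <;> rfl

end Rep

namespace IsCurvedMetric

open SmoothFun

variable {U : Set Coord} {G : Comp 2} {Λ : ℝ} (hG : IsCurvedMetric U G Λ)

theorem ev_g (y : U) (a b : Fin 4) : ev y (hG.alg.g a b) = G y ![a, b] := rfl

theorem L_eq : hG.alg.L = Λ := rfl

theorem ev_con (y : U) (f : Fin 4 → Fin 4 → SmoothFun U) :
    ev y (hG.alg.con f) = ∑ a, ∑ b, ginv G y a b * ev y (f a b) := by
  rw [MetricAlgebra.con_apply]
  simp only [map_sum, map_mul]
  rfl

section

variable {k : ℕ}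

theorem rep_cov {T : Comp k} {t : Tens (SmoothFun U) k} (hT : Rep U T t) :
    Rep U (cov G T) (hG.alg.cov t) := fun y I => by
  have h : ev y (hG.alg.D (I 0) (t (Fin.tail I))) = pd (I 0) (fun z => T z (Fin.tail I)) y :=
    ev_deriv hG.isOpen _ _ (fun z => hT z _) y
  have h2 : ∀ a d b, christoffel G y d a b = ev y (hG.alg.Γ a d b) := fun a d b => hG.ev_Γ y a d b
  rw [MetricAlgebra.cov_apply, map_sub, h, MetricAlgebra.act_apply, cov]
  simp only [map_sum, map_mul, h2, hT y]

theorem rep_tr {T : Comp (k + 2)} {t : Tens (SmoothFun U) (k + 2)} (hT : Rep U T t) :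
    Rep U (tr G T) (hG.alg.tr t) := fun y I => by
  rw [MetricAlgebra.tr_apply, ev_con, tr]
  simp only [hT y]

theorem rep_div {T : Comp (k + 1)} {t : Tens (SmoothFun U) (k + 1)} (hT : Rep U T t) :
    Rep U (div G T) (hG.alg.dv t) := hG.rep_tr (hG.rep_cov hT)

theorem rep_lap {T : Comp k} {t : Tens (SmoothFun U) k} (hT : Rep U T t) :
    Rep U (lap G T) (hG.alg.lp t) := hG.rep_tr (hG.rep_cov (hG.rep_cov hT))

end

theorem rep_gSym {T : Comp 1} {t : Tens (SmoothFun U) 1} (hT : Rep U T t) :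
    Rep U (gSym G T) (hG.alg.gSym t) := fun y I => by
  have e : ∀ a b, G y ![a, b] = ev y (hG.alg.g a b) := fun _ _ => rfl
  simp only [gSym, sym3, ConstCurvAlgebra.gSym, map_smul, map_add, map_mul, smul_eq_mul, hT y, e]
  rw [hG.alg.g_symm (I 1) (I 0), hG.alg.g_symm (I 2) (I 1), hG.alg.g_symm (I 2) (I 0)]
  ring

theorem rep_tfSym {T : Comp 2} {t : Tens (SmoothFun U) 2} (hT : Rep U T t) :
    Rep U (tfSym G T) (hG.alg.tfSym t) := fun y I => by
  have e : ∀ a b, G y ![a, b] = ev y (hG.alg.g a b) := fun _ _ => rfl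
  have e2 : I = ![I 0, I 1] := by funext i; fin_cases i <;> rfl
  simp only [tfSym, sym2, ConstCurvAlgebra.tfSym, map_smul, map_add, map_sub, map_mul,
    smul_eq_mul, hT y, hG.rep_tr hT y]
  rw [show G y I = ev y (hG.alg.g (I 0) (I 1)) by rw [← e, ← e2]]
  ring

theorem rep_gaugeOp {σ : Comp 0} {t : Tens (SmoothFun U) 0} (hσ : Rep U σ t) :
    Rep U (gaugeOp G Λ σ) (hG.alg.gaugeOp t) := fun y I => by
  simp only [gaugeOp, ConstCurvAlgebra.gaugeOp, Pi.add_apply, Pi.smul_apply, map_add, map_smul,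
    smul_eq_mul, (hG.rep_cov (hG.rep_cov (hG.rep_cov hσ))).symm3 y, hG.rep_gSym (hG.rep_cov hσ) y,
    L_eq]

theorem rep_traceAdjust {φ : Comp 3} {t : Tens (SmoothFun U) 3} (hφ : Rep U φ t) :
    Rep U (traceAdjust G φ) (hG.alg.traceAdj t) := fun y I => by
  simp only [traceAdjust, ConstCurvAlgebra.traceAdj, Pi.add_apply, Pi.smul_apply, map_add,
    map_smul, smul_eq_mul, hφ y, hG.rep_gSym (hG.rep_tr hφ) y]

theorem rep_traceAdjustInv {φ : Comp 3} {t : Tens (SmoothFun U) 3} (hφ : Rep U φ t) :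
    Rep U (traceAdjustInv G φ) (hG.alg.traceAdjInv t) := fun y I => by
  simp only [traceAdjustInv, ConstCurvAlgebra.traceAdjInv, Pi.sub_apply, Pi.smul_apply, map_sub,
    map_smul, smul_eq_mul, hφ y, hG.rep_gSym (hG.rep_tr hφ) y]

section

variable {φ : Comp 3} {t : Tens (SmoothFun U) 3} (hφ : Rep U φ t)
  {χ : Comp 0} {u : Tens (SmoothFun U) 0} (hχ : Rep U χ u)
include hφ hχ

theorem rep_pmEq : Rep U (pmEq G Λ φ χ) (hG.alg.pmEq t u) := fun y I => by
  simp only [pmEq, ConstCurvAlgebra.pmEq, Pi.add_apply, Pi.sub_apply, Pi.smul_apply, map_add,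
    map_sub, map_smul, smul_eq_mul, hφ y, hG.rep_lap hφ y, (hG.rep_cov (hG.rep_div hφ)).symm3 y,
    (hG.rep_cov (hG.rep_cov (hG.rep_tr hφ))).symm3 y,
    hG.rep_gSym (hG.rep_lap (hG.rep_tr hφ)) y, hG.rep_gSym (hG.rep_div (hG.rep_div hφ)) y,
    hG.rep_gSym (hG.rep_cov (hG.rep_div (hG.rep_tr hφ))) y, hG.rep_gSym (hG.rep_cov hχ) y, L_eq]

theorem rep_pmAux : Rep U (pmAux G Λ φ χ) (hG.alg.pmAux t u) := fun y I => by
  simp only [pmAux, ConstCurvAlgebra.pmAux, Pi.add_apply, Pi.smul_apply, map_add, map_smul,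
    smul_eq_mul, hG.rep_lap hχ y, hG.rep_div (hG.rep_tr hφ) y, L_eq]

theorem rep_pmDivConstraint : Rep U (pmDivConstraint G Λ φ χ) (hG.alg.pmDiv t u) := fun y I => by
  simp only [pmDivConstraint, ConstCurvAlgebra.pmDiv, Pi.add_apply, Pi.sub_apply, Pi.smul_apply,
    map_add, map_sub, map_smul, smul_eq_mul, hG.rep_tfSym (hG.rep_cov (hG.rep_cov hχ)) y,
    hG.rep_tfSym (hG.rep_div hφ) y, hG.rep_tfSym (hG.rep_cov (hG.rep_tr hφ)) y, L_eq]

theorem rep_pmScalarConstraint : Rep U (pmScalarConstraint G Λ φ χ) (hG.alg.pmScal t u) :=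
  fun y I => by
    simp only [pmScalarConstraint, ConstCurvAlgebra.pmScal, Pi.add_apply, Pi.smul_apply, map_add,
      map_smul, smul_eq_mul, hG.rep_cov hχ y, hG.rep_tr hφ y, L_eq]

end

theorem rep_pmGaugeField {σ : Comp 0} {t : Tens (SmoothFun U) 0} (hσ : Rep U σ t) :
    Rep U (pmGaugeField G Λ σ) (hG.alg.pmGF t) := fun y I => by
  simp only [pmGaugeField, ConstCurvAlgebra.pmGF, Pi.add_apply, Pi.smul_apply, map_add, map_smul,
    smul_eq_mul, (hG.rep_cov (hG.rep_tfSym (hG.rep_cov (hG.rep_cov hσ)))).symm3 y,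
    hG.rep_gSym (hG.rep_cov hσ) y, L_eq]

theorem rep_pmGaugeScalar {σ : Comp 0} {t : Tens (SmoothFun U) 0} (hσ : Rep U σ t) :
    Rep U (pmGaugeScalar G Λ σ) (hG.alg.pmGS t) := fun y I => by
  simp only [pmGaugeScalar, ConstCurvAlgebra.pmGS, Pi.add_apply, Pi.smul_apply, Pi.neg_apply,
    map_add, map_smul, map_neg, smul_eq_mul, hG.rep_lap hσ y, hσ y, L_eq]
  ring

end IsCurvedMetric

/-! ### Curvature and the BGG operators in coordinates -/

namespace IsCurvedMetric

open SmoothFun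

variable {U : Set Coord} {G : Comp 2} {Λ : ℝ} (hG : IsCurvedMetric U G Λ)
include hG

theorem schouten_eq {y : Coord} (hy : y ∈ U) (I : Fin 2 → Fin 4) :
    schouten G y I = Λ / 3 * G y I := by
  obtain ⟨b, c, rfl⟩ : ∃ b c, I = ![b, c] :=
    ⟨I 0, I 1, by funext i; fin_cases i <;> rfl⟩
  have h : ∑ a, kron a b * G y ![a, c] = G y ![b, c] := by
    simp [kron]
  have h4 : ∑ a, kron a a * G y ![b, c] = 4 * G y ![b, c] := by
    simp [kron]
  simp only [schouten, hG.curv y hy, Matrix.cons_val_zero, Matrix.cons_val_one]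
  rw [← Finset.mul_sum, Finset.sum_sub_distrib, h, h4]
  ring

theorem rep_schouten : Rep U (schouten G) ((Λ / 3) • hG.alg.gOut fun _ => 1) := fun y I => by
  have e2 : I = ![I 0, I 1] := by funext i; fin_cases i <;> rfl
  rw [hG.schouten_eq y.2, Pi.smul_apply, map_smul, MetricAlgebra.gOut, mul_one, hG.ev_g,
    smul_eq_mul, ← e2]

theorem cov_schouten {y : Coord} (hy : y ∈ U) (I : Fin 3 → Fin 4) :
    cov G (schouten G) y I = 0 := by
  have h1 : hG.alg.cov (k := 0) (fun _ => 1) = 0 := by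
    funext I
    rw [MetricAlgebra.cov_apply, Derivation.map_one_eq_zero, MetricAlgebra.act_apply]
    simp
  have h : hG.alg.cov ((Λ / 3) • hG.alg.gOut (k := 0) fun _ => 1) = 0 := by
    refine ConstCurvAlgebra.tens3_ext fun c a b => ?_
    have := hG.alg.cov_gOut (k := 0) (fun _ => 1) c a b ![]
    rw [map_smul, Pi.smul_apply, Pi.zero_apply]
    refine (congrArg _ this).trans ?_
    rw [h1, Pi.zero_apply, mul_zero, smul_zero]
  rw [hG.rep_cov hG.rep_schouten ⟨y, hy⟩ I, h]
  rfl

/-- A metric of constant curvature is projectively flat. -/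
theorem weyl_eq {y : Coord} (hy : y ∈ U) (a b d c : Fin 4) : weyl G y a b d c = 0 := by
  rw [weyl, hG.curv y hy, hG.schouten_eq hy, hG.schouten_eq hy]
  ring

theorem cotton_eq {y : Coord} (hy : y ∈ U) (a b c : Fin 4) : cotton G y a b c = 0 := by
  rw [cotton, hG.cov_schouten hy, hG.cov_schouten hy, sub_zero]

theorem sum_ginv_ginv_schouten {y : Coord} (hy : y ∈ U) (a b : Fin 4) :
    ∑ a', ∑ b', ginv G y a a' * ginv G y b b' * schouten G y ![a', b'] =
      Λ / 3 * ginv G y a b := by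
  have h : ∀ a', ∑ b', ginv G y b b' * G y ![b', a'] = (1 : Matrix (Fin 4) (Fin 4) ℝ) b a' :=
    fun a' => by rw [← hG.ginv_mul hy, Matrix.mul_apply]; rfl
  have h2 : ∀ a', ∑ b', ginv G y a a' * ginv G y b b' * schouten G y ![a', b'] =
      Λ / 3 * ginv G y a a' * (1 : Matrix (Fin 4) (Fin 4) ℝ) b a' := fun a' => by
    rw [← h, Finset.mul_sum]
    refine Finset.sum_congr rfl fun b' _ => ?_
    rw [hG.schouten_eq hy, hG.symm y hy a' b']
    ring
  simp only [h2, Matrix.one_apply, mul_ite, mul_one, mul_zero, Finset.sum_ite_eq,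
    Finset.mem_univ, if_true]

/-- Of the terms of the adjoint with `Q`, those with a derivative of `Q` vanish, and the other one
is the divergence of a multiple of the trace. -/
theorem rep_bggOpAdj {γ : Comp 3} {t : Tens (SmoothFun U) 3} (hγ : Rep U γ t) :
    Rep U (bggOpAdj G γ) (hG.alg.adj t) := fun y I => by
  have h : Rep U (fun z (K : Fin 1 → Fin 4) => ∑ a, ∑ b, ∑ a', ∑ b',
      ginv G z a a' * ginv G z b b' * schouten G z ![a', b'] * γ z ![a, b, K 0])
      ((Λ / 3) • hG.alg.tr t) := by
    refine ((hG.rep_tr hγ).smul (Λ / 3)).congr fun z hz K => ?_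
    obtain ⟨c, rfl⟩ : ∃ c, K = ![c] := ⟨K 0, by funext i; fin_cases i; rfl⟩
    change _ = Λ / 3 * ∑ a, ∑ b, ginv G z a b * γ z ![a, b, c]
    rw [Finset.mul_sum]
    refine Finset.sum_congr rfl fun a _ => ?_
    rw [Finset.mul_sum]
    refine Finset.sum_congr rfl fun b _ => ?_
    simp only [← Finset.sum_mul]
    rw [hG.sum_ginv_ginv_schouten hz, mul_assoc]
    rfl
  simp only [bggOpAdj, hG.cov_schouten y.2, mul_zero, zero_mul, Finset.sum_const_zero, add_zero,
    hG.rep_div (hG.rep_div (hG.rep_div hγ)) y, hG.rep_div h y]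
  rw [ConstCurvAlgebra.adj, ConstCurvAlgebra.dv_smul]
  simp only [Pi.sub_apply, Pi.neg_apply, Pi.smul_apply, map_sub, map_neg, map_smul, smul_eq_mul,
    L_eq]
  ring

end IsCurvedMetric

/-- The tractor-valued tensor `Ξ` restricts on `U` to `ξ`. -/
structure RepT (U : Set Coord) {k : ℕ} (Ξ : TractorForm k) (ξ : TractorArray (SmoothFun U) k) :
    Prop where
  top : Rep U Ξ.top ξ.top
  mid : Rep U Ξ.mid ξ.mid
  bot : Rep U Ξ.bot ξ.bot

namespace RepT

variable {U : Set Coord} {k : ℕ} {Ξ Θ : TractorForm k} {ξ θ : TractorArray (SmoothFun U) k}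

theorem eqOn_iff (hΞ : RepT U Ξ ξ) (hΘ : RepT U Θ θ) : Ξ.EqOn U Θ ↔ ξ = θ := by
  rw [TractorForm.EqOn, hΞ.top.eqOn_iff hΘ.top, hΞ.mid.eqOn_iff hΘ.mid, hΞ.bot.eqOn_iff hΘ.bot,
    TractorArray.ext_iff]

theorem zeroOn_iff (hΞ : RepT U Ξ ξ) : Ξ.ZeroOn U ↔ ξ.top = 0 ∧ ξ.mid = 0 ∧ ξ.bot = 0 := by
  rw [TractorForm.ZeroOn, hΞ.top.zeroOn_iff, hΞ.mid.zeroOn_iff, hΞ.bot.zeroOn_iff]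

theorem split₁ {ψ : Comp 3} {t : Tens (SmoothFun U) 3} (hψ : Rep U ψ t) :
    RepT U (split₁ ψ) (ConstCurvAlgebra.tsplit₁ t) where
  top := Rep.zero
  mid := Rep.zero
  bot y _ := hψ y _

theorem exists_of_isSection (h : Ξ.IsSection U) : ∃ ξ, RepT U Ξ ξ := by
  obtain ⟨t, ht⟩ := Rep.exists_of_smoothOn h.top
  obtain ⟨m, hm⟩ := Rep.exists_of_smoothOn h.mid
  obtain ⟨b, hb⟩ := Rep.exists_of_smoothOn h.bot
  exact ⟨⟨t, m, b⟩, ht, hm, hb⟩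

end RepT

namespace IsCurvedMetric

open SmoothFun

variable {U : Set Coord} {G : Comp 2} {Λ : ℝ} (hG : IsCurvedMetric U G Λ)
include hG

theorem repT_split₀ {σ : Comp 0} {t : Tens (SmoothFun U) 0} (hσ : Rep U σ t) :
    RepT U (split₀ G σ) (hG.alg.tsplit₀ t) where
  top := hσ
  mid := (hG.rep_cov hσ).smul (1 / 2)
  bot y I := by
    have e2 : I = ![I 0, I 1] := by funext i; fin_cases i <;> rfl
    have e : G y I = ev y (hG.alg.g (I 0) (I 1)) := by rw [ev_g, ← e2]
    have e3 : Fin.tail (Fin.tail I) = ![] := Subsingleton.elim _ _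
    simp only [split₀, ConstCurvAlgebra.tsplit₀, Pi.add_apply, Pi.smul_apply, map_add, map_smul,
      smul_eq_mul, MetricAlgebra.gOut, map_mul, hG.schouten_eq y.2, e, e3, hσ y,
      hG.rep_cov (hG.rep_cov hσ) y, L_eq]
    ring

theorem repT_tractorCov {k : ℕ} {Ξ : TractorForm k} {ξ : TractorArray (SmoothFun U) k}
    (h : RepT U Ξ ξ) : RepT U (tractorCov G Ξ) (hG.alg.tcov ξ) where
  top y I := by
    simp only [tractorCov, ConstCurvAlgebra.tcov, map_sub, map_smul, smul_eq_mul,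
      hG.rep_cov h.top y, h.mid y]
  mid y I := by
    simp only [tractorCov, ConstCurvAlgebra.tcov, map_sub, map_add, map_smul, map_mul, smul_eq_mul,
      hG.rep_cov h.mid y, h.top y, h.bot y, hG.schouten_eq y.2, hG.ev_g, L_eq, mul_assoc]
  bot y I := by
    simp only [tractorCov, ConstCurvAlgebra.tcov, map_add, map_smul, map_mul, smul_eq_mul,
      hG.rep_cov h.bot y, h.mid y, hG.schouten_eq y.2, hG.ev_g, L_eq, mul_assoc]

theorem repT_extD {Ξ : TractorForm 1} {ξ : TractorArray (SmoothFun U) 1}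
    (h : RepT U Ξ ξ) : RepT U (extD G Ξ) (hG.alg.textD ξ) where
  top y I := by
    simp only [extD, ConstCurvAlgebra.textD, map_sub, (hG.repT_tractorCov h).top y]
  mid y I := by
    simp only [extD, ConstCurvAlgebra.textD, map_sub, (hG.repT_tractorCov h).mid y]
  bot y I := by
    simp only [extD, ConstCurvAlgebra.textD, map_sub, (hG.repT_tractorCov h).bot y]

theorem repT_codiff {Ξ : TractorForm 2} {ξ : TractorArray (SmoothFun U) 2}
    (h : RepT U Ξ ξ) : RepT U (codiff G Ξ) (hG.alg.tcodiff ξ) where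
  top y I := by
    simp only [codiff, ConstCurvAlgebra.tcodiff, map_neg, hG.ev_con, (hG.repT_tractorCov h).top y]
  mid y I := by
    simp only [codiff, ConstCurvAlgebra.tcodiff, map_neg, hG.ev_con, (hG.repT_tractorCov h).mid y]
  bot y I := by
    simp only [codiff, ConstCurvAlgebra.tcodiff, map_neg, hG.ev_con, (hG.repT_tractorCov h).bot y]

/-- The tractor connection of a metric of constant curvature is flat, so the curvature term of the
detour operator drops out. -/
theorem repT_detourOp {Ξ : TractorForm 1} {ξ : TractorArray (SmoothFun U) 1}
    (h : RepT U Ξ ξ) : RepT U (detourOp G Ξ) (hG.alg.tcodiff (hG.alg.textD ξ)) where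
  top y I := by
    simp only [detourOp, endCurv, sub_zero, (hG.repT_codiff (hG.repT_extD h)).top y]
  mid y I := by
    simp only [detourOp, endCurv, hG.weyl_eq y.2, hG.cotton_eq y.2, zero_mul,
      Finset.sum_const_zero, mul_zero, sub_zero, (hG.repT_codiff (hG.repT_extD h)).mid y]
  bot y I := by
    simp only [detourOp, endCurv, hG.weyl_eq y.2, hG.cotton_eq y.2, zero_mul, add_zero,
      Finset.sum_const_zero, mul_zero, sub_zero, (hG.repT_codiff (hG.repT_extD h)).bot y]

theorem repT_detourOp_split₁ {ψ : Comp 3} {t : Tens (SmoothFun U) 3} (hψ : Rep U ψ t)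
    (ht : ConstCurvAlgebra.Sym t) : RepT U (detourOp G (split₁ ψ)) (hG.alg.detTractor t) := by
  rw [← hG.alg.tcodiff_textD_tsplit₁ ht]
  exact hG.repT_detourOp (RepT.split₁ hψ)

theorem rep_bggDetour {ψ : Comp 3} {t : Tens (SmoothFun U) 3} (hψ : Rep U ψ t)
    (ht : ConstCurvAlgebra.Sym t) : Rep U (bggDetour G ψ) (-hG.alg.det t) := by
  rw [← hG.alg.symm3_detTractor_bot]
  exact (hG.repT_detourOp_split₁ hψ ht).bot.symm3

theorem repT_tractorCov_split₀ {σ : Comp 0} {t : Tens (SmoothFun U) 0} (hσ : Rep U σ t) :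
    RepT U (tractorCov G (split₀ G σ))
      (ConstCurvAlgebra.tsplit₁ ((1 / 2 : ℝ) • hG.alg.gaugeOp t)) := by
  rw [← hG.alg.tcov_tsplit₀]
  exact hG.repT_tractorCov (hG.repT_split₀ hσ)

theorem rep_bggOp {σ : Comp 0} {t : Tens (SmoothFun U) 0} (hσ : Rep U σ t) :
    Rep U (bggOp G σ) ((1 / 2 : ℝ) • hG.alg.gaugeOp t) := by
  rw [← ConstCurvAlgebra.symm3_tsplit₁_bot
    (ConstCurvAlgebra.sym_smul (hG.alg.sym_gaugeOp t) (1 / 2))]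
  exact (hG.repT_tractorCov_split₀ hσ).bot.symm3

end IsCurvedMetric

/-! ### The components of the metric in a chart -/

/-- The Gram matrix of a nondegenerate symmetric form on the image of the standard basis under an
isomorphism is invertible. -/
theorem isUnit_det_of_nondegenerate {V : Type*} [AddCommGroup V] [Module ℝ V]
    (B : MultilinearMap ℝ (fun _ : Fin 2 => V) ℝ) (hB : ∀ v w, B ![v, w] = B ![w, v])
    (hB' : ∀ v, (∀ w, B ![v, w] = 0) → v = 0) (f : Coord →ₗ[ℝ] V) (hf : Function.Bijective f) :
    IsUnit (Matrix.of fun a b => B ![f (EuclideanSpace.single a (1 : ℝ)),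
      f (EuclideanSpace.single b (1 : ℝ))]).det := by
  rw [isUnit_iff_ne_zero]
  intro h0
  obtain ⟨v, hv, hv0⟩ := Matrix.exists_mulVec_eq_zero_iff.mpr h0
  set v' : Coord := WithLp.toLp 2 v
  have hv' : v' = ∑ a, v a • (EuclideanSpace.single a (1 : ℝ) : Coord) := by
    have h2 := ((EuclideanSpace.basisFun (Fin 4) ℝ).sum_repr v').symm
    simpa using h2
  have h1 : ∀ u w, B.toLinearMap ![u, 0] 1 w = B ![u, w] := fun u w => by
    rw [MultilinearMap.toLinearMap_apply]
    congr 1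
    funext i
    fin_cases i <;> rfl
  have hl : B.toLinearMap ![f v', 0] 1 ∘ₗ f = 0 := by
    refine (EuclideanSpace.basisFun (Fin 4) ℝ).toBasis.ext fun b => ?_
    rw [OrthonormalBasis.coe_toBasis, EuclideanSpace.basisFun_apply, LinearMap.comp_apply, h1, hB,
      ← h1, hv', LinearMap.zero_apply]
    simp only [map_sum, map_smul]
    simp only [h1, smul_eq_mul]
    refine Eq.trans ?_ (congrFun hv0 b)
    rw [Matrix.mulVec, dotProduct]
    refine Finset.sum_congr rfl fun a _ => ?_
    exact mul_comm _ _
  have h : f v' = 0 := hB' _ fun w => by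
    obtain ⟨u, rfl⟩ := hf.2 w
    rw [← h1]
    exact LinearMap.congr_fun hl u
  have h2 : v' = 0 := hf.1 (h.trans (map_zero f).symm)
  exact hv (by simpa [v'] using congrArg (fun w : Coord => w.ofLp) h2)

section Manifold

variable {M : Type*} [TopologicalSpace M] [ChartedSpace Coord M]

theorem mfderiv_symm_bijective [IsManifold (𝓡 4) ∞ M] {e : OpenPartialHomeomorph M Coord}
    (he : e ∈ IsManifold.maximalAtlas (𝓡 4) ∞ M) {y : Coord} (hy : y ∈ e.target) :
    Function.Bijective (mfderiv 𝓘(ℝ, Coord) (𝓡 4) e.symm y) := by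
  have he' : e ∈ IsManifold.maximalAtlas (𝓡 4) 1 M :=
    IsManifold.maximalAtlas_subset_of_le (by exact_mod_cast le_top) he
  have hd : e.MDifferentiable (𝓡 4) 𝓘(ℝ, Coord) :=
    ⟨fun x hx => (mdifferentiableAt_of_mem_maximalAtlas he' hx).mdifferentiableWithinAt,
      fun x hx => (mdifferentiableAt_symm_of_mem_maximalAtlas he' hx).mdifferentiableWithinAt⟩
  exact hd.symm.mfderiv_bijective hy

variable {g : TensorField M 2}

theorem IsPseudoRiemannianMetric.comp_symm (hg : IsPseudoRiemannianMetric g)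
    (e : OpenPartialHomeomorph M Coord) (y : Coord) (a b : Fin 4) :
    g.comp e y ![a, b] = g.comp e y ![b, a] := by
  have h := hg.symm (e.symm y) (fun i => coordVec e y (![a, b] i)) (Equiv.swap 0 1)
  rw [TensorField.comp, TensorField.comp, ← h]
  congr 1
  funext i
  fin_cases i <;> rfl

/-- The component matrix of a metric in a chart is invertible, since the coordinate vectors form a
basis of the tangent space. -/
theorem IsPseudoRiemannianMetric.comp_nondeg [IsManifold (𝓡 4) ∞ M]
    (hg : IsPseudoRiemannianMetric g) {e : OpenPartialHomeomorph M Coord}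
    (he : e ∈ IsManifold.maximalAtlas (𝓡 4) ∞ M) {y : Coord} (hy : y ∈ e.target) :
    IsUnit (Matrix.of fun a b => g.comp e y ![a, b]).det := by
  have h := isUnit_det_of_nondegenerate (V := TangentSpace (𝓡 4) (e.symm y)) (g (e.symm y))
    (fun v w => by
      rw [← hg.symm (e.symm y) ![v, w] (Equiv.swap 0 1)]
      congr 1
      funext i
      fin_cases i <;> rfl)
    (hg.nondeg (e.symm y)) (mfderiv 𝓘(ℝ, Coord) (𝓡 4) e.symm y).toLinearMap
    (mfderiv_symm_bijective he hy)
  convert h using 3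
  funext a b
  rw [TensorField.comp]
  congr 1
  funext i
  fin_cases i <;> rfl

theorem IsPseudoRiemannianMetric.isCurvedMetric [IsManifold (𝓡 4) ∞ M]
    (hg : IsPseudoRiemannianMetric g) {Λ : ℝ} (hK : HasConstantCurvature g Λ)
    {e : OpenPartialHomeomorph M Coord} (he : e ∈ IsManifold.maximalAtlas (𝓡 4) ∞ M) :
    IsCurvedMetric e.target (g.comp e) Λ where
  isOpen := e.open_target
  smooth := hg.smooth e he
  symm y _ := hg.comp_symm e y
  nondeg _ hy := hg.comp_nondeg he hy
  curv := hK e he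

end Manifold

/-! ### Potentials of closed one-forms -/

namespace IsCurvedMetric

open SmoothFun

variable {U : Set Coord} {G : Comp 2} {Λ : ℝ}

theorem cov_zero_apply (G : Comp 2) (χ : Comp 0) (y : Coord) (a : Fin 4) :
    cov G χ y ![a] = pd a (fun z => χ z ![]) y := by
  have e : Fin.tail ![a] = ![] := Subsingleton.elim _ _
  simp [cov, e]

/-- The Poincaré lemma: a smooth one-form with symmetric covariant derivative on a convex open set
is a gradient. -/
theorem exists_potential (hG : IsCurvedMetric U G Λ) (hU : Convex ℝ U) {X : Comp 1}
    {t : Tens (SmoothFun U) 1} (hX : Rep U X t) (ht : hG.alg.ext₁ t = 0) :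
    ∃ χ : Comp 0, χ.SmoothOn U ∧ Comp.EqOn U X (cov G χ) := by
  have hsm := hX.smoothOn
  have hpd : ∀ y ∈ U, ∀ a b, pd a (fun z => X z ![b]) y = pd b (fun z => X z ![a]) y := by
    intro y hy a b
    have h1 : ∀ a b, pd a (fun z => X z ![b]) y = ev ⟨y, hy⟩ (hG.alg.D a (t ![b])) := fun a b =>
      (ev_deriv hG.isOpen a (t ![b]) (fun z => hX z _) ⟨y, hy⟩).symm
    rw [h1, h1]
    congr 1
    have h2 := congrFun ht ![a, b]
    have h3 : hG.alg.cov t ![a, b] - hG.alg.cov t ![b, a] = 0 := h2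
    have h4 : ∀ a b, MetricAlgebra.act (hG.alg.Γ a) t ![b] = ∑ d, hG.alg.Γ a d b * t ![d] := by
      intro a b
      rw [MetricAlgebra.act_cons, MetricAlgebra.act_apply]
      simp
    rw [MetricAlgebra.cov_cons, MetricAlgebra.cov_cons, h4, h4] at h3
    simp only [hG.alg.Γ_symm _ a b] at h3
    exact sub_eq_zero.mp (by rw [← h3]; abel)
  set α : Coord → Coord →L[ℝ] ℝ := fun y =>
    ∑ a : Fin 4, X y ![a] • (EuclideanSpace.proj a : Coord →L[ℝ] ℝ) with hα
  have hαd : ContDiffOn ℝ ∞ α U :=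
    ContDiffOn.sum fun a _ => (hsm ![a]).smul contDiffOn_const
  have hd : ∀ y ∈ U, ∀ a, DifferentiableAt ℝ (fun z => X z ![a]) y := fun y hy a =>
    differentiableAt_of_smooth hG.isOpen (hsm ![a]) hy
  have hαf : ∀ y ∈ U, ∀ u v : Coord, fderiv ℝ α y u v =
      ∑ a, ∑ b, u b * v a * pd b (fun z => X z ![a]) y := by
    intro y hy u v
    have h1 : HasFDerivAt α (∑ a : Fin 4, (fderiv ℝ (fun z => X z ![a]) y).smulRight
        (EuclideanSpace.proj a : Coord →L[ℝ] ℝ)) y :=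
      HasFDerivAt.fun_sum fun a _ => (hd y hy a).hasFDerivAt.smul_const
        (EuclideanSpace.proj a : Coord →L[ℝ] ℝ)
    rw [h1.fderiv]
    have hu : u = ∑ b, u b • (EuclideanSpace.single b (1 : ℝ) : Coord) := by
      simpa using ((EuclideanSpace.basisFun (Fin 4) ℝ).sum_repr u).symm
    have h2 : ∀ a, fderiv ℝ (fun z => X z ![a]) y u = ∑ b, u b * pd b (fun z => X z ![a]) y :=
      fun a => by
        conv_lhs => rw [hu]
        simp only [map_sum, map_smul, smul_eq_mul, pd]
    simp only [sum_apply, ContinuousLinearMap.smulRight_apply,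
      smul_apply, smul_eq_mul, h2, Finset.sum_mul]
    refine Finset.sum_congr rfl fun a _ => Finset.sum_congr rfl fun b _ => ?_
    change u b * pd b (fun z => X z ![a]) y * v a = _
    ring
  obtain ⟨f, hf⟩ := hU.exists_forall_hasFDerivAt_of_fderiv_symmetric hG.isOpen
    (hαd.differentiableOn (by simp)) fun y hy u v => by
      rw [hαf y hy, hαf y hy, Finset.sum_comm]
      refine Finset.sum_congr rfl fun a _ => Finset.sum_congr rfl fun b _ => ?_
      rw [hpd y hy a b]
      ring
  refine ⟨fun y _ => f y, fun I => ?_, fun y hy I => ?_⟩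
  · refine (contDiffOn_infty_iff_fderiv_of_isOpen hG.isOpen).mpr
      ⟨fun y hy => (hf y hy).differentiableAt.differentiableWithinAt, ?_⟩
    exact hαd.congr fun y hy => (hf y hy).fderiv
  · obtain ⟨a, rfl⟩ : ∃ a, I = ![a] := ⟨I 0, by funext i; fin_cases i; rfl⟩
    rw [cov_zero_apply, pd, (hf y hy).fderiv, hα]
    simp only [sum_apply, smul_apply, smul_eq_mul]
    simp

end IsCurvedMetric

/-! ### The detour complex in coordinates -/

namespace RepT

variable {U : Set Coord} {k : ℕ} {Ξ : TractorForm k} {ξ : TractorArray (SmoothFun U) k}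

theorem isSection (h : RepT U Ξ ξ) (hs : ∀ a b J, ξ.bot (Matrix.vecCons a (Matrix.vecCons b J)) =
    ξ.bot (Matrix.vecCons b (Matrix.vecCons a J))) : Ξ.IsSection U where
  top := h.top.smoothOn
  mid := h.mid.smoothOn
  bot := h.bot.smoothOn
  symm y hy a b J := by rw [h.bot ⟨y, hy⟩, h.bot ⟨y, hy⟩, hs]

theorem bot_symm (h : RepT U Ξ ξ) (hs : Ξ.IsSection U) (a b : Fin 4) (J : Fin k → Fin 4) :
    ξ.bot (Matrix.vecCons a (Matrix.vecCons b J)) = ξ.bot (Matrix.vecCons b (Matrix.vecCons a J)) :=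
  SmoothFun.ext_ev fun y => by rw [← h.bot y, ← h.bot y, hs.symm y y.2]

theorem kostant₁_zeroOn_iff {Ξ : TractorForm 1} {ξ : TractorArray (SmoothFun U) 1}
    (h : RepT U Ξ ξ) : (kostant₁ Ξ).ZeroOn U ↔
      ξ.top = 0 ∧ ∀ a b, ξ.mid ![b, a] + ξ.mid ![a, b] = 0 := by
  have h1 : Rep U (kostant₁ Ξ).mid ξ.top := fun y I => by
    have e : ![I 0] = I := by funext i; fin_cases i; rfl
    simp only [kostant₁, e, h.top y]
  have h2 : Rep U (kostant₁ Ξ).bot fun I => ξ.mid ![I 1, I 0] + ξ.mid ![I 0, I 1] := fun y I => by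
    simp only [kostant₁, map_add, h.mid y]
  rw [TractorForm.ZeroOn, h1.zeroOn_iff, h2.zeroOn_iff]
  exact ⟨fun h => ⟨h.2.1, fun a b => congrFun h.2.2 ![a, b]⟩,
    fun h => ⟨fun _ _ _ => rfl, h.1, funext fun I => h.2 (I 0) (I 1)⟩⟩

theorem kostant₂_zeroOn_iff {F : TractorForm 2} {f : TractorArray (SmoothFun U) 2}
    (h : RepT U F f) : (kostant₂ F).ZeroOn U ↔
      f.top = 0 ∧ ∀ a b c, f.mid ![b, a, c] + f.mid ![a, b, c] = 0 := by
  have h1 : Rep U (kostant₂ F).mid f.top := fun y I => by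
    have e : ![I 0, I 1] = I := by funext i; fin_cases i <;> rfl
    simp only [kostant₂, e, h.top y]
  have h2 : Rep U (kostant₂ F).bot fun I => f.mid ![I 1, I 0, I 2] + f.mid ![I 0, I 1, I 2] :=
    fun y I => by simp only [kostant₂, map_add, h.mid y]
  rw [TractorForm.ZeroOn, h1.zeroOn_iff, h2.zeroOn_iff]
  exact ⟨fun h => ⟨h.2.1, fun a b c => congrFun h.2.2 ![a, b, c]⟩,
    fun h => ⟨fun _ _ _ => rfl, h.1, funext fun I => h.2 (I 0) (I 1) (I 2)⟩⟩

end RepT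

namespace IsCurvedMetric

open SmoothFun

variable {U : Set Coord} {G : Comp 2} {Λ : ℝ} (hG : IsCurvedMetric U G Λ)
include hG

section Parameter

variable {σ : Comp 0} (hσ : σ.SmoothOn U)
include hσ

theorem isSection_split₀ : (split₀ G σ).IsSection U := by
  obtain ⟨t, ht⟩ := Rep.exists_of_smoothOn hσ
  refine (hG.repT_split₀ ht).isSection fun a b J => ?_
  rw [Subsingleton.elim J ![]]
  exact hG.alg.tsplit₀_bot_symm t a b

/-- The splitting operator on scalars is characterised by the Kostant codifferential. -/
theorem eqOn_split₀_iff {s : TractorForm 0} (hs : s.IsSection U) : s.EqOn U (split₀ G σ) ↔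
    Comp.EqOn U s.top σ ∧ (kostant₁ (tractorCov G s)).ZeroOn U := by
  obtain ⟨t, ht⟩ := Rep.exists_of_smoothOn hσ
  obtain ⟨ξ, hξ⟩ := RepT.exists_of_isSection hs
  rw [hξ.eqOn_iff (hG.repT_split₀ ht), hξ.top.eqOn_iff ht,
    (hG.repT_tractorCov hξ).kostant₁_zeroOn_iff]
  exact hG.alg.eq_tsplit₀_iff (fun a b => hξ.bot_symm hs a b ![]) t

theorem bggOp_eq : Comp.EqOn U (bggOp G σ) fun y I => 1 / 2 * gaugeOp G Λ σ y I := by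
  obtain ⟨t, ht⟩ := Rep.exists_of_smoothOn hσ
  exact ((hG.rep_bggOp ht).eqOn_iff ((hG.rep_gaugeOp ht).smul (1 / 2))).mpr rfl

theorem bggOp_eq_schouten : Comp.EqOn U (bggOp G σ) fun y I => 1 / 2 *
    (symm3 (cov G (cov G (cov G σ))) y I
      + 4 * sym3 (fun a b c => schouten G y ![a, b] * cov G σ y ![c]) (I 0) (I 1) (I 2)
      + 2 * (symm3 (cov G (schouten G)) y I * σ y ![])) := fun y hy I => by
  rw [hG.bggOp_eq hσ y hy I]
  simp only [gaugeOp, symm3, sym3, gSym, hG.cov_schouten hy, hG.schouten_eq hy]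
  ring

theorem tractorCov_split₀ : (tractorCov G (split₀ G σ)).EqOn U (split₁ (bggOp G σ)) := by
  obtain ⟨t, ht⟩ := Rep.exists_of_smoothOn hσ
  exact ((hG.repT_tractorCov_split₀ ht).eqOn_iff (RepT.split₁ (hG.rep_bggOp ht))).mpr rfl

/-- The factor `½` of the first operator is absorbed in the parameter. -/
theorem rep_bggOp_gaugeOp : ∃ t, Rep U (bggOp G σ) (hG.alg.gaugeOp t) := by
  obtain ⟨t, ht⟩ := Rep.exists_of_smoothOn hσ
  refine ⟨(1 / 2 : ℝ) • t, ?_⟩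
  rw [hG.alg.gaugeOp_smul]
  exact hG.rep_bggOp ht

theorem extD_split₁_bggOp : (extD G (split₁ (bggOp G σ))).ZeroOn U := by
  obtain ⟨t, ht⟩ := hG.rep_bggOp_gaugeOp hσ
  rw [(hG.repT_extD (RepT.split₁ ht)).zeroOn_iff, hG.alg.textD_tsplit₁ (hG.alg.sym_gaugeOp t),
    hG.alg.curl_gaugeOp]
  exact ⟨rfl, rfl, rfl⟩

theorem detourOp_split₁_bggOp : (detourOp G (split₁ (bggOp G σ))).ZeroOn U := by
  obtain ⟨t, ht⟩ := hG.rep_bggOp_gaugeOp hσ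
  rw [(hG.repT_detourOp_split₁ ht (hG.alg.sym_gaugeOp t)).zeroOn_iff, hG.alg.detTractor_gaugeOp]
  exact ⟨rfl, rfl, rfl⟩

theorem bggDetour_bggOp : Comp.ZeroOn U (bggDetour G (bggOp G σ)) := by
  obtain ⟨t, ht⟩ := hG.rep_bggOp_gaugeOp hσ
  rw [(hG.rep_bggDetour ht (hG.alg.sym_gaugeOp t)).zeroOn_iff, hG.alg.det_gaugeOp, neg_zero]

end Parameter

section Potential

variable {ψ : Comp 3} {t : Tens (SmoothFun U) 3} (hψ : Rep U ψ t) (ht : ConstCurvAlgebra.Sym t)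
include hψ ht

omit hG in
theorem isSection_split₁ : (split₁ ψ).IsSection U :=
  (RepT.split₁ hψ).isSection fun a b J => by
    obtain ⟨c, rfl⟩ : ∃ c, J = ![c] := ⟨J 0, by funext i; fin_cases i; rfl⟩
    exact ht.2 c a b

/-- The splitting operator on symmetric tensors is characterised by the Kostant codifferential. -/
theorem eqOn_split₁_iff {Ξ : TractorForm 1} (hΞ : Ξ.IsSection U) : Ξ.EqOn U (split₁ ψ) ↔
    (kostant₁ Ξ).ZeroOn U ∧ Comp.EqOn U (proj Ξ) ψ ∧ (kostant₂ (extD G Ξ)).ZeroOn U := by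
  obtain ⟨ξ, hξ⟩ := RepT.exists_of_isSection hΞ
  have hp : Rep U (proj Ξ) (ConstCurvAlgebra.symm3 ξ.bot) := hξ.bot.symm3
  rw [hξ.eqOn_iff (RepT.split₁ hψ), hξ.kostant₁_zeroOn_iff, hp.eqOn_iff hψ,
    (hG.repT_extD hξ).kostant₂_zeroOn_iff]
  exact hG.alg.eq_tsplit₁_iff (fun a b c => hξ.bot_symm hΞ a b ![c]) ht

theorem extD_split₁ : (extD G (split₁ ψ)).EqOn U
    { top := fun _ _ => 0
      mid := fun _ _ => 0
      bot := fun y I =>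
        cov G ψ y ![I 2, I 3, I 0, I 1] - cov G ψ y ![I 3, I 2, I 0, I 1] } := by
  have h := hG.repT_extD (RepT.split₁ hψ)
  rw [hG.alg.textD_tsplit₁ ht] at h
  refine (h.eqOn_iff ⟨Rep.zero, Rep.zero, fun y I => ?_⟩).mpr rfl
  change cov G ψ y ![I 2, I 3, I 0, I 1] - cov G ψ y ![I 3, I 2, I 0, I 1] =
    ev y (hG.alg.curl t ![I 2, I 3, I 0, I 1])
  rw [ConstCurvAlgebra.curl_apply, map_sub, hG.rep_cov hψ y, hG.rep_cov hψ y]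

theorem detourOp_split₁ : (detourOp G (split₁ ψ)).EqOn U
    { top := fun _ _ => 0
      mid := fun y I => div G ψ y ![I 1, I 0] - cov G (tr G ψ) y ![I 1, I 0]
      bot := fun y I =>
        -(lap G ψ y ![I 2, I 0, I 1] - cov G (div G ψ) y ![I 2, I 0, I 1]
          + 2 * Λ / 3 * sym2 (fun a b => G y ![I 2, a] * tr G ψ y ![b]) (I 0) (I 1)
          - 5 * Λ / 3 * ψ y ![I 2, I 0, I 1]) } := by
  refine ((hG.repT_detourOp_split₁ hψ ht).eqOn_iff ⟨Rep.zero, fun y I => ?_, fun y I => ?_⟩).mpr rfl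
  · simp only [ConstCurvAlgebra.detTractor, ConstCurvAlgebra.tp, ConstCurvAlgebra.detMid,
      Pi.sub_apply, map_sub, hG.rep_div hψ y, hG.rep_cov (hG.rep_tr hψ) y]
  · have e : ev y (hG.alg.detBot t ![I 2, I 0, I 1]) =
        ev y (hG.alg.lp t ![I 2, I 0, I 1] - hG.alg.cov (hG.alg.dv t) ![I 2, I 0, I 1] +
          (Λ / 3) • (hG.alg.g (I 2) (I 0) * hG.alg.tr t ![I 1] +
            hG.alg.g (I 2) (I 1) * hG.alg.tr t ![I 0]) - (5 * Λ / 3) • t ![I 2, I 0, I 1]) := rfl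
    simp only [ConstCurvAlgebra.detTractor, map_neg]
    rw [e]
    simp only [map_sub, map_add, map_smul, map_mul, smul_eq_mul, hG.rep_lap hψ y,
      hG.rep_cov (hG.rep_div hψ) y, hG.rep_tr hψ y, hψ y, hG.ev_g, sym2]
    ring

theorem bggDetour_eq : Comp.EqOn U (bggDetour G ψ) fun y I =>
    -(lap G ψ y I - symm3 (cov G (div G ψ)) y I + 2 * Λ / 3 * gSym G (tr G ψ) y I
      - 5 * Λ / 3 * ψ y I) := by
  refine ((hG.rep_bggDetour hψ ht).eqOn_iff fun y I => ?_).mpr rfl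
  rw [hG.alg.det_eq ht]
  simp only [Pi.neg_apply, Pi.sub_apply, Pi.add_apply, Pi.smul_apply, map_neg, map_sub, map_add,
    map_smul, smul_eq_mul, hG.rep_lap hψ y, (hG.rep_cov (hG.rep_div hψ)).symm3 y,
    hG.rep_gSym (hG.rep_tr hψ) y, hψ y, hG.L_eq]

theorem bggOpAdj_bggDetour : Comp.ZeroOn U (bggOpAdj G (bggDetour G ψ)) := by
  rw [(hG.rep_bggOpAdj (hG.rep_bggDetour hψ ht)).zeroOn_iff, hG.alg.adj_neg, hG.alg.adj_det ht,
    neg_zero]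

omit ht in
theorem divObs_eq_zero_iff : hG.alg.divObs t = 0 ↔ ∀ y ∈ U, ∀ a b, div G ψ y ![a, b] =
    sym2 (fun a b => cov G (tr G ψ) y ![a, b]) a b := by
  have h : ∀ (y : U) a b, ev y (hG.alg.divObs t ![a, b]) = div G ψ y ![a, b] -
      sym2 (fun a b => cov G (tr G ψ) y ![a, b]) a b := fun y a b => by
    rw [ConstCurvAlgebra.divObs_apply]
    simp only [map_sub, map_smul, map_add, smul_eq_mul, sym2, hG.rep_div hψ y,
      hG.rep_cov (hG.rep_tr hψ) y]
    ring
  refine ⟨fun h0 y hy a b => ?_, fun h0 => ConstCurvAlgebra.tens2_ext fun a b => ext_ev fun y => ?_⟩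
  · rw [← sub_eq_zero, ← h ⟨y, hy⟩, h0]
    exact map_zero _
  · rw [h, h0 y y.2, sub_self]
    exact (map_zero _).symm

omit ht in
theorem ext₁_tr_eq_zero_iff : hG.alg.ext₁ (hG.alg.tr t) = 0 ↔ ∀ y ∈ U, ∀ a b,
    cov G (tr G ψ) y ![a, b] = cov G (tr G ψ) y ![b, a] := by
  have h : ∀ (y : U) a b, ev y (hG.alg.ext₁ (hG.alg.tr t) ![a, b]) =
      cov G (tr G ψ) y ![a, b] - cov G (tr G ψ) y ![b, a] := fun y a b => by
    rw [hG.rep_cov (hG.rep_tr hψ) y, hG.rep_cov (hG.rep_tr hψ) y, ← map_sub]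
    rfl
  refine ⟨fun h0 y hy a b => ?_, fun h0 => ConstCurvAlgebra.tens2_ext fun a b => ext_ev fun y => ?_⟩
  · rw [← sub_eq_zero, ← h ⟨y, hy⟩, h0]
    exact map_zero _
  · rw [h, h0 y y.2, sub_self]
    exact (map_zero _).symm

theorem detourOp_mid_zeroOn_iff :
    Comp.ZeroOn U (detourOp G (split₁ ψ)).mid ↔ hG.alg.detMid t = 0 := by
  rw [(hG.repT_detourOp_split₁ hψ ht).mid.zeroOn_iff]
  exact hG.alg.detMid_eq_zero_of_tp

theorem detourOp_zeroOn_iff :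
    (detourOp G (split₁ ψ)).ZeroOn U ↔ hG.alg.detMid t = 0 ∧ hG.alg.detBot t = 0 := by
  rw [(hG.repT_detourOp_split₁ hψ ht).zeroOn_iff]
  exact hG.alg.detTractor_eq_zero_iff

theorem detourOp_eqOn_split₁_bggDetour (h : Comp.ZeroOn U (detourOp G (split₁ ψ)).mid) :
    (detourOp G (split₁ ψ)).EqOn U (split₁ (bggDetour G ψ)) := by
  rw [hG.detourOp_mid_zeroOn_iff hψ ht] at h
  exact ((hG.repT_detourOp_split₁ hψ ht).eqOn_iff (RepT.split₁ (hG.rep_bggDetour hψ ht))).mpr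
    (hG.alg.detTractor_eq ht h)

omit ht in
theorem tr_eqOn_iff {χ : Comp 0} {u : Tens (SmoothFun U) 0} (hχ : Rep U χ u) :
    Comp.EqOn U (tr G ψ) (fun y I => -(6 / Λ) * cov G χ y I) ↔
      hG.alg.tr t = (-(6 / Λ)) • hG.alg.cov u :=
  (hG.rep_tr hψ).eqOn_iff ((hG.rep_cov hχ).smul (-(6 / Λ)))

/-- The auxiliary scalar of the partially massless theory is a potential of the trace. -/
theorem exists_auxiliary_scalar (hΛ : Λ ≠ 0) (hU : Convex ℝ U)
    (h : Comp.ZeroOn U (detourOp G (split₁ ψ)).mid) : ∃ χ : Comp 0, χ.SmoothOn U ∧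
      Comp.EqOn U (tr G ψ) (fun y I => -(6 / Λ) * cov G χ y I) ∧
      ((detourOp G (split₁ ψ)).ZeroOn U → PMSystemOn U G Λ (traceAdjustInv G ψ) χ) := by
  rw [hG.detourOp_mid_zeroOn_iff hψ ht] at h
  have h1 := ((hG.alg.detMid_eq_zero_iff ht).mp h).2
  have h2 : hG.alg.ext₁ ((-(Λ / 6)) • hG.alg.tr t) = 0 := by
    rw [hG.alg.ext₁_smul, h1, smul_zero]
  obtain ⟨χ, hχ, hχ'⟩ := hG.exists_potential hU ((hG.rep_tr hψ).smul (-(Λ / 6))) h2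
  obtain ⟨u, hu⟩ := Rep.exists_of_smoothOn hχ
  have h3 : Comp.EqOn U (tr G ψ) (fun y I => -(6 / Λ) * cov G χ y I) := fun y hy I => by
    change _ = -(6 / Λ) * cov G χ y I
    rw [← hχ' y hy I]
    field_simp
  refine ⟨χ, hχ, h3, fun h4 => ?_⟩
  have hi := hG.rep_traceAdjustInv hψ
  rw [PMSystemOn, (hG.rep_pmEq hi hu).zeroOn_iff, (hG.rep_pmAux hi hu).zeroOn_iff,
    hG.alg.pmSystem_iff ht u hΛ, hG.alg.pmScal_eq_zero_iff hΛ]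
  exact ⟨(hG.detourOp_zeroOn_iff hψ ht).mp h4, (hG.tr_eqOn_iff hψ hu).mp h3⟩

omit ht in
theorem traceAdjust_traceAdjustInv : Comp.EqOn U (traceAdjust G (traceAdjustInv G ψ)) ψ :=
  ((hG.rep_traceAdjust (hG.rep_traceAdjustInv hψ)).eqOn_iff hψ).mpr (hG.alg.traceAdj_traceAdjInv t)

omit ht in
theorem traceAdjustInv_traceAdjust : Comp.EqOn U (traceAdjustInv G (traceAdjust G ψ)) ψ :=
  ((hG.rep_traceAdjustInv (hG.rep_traceAdjust hψ)).eqOn_iff hψ).mpr (hG.alg.traceAdjInv_traceAdj t)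

end Potential

end IsCurvedMetric

/-! ### The partially massless theory in coordinates -/

namespace IsCurvedMetric

open SmoothFun

variable {U : Set Coord} {G : Comp 2} {Λ : ℝ} (hG : IsCurvedMetric U G Λ)
include hG

section Gauge

variable {ς : Comp 0} (hς : ς.SmoothOn U)
include hς

theorem traceAdjust_pmGaugeField :
    Comp.EqOn U (traceAdjust G (pmGaugeField G Λ ς)) (gaugeOp G Λ ς) := by
  obtain ⟨s, hs⟩ := Rep.exists_of_smoothOn hς
  exact ((hG.rep_traceAdjust (hG.rep_pmGaugeField hs)).eqOn_iff (hG.rep_gaugeOp hs)).mpr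
    (hG.alg.traceAdj_pmGF s)

/-- The operators of the theory are additive and annihilate pure gauge fields. -/
theorem gauge_invariance (hΛ : Λ ≠ 0) {φ : Comp 3} {χ : Comp 0} (hφ : φ.SmoothOn U)
    (hχ : χ.SmoothOn U) :
    Comp.EqOn U (pmEq G Λ (φ + pmGaugeField G Λ ς) (χ + pmGaugeScalar G Λ ς)) (pmEq G Λ φ χ) ∧
    Comp.EqOn U (pmAux G Λ (φ + pmGaugeField G Λ ς) (χ + pmGaugeScalar G Λ ς))
      (pmAux G Λ φ χ) ∧
    Comp.EqOn U (pmDivConstraint G Λ (φ + pmGaugeField G Λ ς) (χ + pmGaugeScalar G Λ ς))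
      (pmDivConstraint G Λ φ χ) ∧
    Comp.EqOn U (pmScalarConstraint G Λ (φ + pmGaugeField G Λ ς) (χ + pmGaugeScalar G Λ ς))
      (pmScalarConstraint G Λ φ χ) := by
  obtain ⟨s, hs⟩ := Rep.exists_of_smoothOn hς
  obtain ⟨f, hf⟩ := Rep.exists_of_smoothOn hφ
  obtain ⟨u, hu⟩ := Rep.exists_of_smoothOn hχ
  have hf' := hf.add (hG.rep_pmGaugeField hs)
  have hu' := hu.add (hG.rep_pmGaugeScalar hs)
  have h := hG.alg.pmSystem_gauge hΛ s
  refine ⟨((hG.rep_pmEq hf' hu').eqOn_iff (hG.rep_pmEq hf hu)).mpr ?_,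
    ((hG.rep_pmAux hf' hu').eqOn_iff (hG.rep_pmAux hf hu)).mpr ?_,
    ((hG.rep_pmDivConstraint hf' hu').eqOn_iff (hG.rep_pmDivConstraint hf hu)).mpr ?_,
    ((hG.rep_pmScalarConstraint hf' hu').eqOn_iff (hG.rep_pmScalarConstraint hf hu)).mpr ?_⟩
  · exact (hG.alg.pmEq_add _ _ _ _).trans (by rw [h.1]; exact add_zero _)
  · exact (hG.alg.pmAux_add _ _ _ _).trans (by rw [h.2]; exact add_zero _)
  · exact (hG.alg.pmDiv_add _ _ _ _).trans (by rw [hG.alg.pmDiv_gauge hΛ]; exact add_zero _)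
  · exact (hG.alg.pmScal_add _ _ _ _).trans (by rw [hG.alg.pmScal_gauge]; exact add_zero _)

end Gauge

section Field

variable {φ : Comp 3} {f : Tens (SmoothFun U) 3} (hφ : Rep U φ f) (hf : ConstCurvAlgebra.Sym f)
  {χ : Comp 0} {u : Tens (SmoothFun U) 0} (hχ : Rep U χ u)
include hφ hχ

theorem pmScalarConstraint_zeroOn_iff (hΛ : Λ ≠ 0) : Comp.ZeroOn U (pmScalarConstraint G Λ φ χ) ↔
    Comp.EqOn U (tr G (traceAdjust G φ)) (fun y I => -(6 / Λ) * cov G χ y I) := by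
  rw [hG.tr_eqOn_iff (hG.rep_traceAdjust hφ) hχ, (hG.rep_pmScalarConstraint hφ hχ).zeroOn_iff]
  have h := hG.alg.pmScal_eq_zero_iff hΛ (hG.alg.traceAdj f) u
  rwa [hG.alg.traceAdjInv_traceAdj] at h

include hf

theorem constraints_of_pmSystemOn (hΛ : Λ ≠ 0) (h : PMSystemOn U G Λ φ χ) :
    Comp.ZeroOn U (pmDivConstraint G Λ φ χ) ∧ Comp.ZeroOn U (pmScalarConstraint G Λ φ χ) := by
  rw [PMSystemOn, (hG.rep_pmEq hφ hχ).zeroOn_iff, (hG.rep_pmAux hφ hχ).zeroOn_iff] at h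
  rw [(hG.rep_pmDivConstraint hφ hχ).zeroOn_iff, (hG.rep_pmScalarConstraint hφ hχ).zeroOn_iff]
  have hp := hG.alg.sym_traceAdj hf
  rw [← hG.alg.traceAdjInv_traceAdj f] at h ⊢
  have h2 := hG.alg.constraints_of_pmSystem hp u hΛ h.1 h.2
  exact ⟨(hG.alg.pmDiv_eq_zero_iff hp u hΛ h2.1).mpr h2.2, h2.1⟩

theorem pmDivConstraint_zeroOn_iff (hΛ : Λ ≠ 0)
    (h : Comp.ZeroOn U (pmScalarConstraint G Λ φ χ)) :
    Comp.ZeroOn U (pmDivConstraint G Λ φ χ) ↔ ∀ y ∈ U, ∀ a b,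
      div G (traceAdjust G φ) y ![a, b] =
        sym2 (fun a b => cov G (tr G (traceAdjust G φ)) y ![a, b]) a b := by
  rw [(hG.rep_pmScalarConstraint hφ hχ).zeroOn_iff] at h
  rw [(hG.rep_pmDivConstraint hφ hχ).zeroOn_iff,
    ← hG.divObs_eq_zero_iff (hG.rep_traceAdjust hφ)]
  have hp := hG.alg.sym_traceAdj hf
  have h2 := hG.alg.pmDiv_eq_zero_iff hp u hΛ
  rw [hG.alg.traceAdjInv_traceAdj] at h2
  exact h2 h

theorem pmEq_eqOn_neg_bggDetour (hΛ : Λ ≠ 0) (h : Comp.ZeroOn U (pmScalarConstraint G Λ φ χ))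
    (h' : Comp.ZeroOn U (pmDivConstraint G Λ φ χ)) :
    Comp.EqOn U (pmEq G Λ φ χ) (fun y I => -bggDetour G (traceAdjust G φ) y I) ∧
      Comp.ZeroOn U (pmAux G Λ φ χ) := by
  rw [hG.pmDivConstraint_zeroOn_iff hφ hf hχ hΛ h,
    ← hG.divObs_eq_zero_iff (hG.rep_traceAdjust hφ)] at h'
  rw [(hG.rep_pmScalarConstraint hφ hχ).zeroOn_iff] at h
  have hp := hG.alg.sym_traceAdj hf
  have h2 := hG.alg.pmEq_eq_det hp u hΛ
  rw [hG.alg.traceAdjInv_traceAdj] at h2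
  refine ⟨((hG.rep_pmEq hφ hχ).eqOn_iff (hG.rep_bggDetour (hG.rep_traceAdjust hφ) hp).neg).mpr ?_,
    (hG.rep_pmAux hφ hχ).zeroOn_iff.mpr ?_⟩
  · rw [h2 h h', neg_neg]
  · rw [← ConstCurvAlgebra.dv_pmScal, h, hG.alg.dv_zero]

theorem pmSystemOn_iff (hΛ : Λ ≠ 0) : PMSystemOn U G Λ φ χ ↔
    (detourOp G (split₁ (traceAdjust G φ))).ZeroOn U ∧
      Comp.EqOn U (tr G (traceAdjust G φ)) (fun y I => -(6 / Λ) * cov G χ y I) := by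
  have hp := hG.alg.sym_traceAdj hf
  rw [← hG.pmScalarConstraint_zeroOn_iff hφ hχ hΛ, PMSystemOn, (hG.rep_pmEq hφ hχ).zeroOn_iff,
    (hG.rep_pmAux hφ hχ).zeroOn_iff, (hG.rep_pmScalarConstraint hφ hχ).zeroOn_iff,
    hG.detourOp_zeroOn_iff (hG.rep_traceAdjust hφ) hp]
  have h2 := hG.alg.pmSystem_iff hp u hΛ
  rwa [hG.alg.traceAdjInv_traceAdj] at h2

end Field

end IsCurvedMetric

end PMSpinThree

end

theorem mainTheorem6 {M : Type*} [TopologicalSpace M] [ChartedSpace Coord M]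
    [IsManifold (𝓡 4) ∞ M]
    (g : TensorField M 2) (hg : IsPseudoRiemannianMetric g)
    (Λ : ℝ) (hΛ : Λ ≠ 0) (hK : HasConstantCurvature g Λ)
    (e : OpenPartialHomeomorph M Coord) (he : e ∈ IsManifold.maximalAtlas (𝓡 4) ∞ M)
    (U : Set Coord) (hU : IsOpen U) (hUe : U ⊆ e.target)
    (G : Comp 2) (hG : G = g.comp e) :
    -- The metric scale is an Einstein scale: `Q = (Λ/3) g`.
    Comp.EqOn U (schouten G) (fun y I => Λ / 3 * G y I) ∧
    -- Gauge parameters `σ`: splitting operator, first BGG operator, commuting square, and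
    -- gauge invariance of the detour operators.
    (∀ σ : Comp 0, σ.SmoothOn U →
      (split₀ G σ).IsSection U ∧
      (∀ s : TractorForm 0, s.IsSection U →
        (s.EqOn U (split₀ G σ) ↔
          Comp.EqOn U s.top σ ∧ (kostant₁ (tractorCov G s)).ZeroOn U)) ∧
      Comp.EqOn U (bggOp G σ) (fun y I =>
        (1 / 2) * (symm3 (cov G (cov G (cov G σ))) y I
          + 4 * sym3 (fun a b c => schouten G y ![a, b] * cov G σ y ![c]) (I 0) (I 1) (I 2)
          + 2 * (symm3 (cov G (schouten G)) y I * σ y ![]))) ∧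
      Comp.EqOn U (bggOp G σ) (fun y I => (1 / 2) * gaugeOp G Λ σ y I) ∧
      (tractorCov G (split₀ G σ)).EqOn U (split₁ (bggOp G σ)) ∧
      (extD G (split₁ (bggOp G σ))).ZeroOn U ∧
      (detourOp G (split₁ (bggOp G σ))).ZeroOn U ∧
      Comp.ZeroOn U (bggDetour G (bggOp G σ))) ∧
    -- Potentials `ψ`: splitting operator, curvature, detour operators, Bianchi identity,
    -- constraints and the local auxiliary scalar.
    (∀ ψ : Comp 3, ψ.SmoothOn U → ψ.SymmOn U →
      (split₁ ψ).IsSection U ∧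
      (∀ Ξ : TractorForm 1, Ξ.IsSection U →
        (Ξ.EqOn U (split₁ ψ) ↔
          (kostant₁ Ξ).ZeroOn U ∧ Comp.EqOn U (proj Ξ) ψ ∧ (kostant₂ (extD G Ξ)).ZeroOn U)) ∧
      (extD G (split₁ ψ)).EqOn U
        { top := fun _ _ => 0
          mid := fun _ _ => 0
          bot := fun y I =>
            cov G ψ y ![I 2, I 3, I 0, I 1] - cov G ψ y ![I 3, I 2, I 0, I 1] } ∧
      (detourOp G (split₁ ψ)).EqOn U
        { top := fun _ _ => 0
          mid := fun y I => div G ψ y ![I 1, I 0] - cov G (tr G ψ) y ![I 1, I 0]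
          bot := fun y I =>
            -(lap G ψ y ![I 2, I 0, I 1] - cov G (div G ψ) y ![I 2, I 0, I 1]
              + 2 * Λ / 3 * sym2 (fun a b => G y ![I 2, a] * tr G ψ y ![b]) (I 0) (I 1)
              - 5 * Λ / 3 * ψ y ![I 2, I 0, I 1]) } ∧
      Comp.EqOn U (bggDetour G ψ) (fun y I =>
        -(lap G ψ y I - symm3 (cov G (div G ψ)) y I + 2 * Λ / 3 * gSym G (tr G ψ) y I
          - 5 * Λ / 3 * ψ y I)) ∧
      Comp.ZeroOn U (bggOpAdj G (bggDetour G ψ)) ∧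
      (Comp.ZeroOn U (detourOp G (split₁ ψ)).mid ↔
        (∀ y ∈ U, ∀ a b, div G ψ y ![a, b] = sym2 (fun a b => cov G (tr G ψ) y ![a, b]) a b) ∧
        (∀ y ∈ U, ∀ a b, cov G (tr G ψ) y ![a, b] = cov G (tr G ψ) y ![b, a])) ∧
      (Comp.ZeroOn U (detourOp G (split₁ ψ)).mid →
        (detourOp G (split₁ ψ)).EqOn U (split₁ (bggDetour G ψ))) ∧
      (∀ (p : Coord) (r : ℝ), Metric.ball p r ⊆ U →
        Comp.ZeroOn (Metric.ball p r) (detourOp G (split₁ ψ)).mid →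
        ∃ χ : Comp 0, χ.SmoothOn (Metric.ball p r) ∧
          Comp.EqOn (Metric.ball p r) (tr G ψ) (fun y I => -(6 / Λ) * cov G χ y I) ∧
          ((detourOp G (split₁ ψ)).ZeroOn (Metric.ball p r) →
            PMSystemOn (Metric.ball p r) G Λ (traceAdjustInv G ψ) χ)) ∧
      Comp.EqOn U (traceAdjust G (traceAdjustInv G ψ)) ψ ∧
      Comp.EqOn U (traceAdjustInv G (traceAdjust G ψ)) ψ) ∧
    -- Gauge transformations of the partially massless theory.
    (∀ ς : Comp 0, ς.SmoothOn U →
      Comp.EqOn U (traceAdjust G (pmGaugeField G Λ ς)) (gaugeOp G Λ ς) ∧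
      Comp.EqOn U (traceAdjust G (pmGaugeField G Λ ς)) (fun y I => 2 * bggOp G ς y I) ∧
      (∀ (φ : Comp 3) (χ : Comp 0), φ.SmoothOn U → φ.SymmOn U → χ.SmoothOn U →
        Comp.EqOn U (pmEq G Λ (φ + pmGaugeField G Λ ς) (χ + pmGaugeScalar G Λ ς))
          (pmEq G Λ φ χ) ∧
        Comp.EqOn U (pmAux G Λ (φ + pmGaugeField G Λ ς) (χ + pmGaugeScalar G Λ ς))
          (pmAux G Λ φ χ) ∧
        Comp.EqOn U (pmDivConstraint G Λ (φ + pmGaugeField G Λ ς) (χ + pmGaugeScalar G Λ ς))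
          (pmDivConstraint G Λ φ χ) ∧
        Comp.EqOn U (pmScalarConstraint G Λ (φ + pmGaugeField G Λ ς) (χ + pmGaugeScalar G Λ ς))
          (pmScalarConstraint G Λ φ χ))) ∧
    -- The partially massless theory against the detour complex, for `ψ = φ + ½ g ⊙ φ̄`.
    (∀ (φ : Comp 3) (χ : Comp 0) (ψ : Comp 3), φ.SmoothOn U → φ.SymmOn U → χ.SmoothOn U →
      ψ = traceAdjust G φ →
      -- integrability conditions of the partially massless equations
      (PMSystemOn U G Λ φ χ →
        Comp.ZeroOn U (pmDivConstraint G Λ φ χ) ∧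
        Comp.ZeroOn U (pmScalarConstraint G Λ φ χ)) ∧
      -- the scalar constraint identifies the auxiliary scalar
      (Comp.ZeroOn U (pmScalarConstraint G Λ φ χ) ↔
        Comp.EqOn U (tr G ψ) (fun y I => -(6 / Λ) * cov G χ y I)) ∧
      -- the divergence constraint in terms of `ψ`
      (Comp.ZeroOn U (pmScalarConstraint G Λ φ χ) →
        (Comp.ZeroOn U (pmDivConstraint G Λ φ χ) ↔
          ∀ y ∈ U, ∀ a b,
            div G ψ y ![a, b] = sym2 (fun a b => cov G (tr G ψ) y ![a, b]) a b)) ∧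
      -- modulo the constraints, the equations of motion agree
      (Comp.ZeroOn U (pmScalarConstraint G Λ φ χ) → Comp.ZeroOn U (pmDivConstraint G Λ φ χ) →
        Comp.EqOn U (pmEq G Λ φ χ) (fun y I => -bggDetour G ψ y I) ∧
        Comp.ZeroOn U (pmAux G Λ φ χ)) ∧
      -- equivalence of the two systems
      (PMSystemOn U G Λ φ χ ↔
        (detourOp G (split₁ ψ)).ZeroOn U ∧
        Comp.EqOn U (tr G ψ) (fun y I => -(6 / Λ) * cov G χ y I))) := by
  have hC : IsCurvedMetric U G Λ := hG ▸ (hg.isCurvedMetric hK he).mono hU hUe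
  refine ⟨fun y hy I => hC.schouten_eq hy I, fun σ hσ => ?_, fun ψ hψ hψs => ?_, fun ς hς => ?_,
    fun φ χ ψ hφ hφs hχ hψ => ?_⟩
  · exact ⟨hC.isSection_split₀ hσ, fun s hs => hC.eqOn_split₀_iff hσ hs, hC.bggOp_eq_schouten hσ,
      hC.bggOp_eq hσ, hC.tractorCov_split₀ hσ, hC.extD_split₁_bggOp hσ,
      hC.detourOp_split₁_bggOp hσ, hC.bggDetour_bggOp hσ⟩
  · obtain ⟨t, ht⟩ := Rep.exists_of_smoothOn hψ
    have hs := ht.sym_of_symmOn hψs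
    refine ⟨IsCurvedMetric.isSection_split₁ ht hs, fun Ξ hΞ => hC.eqOn_split₁_iff ht hs hΞ,
      hC.extD_split₁ ht hs, hC.detourOp_split₁ ht hs, hC.bggDetour_eq ht hs,
      hC.bggOpAdj_bggDetour ht hs, ?_, hC.detourOp_eqOn_split₁_bggDetour ht hs,
      fun p r hp h => ?_, hC.traceAdjust_traceAdjustInv ht, hC.traceAdjustInv_traceAdjust ht⟩
    · rw [hC.detourOp_mid_zeroOn_iff ht hs, hC.alg.detMid_eq_zero_iff hs,
        hC.divObs_eq_zero_iff ht, hC.ext₁_tr_eq_zero_iff ht]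
    · obtain ⟨t', ht'⟩ := Rep.exists_of_smoothOn (U := Metric.ball p r)
        fun I => (hψ I).mono hp
      exact (hC.mono Metric.isOpen_ball hp).exists_auxiliary_scalar ht'
        (ht'.sym_of_symmOn fun y hy => hψs y (hp hy)) hΛ (convex_ball p r) h
  · exact ⟨hC.traceAdjust_pmGaugeField hς, fun y hy I => by
      rw [hC.traceAdjust_pmGaugeField hς y hy I]
      change _ = 2 * bggOp G ς y I
      rw [hC.bggOp_eq hς y hy I]
      ring,
      fun φ χ hφ _ hχ => hC.gauge_invariance hς hΛ hφ hχ⟩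
  · subst hψ
    obtain ⟨f, hf⟩ := Rep.exists_of_smoothOn hφ
    obtain ⟨u, hu⟩ := Rep.exists_of_smoothOn hχ
    have hs := hf.sym_of_symmOn hφs
    exact ⟨hC.constraints_of_pmSystemOn hf hs hu hΛ, hC.pmScalarConstraint_zeroOn_iff hf hu hΛ,
      hC.pmDivConstraint_zeroOn_iff hf hs hu hΛ, hC.pmEq_eqOn_neg_bggDetour hf hs hu hΛ,
      hC.pmSystemOn_iff hf hs hu hΛ⟩
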